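/- **Protocol.** An LAA base station serves a user as follows. For packet $n=0,1,\dots$ the (re)transmissions $j=0,1,\dots$ are each preceded by a backoff of $\eta_j$ timeslots, where $\eta_j$ is uniform on $\{0,\dots,W_j-1\}$, with $W_j=W_L$ (fixed window) or $W_j=2^jW_L$ (variable window), $W_L\ge 1$. Each (re)transmission collides with probability $p_L\in[0,1)$. A collided (re)transmission lasts $T_{\rm c}$. After $K_L\ge1$ collided (re)transmissions the packet is dropped; otherwise its first collision-free (re)transmission lasts $T_{\rm f}$, is received in error with probability $\varepsilon_k\in[0,1]$, and delivers bits to user $k$ at rate $R_k\ge0$ while it lasts if it is received correctly. Then the next packet (or the erroneous one, afresh) begins. The duration $\tau$ of a timeslot takes the values $\sigma_{\rm idle},T_{\rm cw},T_{\rm c},T_{\rm sw},T_{\rm f},T_{\rm wl}>0$ (idle slot, WiFi collision, collision of other LAA base stations, WiFi success, success of another LAA base station, WiFi–LAA collision) with given probabilities $f(\cdot)$. All these random inputs are independent. **Theorem.** (1) The successive states of the base station, namely ON (successful collision-free transmission), OFF$_1$ (erroneous collision-free transmission), OFF$_2$ (backoffs and collisions of a packet that is eventually transmitted collision-free), OFF$_3$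 (backoffs and collisions of a packet that is dropped), with their sojourn times, form a semi-Markov process. From ON, OFF$_1$ and OFF$_3$ it moves to OFF$_2$ with probability $1-p_L^{K_L}$ and to OFF$_3$ with probability $p_L^{K_L}$; from OFF$_2$ it moves to ON with probability $1-\varepsilon_k$ and to OFF$_1$ with probability $\varepsilon_k$. The sojourn times in ON and OFF$_1$ equal $T_{\rm f}$; those in OFF$_2$ and OFF$_3$ have the laws of the total duration of backoffs and collided (re)transmissions of a packet conditional on its being delivered (transmitted collision-free), respectively dropped. Let $\hat t_1,\hat t_2$ be the probability generating functions (PGFs) $z\mapsto\mathbb E\,z^{(\cdot)}$ of these two laws. (2) Let $S_k(t)$ be the number of bits delivered to user $k$ during $(0,t]$. For every $\theta_k>0$ the effective capacity $$C_k=-\lim_{t\to\infty}\frac1{\theta_k t}\log\mathbb E\,e^{-\theta_kS_k(t)}$$ exists, and it is the unique real solution of $$(1-p_L^{K_L})\,\hat t_1(e^{\theta_kC_k})\Big[e^{(-R_k\theta_k+\theta_kC_k)T_{\rm f}}(1-\varepsilon_k)+e^{\theta_kC_kT_{\rm f}}\varepsilon_k\Big]+p_L^{K_L}\,\hat t_2(e^{\theta_kC_k})=1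 .$$ The same limit is obtained for any semi-Markov process with the above transition probabilities and sojourn laws, whatever the law of its initial state. (If $p_L=0$, the term $p_L^{K_L}\hat t_2$ is $0$.) (3) For $z>0$, $$\hat t_1(z)=\frac{\sum_{i=0}^{K_L-1}(1-p_L)p_L^i\,z^{iT_{\rm c}}\prod_{j=0}^{i}\hat\eta_j(\hat\tau(z))}{1-p_L^{K_L}},\qquad \hat t_2(z)=z^{K_LT_{\rm c}}\prod_{j=0}^{K_L-1}\hat\eta_j(\hat\tau(z))\quad(p_L>0),$$ where $\hat\eta_j(x)=\frac1{W_j}\frac{1-x^{W_j}}{1-x}$ for $x>0$, $x\ne1$, and $\hat\eta_j(1)=1$, are the PGFs of $\eta_j$, and $\hat\tau(z)=\sum_{s}f(s)z^{s}$, summed over the six kinds of timeslot, is the PGF of $\tau$. (4) If in each timeslot the $N-1$ other LAA base stations ($N\ge1$) transmit with probability $\upsilon_L$ and the $M$ WiFi nodes with probability $\upsilon_W$, all independently, then $f(\sigma_{\rm idle})=(1-\upsilon_L)^{N-1}(1-\upsilon_W)^M$, $f(T_{\rm cw})=(1-(1-\upsilon_W)^M-M\upsilon_W(1-\upsilon_W)^{M-1})(1-\upsilon_L)^{N-1}$,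 $f(T_{\rm c})=(1-\upsilon_W)^M(1-(1-\upsilon_L)^{N-1}-(N-1)\upsilon_L(1-\upsilon_L)^{N-2})$, $f(T_{\rm sw})=(1-\upsilon_L)^{N-1}M\upsilon_W(1-\upsilon_W)^{M-1}$, $f(T_{\rm f})=(1-\upsilon_W)^M(N-1)\upsilon_L(1-\upsilon_L)^{N-2}$, and $f(T_{\rm wl})$ is $1$ minus the sum of these five (a term with the factor $M=0$ or $N-1=0$ is $0$). -/

import Mathlib

open MeasureTheory ProbabilityTheory Filter Topology

noncomputable section

namespace LAA

/-! ### Parameters of the access scheme -/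

/-- Listen-before-talk with a fixed (`fcw`) or an exponentially increasing (`vcw`) contention
window. -/
inductive Scheme
  | fcw
  | vcw

/-- The six kinds of timeslot seen by a base station that is backing off: idle, collision among
WiFi nodes, collision among other LAA base stations, successful WiFi transmission, successful
transmission of another LAA base station, collision between WiFi and LAA. -/
inductive SlotKind
  | idle
  | wifiCollision
  | laaCollision
  | wifiSuccess
  | laaSuccess
  | mixedCollision
  deriving DecidableEq

instance : Fintype SlotKind where
  elems := {.idle, .wifiCollision, .laaCollision, .wifiSuccess, .laaSuccess, .mixedCollision}
  complete := by intro x; cases x <;> simp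

instance : MeasurableSpace SlotKind := ⊤

structure Params where
  scheme : Scheme
  /-- initial contention window -/
  W : ℕ
  /-- number of collided (re)transmissions after which a packet is dropped -/
  K : ℕ
  /-- collision probability of a (re)transmission -/
  p : ℝ
  /-- packet error rate of a collision-free (re)transmission -/
  ε : ℝ
  /-- instantaneous transmit rate -/
  R : ℝ
  /-- probability mass function of the kind of a timeslot -/
  slotProb : SlotKind → ℝ
  /-- duration of an idle slot -/
  sIdle : ℝ
  /-- duration of a slot with a collision among WiFi nodes -/
  Tcw : ℝ
  /-- duration of a collided (re)transmission of LAA base stations -/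
  Tc : ℝ
  /-- duration of a slot with a successful WiFi transmission -/
  Tsw : ℝ
  /-- duration of a collision-free (re)transmission of an LAA base station -/
  Tf : ℝ
  /-- duration of a slot with a collision between WiFi nodes and LAA base stations -/
  Twl : ℝ

structure Params.Valid (Q : Params) : Prop where
  W_pos : 1 ≤ Q.W
  K_pos : 1 ≤ Q.K
  p_nonneg : 0 ≤ Q.p
  p_lt_one : Q.p < 1
  ε_nonneg : 0 ≤ Q.ε
  ε_le_one : Q.ε ≤ 1
  R_nonneg : 0 ≤ Q.R
  slotProb_nonneg : ∀ k, 0 ≤ Q.slotProb k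
  slotProb_sum : ∑ k, Q.slotProb k = 1
  sIdle_pos : 0 < Q.sIdle
  Tcw_pos : 0 < Q.Tcw
  Tc_pos : 0 < Q.Tc
  Tsw_pos : 0 < Q.Tsw
  Tf_pos : 0 < Q.Tf
  Twl_pos : 0 < Q.Twl

/-- Contention window of the `j`-th (re)transmission of a packet, `j = 0, 1, …`. -/
def Params.window (Q : Params) (j : ℕ) : ℕ :=
  match Q.scheme with
  | .fcw => Q.W
  | .vcw => 2 ^ j * Q.W

/-- Duration of a timeslot of a given kind. -/
def Params.slotDuration (Q : Params) : SlotKind → ℝ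
  | .idle => Q.sIdle
  | .wifiCollision => Q.Tcw
  | .laaCollision => Q.Tc
  | .wifiSuccess => Q.Tsw
  | .laaSuccess => Q.Tf
  | .mixedCollision => Q.Twl

/-! ### The random inputs of the protocol -/

/-- Random inputs, for packets `n = 0, 1, …` (a packet that is sent again after a collision-free
but erroneous transmission starts afresh and gets a new number). -/
structure Noise (Ω : Type*) where
  /-- does the `j`-th (re)transmission of packet `n`, if it takes place, collide? -/
  collision : ℕ → ℕ → Ω → Bool
  /-- initial value of the backoff timer before the `j`-th (re)transmission of packet `n` -/
  backoff : ℕ → ℕ → Ω → ℕ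
  /-- kind of the `d`-th timeslot of that backoff -/
  slot : ℕ → ℕ → ℕ → Ω → SlotKind
  /-- is the collision-free (re)transmission of packet `n`, if any, received in error? -/
  error : ℕ → Ω → Bool

/-- Labels of all the random inputs. -/
inductive Source
  | collision (n j : ℕ)
  | backoff (n j : ℕ)
  | slot (n j d : ℕ)
  | error (n : ℕ)

def Source.Val : Source → Type
  | .collision _ _ => Bool
  | .backoff _ _ => ℕ
  | .slot _ _ _ => SlotKind
  | .error _ => Bool

instance (s : Source) : MeasurableSpace s.Val := ⊤

/-- All the random inputs, as one family. -/
def Noise.draw {Ω : Type*} (Y : Noise Ω) : (s : Source) → Ω → s.Val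
  | .collision n j => Y.collision n j
  | .backoff n j => Y.backoff n j
  | .slot n j d => Y.slot n j d
  | .error n => Y.error n

/-- The random inputs are measurable, mutually independent, and have the laws that the parameters
prescribe: collisions with probability `p`, backoff timers uniform on `[0, W_j)`, slot kinds with
probabilities `slotProb`, reception errors with probability `ε`. -/
structure Noise.IsLAA {Ω : Type*} [MeasurableSpace Ω] (Y : Noise Ω) (Q : Params) (μ : Measure Ω) :
    Prop where
  measurable : ∀ s, Measurable (Y.draw s)
  indep : iIndepFun Y.draw μ
  collision_law : ∀ n j, μ.real {ω | Y.collision n j ω = true} = Q.p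
  backoff_law : ∀ n j m, m < Q.window j →
    μ.real {ω | Y.backoff n j ω = m} = 1 / (Q.window j : ℝ)
  slot_law : ∀ n j d k, μ.real {ω | Y.slot n j d ω = k} = Q.slotProb k
  error_law : ∀ n, μ.real {ω | Y.error n ω = true} = Q.ε

/-! ### The protocol -/

section Protocol

variable {Ω : Type*} (Y : Noise Ω) (Q : Params)

/-- Number of collided (re)transmissions of packet `n`: those before the first collision-free
one, and at most `K`. -/
def Noise.collisions (n : ℕ) (ω : Ω) : ℕ :=
  sInf {j | Q.K ≤ j ∨ Y.collision n j ω = false}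

/-- Packet `n` is transmitted collision-free (with or without reception error). -/
def Noise.delivered (n : ℕ) : Set Ω := {ω | Y.collisions Q n ω < Q.K}

/-- Packet `n` is dropped after `K` collisions. -/
def Noise.dropped (n : ℕ) : Set Ω := {ω | Y.collisions Q n ω = Q.K}

/-- Total duration of the backoff before the `j`-th (re)transmission of packet `n`. -/
def Noise.backoffTime (n j : ℕ) (ω : Ω) : ℝ :=
  ∑ d ∈ Finset.range (Y.backoff n j ω), Q.slotDuration (Y.slot n j d ω)

/-- Total duration of the backoffs and collided (re)transmissions of packet `n`. With `i`
collisions there are `i + 1` backoffs if the packet is delivered (`i < K`), and `K` backoffs if it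
is dropped (`i = K`). -/
def Noise.offTime (n : ℕ) (ω : Ω) : ℝ :=
  Y.collisions Q n ω * Q.Tc
    + ∑ j ∈ Finset.range (min (Y.collisions Q n ω + 1) Q.K), Y.backoffTime Q n j ω

end Protocol

/-! ### The four states -/

/-- `off1`: collision-free but erroneous transmission; `off2`: backoffs and collisions of a packet
until its collision-free transmission; `off3`: backoffs and collisions of a packet that is dropped;
`on`: collision-free successful transmission. -/
inductive State
  | on
  | off1
  | off2
  | off3
  deriving DecidableEq

instance : MeasurableSpace State := ⊤

section States

variable {Ω : Type*} (Y : Noise Ω) (Q : Params)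

open Classical in
/-- What the base station does in its `m`-th state: the number of the packet, and whether it is in
its collision-free transmission (`true`) or in its backoffs and collisions (`false`). -/
def Noise.phase (ω : Ω) : ℕ → ℕ × Bool
  | 0 => (0, false)
  | m + 1 =>
    if (Noise.phase ω m).2 = false ∧ ω ∈ Y.delivered Q (Noise.phase ω m).1 then
      ((Noise.phase ω m).1, true)
    else ((Noise.phase ω m).1 + 1, false)

open Classical in
/-- The `m`-th state visited. -/
def Noise.state (m : ℕ) (ω : Ω) : State :=
  if (Y.phase Q ω m).2 = true then
    if Y.error (Y.phase Q ω m).1 ω = true then .off1 else .on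
  else
    if ω ∈ Y.delivered Q (Y.phase Q ω m).1 then .off2 else .off3

/-- The time spent in the `m`-th state visited. -/
def Noise.sojourn (m : ℕ) (ω : Ω) : ℝ :=
  if (Y.phase Q ω m).2 = true then Q.Tf else Y.offTime Q (Y.phase Q ω m).1 ω

end States

/-- Transition probabilities of the four-state model. -/
def Params.transition (Q : Params) : Matrix State State ℝ
  | .off2, .on => 1 - Q.ε
  | .off2, .off1 => Q.ε
  | .off2, _ => 0
  | _, .off2 => 1 - Q.p ^ Q.K
  | _, .off3 => Q.p ^ Q.K
  | _, _ => 0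

/-- Sojourn time laws of the four-state model: `Tf` in the two transmission states, and in `off2`
and `off3` the conditional law of the backoffs and collisions of a packet, given that it is
delivered, and given that it is dropped. -/
def Noise.sojournLaw {Ω : Type*} [MeasurableSpace Ω] (Y : Noise Ω) (Q : Params) (μ : Measure Ω) :
    State → Measure ℝ
  | .on => Measure.dirac Q.Tf
  | .off1 => Measure.dirac Q.Tf
  | .off2 => (cond μ (Y.delivered Q 0)).map (Y.offTime Q 0)
  | .off3 => (cond μ (Y.dropped Q 0)).map (Y.offTime Q 0)

/-- The visited states `X 0, X 1, …` with sojourn times `D 0, D 1, …` form a semi-Markov process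
with transition matrix `P`, where the sojourn time in a state `x` has law `F x` independently of
everything else. The initial law is arbitrary. -/
structure IsSemiMarkov {Ω : Type*} [MeasurableSpace Ω] (μ : Measure Ω) (P : Matrix State State ℝ)
    (F : State → Measure ℝ) (X : ℕ → Ω → State) (D : ℕ → Ω → ℝ) : Prop where
  measurable_state : ∀ n, Measurable (X n)
  measurable_sojourn : ∀ n, Measurable (D n)
  law : ∀ (n : ℕ) (x : ℕ → State) (A : ℕ → Set ℝ), (∀ i, MeasurableSet (A i)) →
    μ.real {ω | ∀ i ≤ n, X i ω = x i ∧ D i ω ∈ A i} =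
      μ.real {ω | X 0 ω = x 0} * (∏ i ∈ Finset.range n, P (x i) (x (i + 1)))
        * ∏ i ∈ Finset.range (n + 1), (F (x i)).real (A i)

/-! ### Service and effective capacity -/

section Service

variable {Ω : Type*} (X : ℕ → Ω → State) (D : ℕ → Ω → ℝ)

/-- The time at which the `n`-th state is entered. -/
def jumpTime (n : ℕ) (ω : Ω) : ℝ := ∑ i ∈ Finset.range n, D i ω

/-- The state at time `t`. -/
def stateAt (t : ℝ) (ω : Ω) : State := X (sInf {n : ℕ | t < jumpTime D (n + 1) ω}) ω

/-- Number of bits delivered during `(0, t]`: rate `R` while in state `on`. -/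
def service (R t : ℝ) (ω : Ω) : ℝ :=
  R * volume.real {s | s ∈ Set.Ioc 0 t ∧ stateAt X D s ω = State.on}

end Service

/-- `C` is the effective capacity, at QoS exponent `θ`, of the cumulative service `S`; that is,
`C = - lim_{t → ∞} (1 / (θ t)) log E[exp (- θ S(t))]`, the limit existing. -/
def HasEffectiveCapacity {Ω : Type*} [MeasurableSpace Ω] (μ : Measure Ω) (S : ℝ → Ω → ℝ)
    (θ C : ℝ) : Prop :=
  Tendsto (fun t : ℝ => -(1 / (θ * t) * Real.log (∫ ω, Real.exp (-θ * S t ω) ∂μ))) atTop (𝓝 C)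

/-! ### Probability generating functions -/

/-- Probability generating function `z ↦ E[z ^ V]` of a real random variable. -/
def pgf {Ω : Type*} [MeasurableSpace Ω] (μ : Measure Ω) (V : Ω → ℝ) (z : ℝ) : ℝ :=
  ∫ ω, z ^ V ω ∂μ

/-- PGF of the total duration of backoffs and collisions of a delivered packet. -/
def Noise.t1Hat {Ω : Type*} [MeasurableSpace Ω] (Y : Noise Ω) (Q : Params) (μ : Measure Ω)
    (z : ℝ) : ℝ :=
  pgf (cond μ (Y.delivered Q 0)) (Y.offTime Q 0) z

/-- PGF of the total duration of backoffs and collisions of a dropped packet. -/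
def Noise.t2Hat {Ω : Type*} [MeasurableSpace Ω] (Y : Noise Ω) (Q : Params) (μ : Measure Ω)
    (z : ℝ) : ℝ :=
  pgf (cond μ (Y.dropped Q 0)) (Y.offTime Q 0) z

/-- PGF of the backoff timer before the `j`-th (re)transmission. -/
def Noise.etaHat {Ω : Type*} [MeasurableSpace Ω] (Y : Noise Ω) (μ : Measure Ω) (j : ℕ)
    (z : ℝ) : ℝ :=
  pgf μ (fun ω => (Y.backoff 0 j ω : ℝ)) z

/-- PGF of the duration of a timeslot. -/
def Noise.tauHat {Ω : Type*} [MeasurableSpace Ω] (Y : Noise Ω) (Q : Params) (μ : Measure Ω)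
    (z : ℝ) : ℝ :=
  pgf μ (fun ω => Q.slotDuration (Y.slot 0 0 0 ω)) z

/-- The equation for the effective capacity. -/
def Noise.CapacityEquation {Ω : Type*} [MeasurableSpace Ω] (Y : Noise Ω) (Q : Params)
    (μ : Measure Ω) (θ C : ℝ) : Prop :=
  (1 - Q.p ^ Q.K) * Y.t1Hat Q μ (Real.exp (θ * C))
      * (Real.exp ((-Q.R * θ + θ * C) * Q.Tf) * (1 - Q.ε) + Real.exp (θ * C * Q.Tf) * Q.ε)
    + Q.p ^ Q.K * Y.t2Hat Q μ (Real.exp (θ * C)) = 1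

/-! ### Timeslots in a network without hidden nodes -/

/-- Kind of a timeslot in which `a` other LAA base stations and `b` WiFi nodes transmit. -/
def slotKind (a b : ℕ) : SlotKind :=
  if a = 0 then (if b = 0 then .idle else if b = 1 then .wifiSuccess else .wifiCollision)
  else if b = 0 then (if a = 1 then .laaSuccess else .laaCollision)
  else .mixedCollision

/-- Probability that a timeslot is of kind `k` when each of the `N - 1` other LAA base stations
transmits with probability `vL` and each of the `M` WiFi nodes with probability `vW`,
all independently. -/
def contentionProb (N M : ℕ) (vL vW : ℝ) (k : SlotKind) : ℝ :=
  ∑ A : Finset (Fin (N - 1)), ∑ B : Finset (Fin M),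
    if slotKind A.card B.card = k then
      (vL ^ A.card * (1 - vL) ^ (N - 1 - A.card)) * (vW ^ B.card * (1 - vW) ^ (M - B.card))
    else 0

end LAA

end

namespace LAA

open scoped ENNReal

/-! Put `l = θ * C` and weight each path by `growth`, the exponential of `l` times the elapsed time
minus `R * θ` times the time spent in `on`. If a nonnegative function `h` on the states satisfies
`IsHarmonic`, that is, `h x` is the mean weight of a visit to `x` times the mean of `h` at the next
state, then `growth` at the `n`-th jump times `h (X n)` is a martingale. Stop it at the first jump
after `t`. Sojourns are bounded and `h` lies between positive constants on the states actually
visited, so the stopped value agrees with `exp (l * t) * exp (-θ * S t)` up to constant factors.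
Hence the expectation of `exp (-θ * S t)` is of exact order `exp (-l * t)`, and the effective
capacity is `l / θ`. Only the Markov property enters (`IsSemiMarkov.setLIntegral_mul`), so the
initial law is irrelevant and no spectral theory is needed.

The capacity equation is the condition for such an `h` to exist. From `on`, `off1` and `off3` the
chain moves according to the same law, that of a fresh packet. Normalising the mean of `h` under
this law to be 1 determines `h` on all four states (`Noise.potential`), and the normalisation itself
then reads `cyclePgf θ l = 1` (`Noise.IsLAA.isHarmonic`). The function `cyclePgf θ` is continuous
and strictly increasing, at most 1 at `0` and at least 1 at `R * θ`, so there is exactly one root.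

The protocol is semi-Markov because it regenerates at each packet: after packet `0`, which takes one
state if dropped and two if delivered, the path is that of the same protocol driven by `Y.shift`,
which is independent of packet `0` and has the same law as `Y`. Cylinder probabilities follow by
induction (`Noise.IsLAA.measureReal_cylinder`).

The generating functions come from independence: given the number of collisions, the off time is a
constant plus a fixed number of independent backoffs, and each backoff is a random sum of
independent slots.

When `p = 0` the law of `off3` is the zero measure. `ProperLaws` allows this, and `off3` is then
almost surely never visited. -/

instance : Fintype State where
  elems := {.on, .off1, .off2, .off3}
  complete := by intro x; cases x <;> simp

/-! ### The Markov property of a semi-Markov process -/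

section Markov

variable {Ω : Type*} {X : ℕ → Ω → State} {D : ℕ → Ω → ℝ}

/-- The event that the first `n` states are prescribed and the first `n` sojourn times lie in
prescribed sets. -/
def cylinder (X : ℕ → Ω → State) (D : ℕ → Ω → ℝ) (n : ℕ) (x : ℕ → State) (A : ℕ → Set ℝ) : Set Ω :=
  {ω | ∀ i < n, X i ω = x i ∧ D i ω ∈ A i}

def cylinders (X : ℕ → Ω → State) (D : ℕ → Ω → ℝ) (n : ℕ) : Set (Set Ω) :=
  {s | ∃ x A, (∀ i, MeasurableSet (A i)) ∧ s = cylinder X D n x A}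

/-- The σ-algebra of the first `n` states and sojourn times. -/
@[reducible] def past (X : ℕ → Ω → State) (D : ℕ → Ω → ℝ) (n : ℕ) : MeasurableSpace Ω :=
  MeasurableSpace.generateFrom (cylinders X D n)

/-- Two cylinders that meet must prescribe the same first `n` states, so only the sets of sojourn
times have to be intersected. -/
lemma isPiSystem_cylinders (n : ℕ) : IsPiSystem (cylinders X D n) := by
  rintro _ ⟨x, A, hA, rfl⟩ _ ⟨y, B, hB, rfl⟩ ⟨ω, hx, hy⟩
  refine ⟨x, fun i => A i ∩ B i, fun i => (hA i).inter (hB i), ?_⟩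
  ext ω'
  constructor
  · rintro ⟨h1, h2⟩ i hi
    exact ⟨(h1 i hi).1, (h1 i hi).2, (h2 i hi).2⟩
  · intro h
    refine ⟨fun i hi => ⟨(h i hi).1, (h i hi).2.1⟩, fun i hi => ⟨?_, (h i hi).2.2⟩⟩
    rw [(h i hi).1, ← (hx i hi).1, (hy i hi).1]

/-- Extension of a finite sequence of states. -/
def extendPath {n : ℕ} (z : Fin n → State) (i : ℕ) : State :=
  if h : i < n then z ⟨i, h⟩ else .on

/-- A generator prescribes all of the first `n` states at once; an event about one index is a finite
union of generators over all paths through `y` at that index. -/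
lemma measurableSet_past_state_sojourn {n i : ℕ} (hi : i < n) (y : State) {A : Set ℝ}
    (hA : MeasurableSet A) : MeasurableSet[past X D n] {ω | X i ω = y ∧ D i ω ∈ A} := by
  have : {ω | X i ω = y ∧ D i ω ∈ A} = ⋃ z : Fin n → State, ⋃ _ : z ⟨i, hi⟩ = y,
      cylinder X D n (extendPath z) (Function.update (fun _ => Set.univ) i A) := by
    ext ω
    simp only [Set.mem_ofPred_eq, Set.mem_iUnion, cylinder, exists_prop]
    constructor
    · rintro ⟨h1, h2⟩
      refine ⟨fun j => X j ω, h1, fun j hj => ⟨by simp [extendPath, hj], ?_⟩⟩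
      rcases eq_or_ne j i with rfl | hji
      · simpa using h2
      · simp [hji]
    · rintro ⟨z, hz, h⟩
      have := h i hi
      simp only [extendPath, hi, dif_pos, hz, Function.update_self] at this
      exact this
  rw [this]
  refine MeasurableSet.iUnion fun z => MeasurableSet.iUnion fun _ =>
    MeasurableSpace.measurableSet_generateFrom ⟨_, _, fun j => ?_, rfl⟩
  rcases eq_or_ne j i with rfl | hji
  · simpa using hA
  · simp [hji]

lemma measurable_past_state {n i : ℕ} (hi : i < n) : Measurable[past X D n] (X i) := by
  refine @measurable_to_countable' _ _ _ _ (past X D n) _ fun y => ?_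
  convert measurableSet_past_state_sojourn (X := X) (D := D) hi y MeasurableSet.univ using 1
  ext; simp

lemma measurable_past_sojourn {n i : ℕ} (hi : i < n) : Measurable[past X D n] (D i) := by
  intro A hA
  have : D i ⁻¹' A = ⋃ y, {ω | X i ω = y ∧ D i ω ∈ A} := by ext; simp
  rw [this]
  exact MeasurableSet.iUnion fun y => measurableSet_past_state_sojourn hi y hA

/-- Supplies the countable cover by generators required when two measures on `past` are identified
through the π-system of cylinders. -/
lemma iUnion_cylinder (n : ℕ) :
    ⋃ z : Fin n → State, cylinder X D n (extendPath z) (fun _ => Set.univ) = Set.univ := by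
  refine Set.eq_univ_of_forall fun ω => Set.mem_iUnion.2 ⟨fun j => X j ω, fun i hi => ?_⟩
  simp [extendPath, hi]

variable [mΩ : MeasurableSpace Ω] {μ : Measure Ω} {P : Matrix State State ℝ} {F : State → Measure ℝ}

lemma measurableSet_cylinder (hX : ∀ n, Measurable (X n)) (hD : ∀ n, Measurable (D n)) (n : ℕ)
    (x : ℕ → State) {A : ℕ → Set ℝ} (hA : ∀ i, MeasurableSet (A i)) :
    MeasurableSet (cylinder X D n x A) := by
  have : cylinder X D n x A = ⋂ i, ⋂ _ : i < n, (X i ⁻¹' {x i} ∩ D i ⁻¹' A i) := by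
    ext; simp [cylinder]
  rw [this]
  exact MeasurableSet.iInter fun i => MeasurableSet.iInter fun _ =>
    (hX i (measurableSet_singleton _)).inter (hD i (hA i))

lemma past_le (hX : ∀ n, Measurable (X n)) (hD : ∀ n, Measurable (D n)) (n : ℕ) :
    past X D n ≤ mΩ := by
  refine MeasurableSpace.generateFrom_le ?_
  rintro _ ⟨x, A, hA, rfl⟩
  exact measurableSet_cylinder hX hD n x hA

/-- Sojourn laws are probability measures, except that a state which is never entered may have
the zero measure. -/
def ProperLaws (P : Matrix State State ℝ) (F : State → Measure ℝ) : Prop :=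
  (∀ x y, 0 ≤ P x y) ∧
    ∀ y, IsProbabilityMeasure (F y) ∨ (F y = 0 ∧ ∀ x, P x y = 0)

lemma ProperLaws.isFiniteMeasure (h : ProperLaws P F) (y : State) : IsFiniteMeasure (F y) := by
  rcases h.2 y with h | h
  · infer_instance
  · rw [h.1]; infer_instance

variable [IsProbabilityMeasure μ]

/-- Both events are instances of `law`, one index apart, with unconstrained coordinates filled by
`Set.univ`. The two products differ by `P x y * F x B`, apart from the total masses of `F x` and `F
y`. -/
lemma IsSemiMarkov.measure_cylinder_inter (h : IsSemiMarkov μ P F X D) (hF : ProperLaws P F) (n : ℕ)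
    (z : ℕ → State) {A : ℕ → Set ℝ} (hA : ∀ i, MeasurableSet (A i)) (x y : State) {B : Set ℝ}
    (hB : MeasurableSet B) :
    μ (cylinder X D n z A ∩ {ω | X n ω = x ∧ D n ω ∈ B ∧ X (n + 1) ω = y}) =
      ENNReal.ofReal (P x y) * F x B * μ (cylinder X D n z A ∩ {ω | X n ω = x}) := by
  have := hF.isFiniteMeasure
  set z1 : ℕ → State := fun i => if i < n then z i else if i = n then x else y with hz1
  set A1 : ℕ → Set ℝ := fun i => if i < n then A i else if i = n then B else Set.univ with hA1
  set A2 : ℕ → Set ℝ := fun i => if i < n then A i else Set.univ with hA2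
  have hA1m : ∀ i, MeasurableSet (A1 i) := by
    intro i; simp only [hA1]; split_ifs <;> simp [hA, hB]
  have hA2m : ∀ i, MeasurableSet (A2 i) := by
    intro i; simp only [hA2]; split_ifs <;> simp [hA]
  have e1 : cylinder X D n z A ∩ {ω | X n ω = x ∧ D n ω ∈ B ∧ X (n + 1) ω = y} =
      {ω | ∀ i ≤ n + 1, X i ω = z1 i ∧ D i ω ∈ A1 i} := by
    ext ω
    simp only [cylinder, Set.mem_inter_iff, Set.mem_ofPred_eq]
    constructor
    · rintro ⟨h1, h2, h3, h4⟩ i hi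
      rcases lt_trichotomy i n with hin | rfl | hin
      · simpa [hz1, hA1, hin] using h1 i hin
      · simp [hz1, hA1, h2, h3]
      · obtain rfl : i = n + 1 := by omega
        simp [hz1, hA1, h4]
    · intro h
      refine ⟨fun i hi => by simpa [hz1, hA1, hi] using h i (by omega), ?_⟩
      have h1 := h n (by omega)
      have h2 := h (n + 1) le_rfl
      simp [hz1, hA1] at h1 h2
      exact ⟨h1.1, h1.2, h2⟩
  have e2 : cylinder X D n z A ∩ {ω | X n ω = x} =
      {ω | ∀ i ≤ n, X i ω = z1 i ∧ D i ω ∈ A2 i} := by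
    ext ω
    simp only [cylinder, Set.mem_inter_iff, Set.mem_ofPred_eq]
    constructor
    · rintro ⟨h1, h2⟩ i hi
      rcases hi.lt_or_eq with hin | rfl
      · simpa [hz1, hA2, hin] using h1 i hin
      · simp [hz1, hA2, h2]
    · intro h
      refine ⟨fun i hi => by simpa [hz1, hA2, hi] using h i (by omega), ?_⟩
      have h1 := h n (by omega)
      simpa [hz1, hA2] using h1
  have key : μ.real {ω | ∀ i ≤ n + 1, X i ω = z1 i ∧ D i ω ∈ A1 i} =
      P x y * (F x).real B * μ.real {ω | ∀ i ≤ n, X i ω = z1 i ∧ D i ω ∈ A2 i} := by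
    rw [h.law _ _ _ hA1m, h.law _ _ _ hA2m, Finset.prod_range_succ (n := n),
      Finset.prod_range_succ (n := n + 1), Finset.prod_range_succ (n := n) (f := fun i =>
        (F (z1 i)).real (A1 i)),
      Finset.prod_range_succ (n := n) (f := fun i => (F (z1 i)).real (A2 i))]
    have : ∏ i ∈ Finset.range n, (F (z1 i)).real (A1 i) =
        ∏ i ∈ Finset.range n, (F (z1 i)).real (A2 i) := by
      refine Finset.prod_congr rfl fun i hi => ?_
      simp [hA1, hA2, Finset.mem_range.1 hi]
    rw [this]
    have e3 : z1 n = x := by simp [hz1]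
    have e4 : z1 (n + 1) = y := by simp [hz1]
    have e5 : A1 n = B := by simp [hA1]
    have e6 : A1 (n + 1) = Set.univ := by simp [hA1]
    have e7 : A2 n = Set.univ := by simp [hA2]
    rw [e3, e4, e5, e6, e7]
    -- The mass of `F y` is 1 unless `F y` is zero, and in that case `P x y = 0`.
    have e8 : P x y * (F y).real Set.univ = P x y := by
      rcases hF.2 y with hy | hy
      · simp
      · simp [hy.2]
    -- If `F x` is the zero measure, both sides vanish.
    have e9 : (F x).real B * (F x).real Set.univ = (F x).real B := by
      rcases hF.2 x with hx | hx
      · simp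
      · simp [hx.1]
    linear_combination (μ.real {ω | X 0 ω = z1 0} *
      (∏ i ∈ Finset.range n, P (z1 i) (z1 (i + 1))) * (∏ i ∈ Finset.range n, (F (z1 i)).real (A2 i)))
      * ((F x).real B * e8 - P x y * e9)
  rw [e1, e2, ← ENNReal.ofReal_toReal (measure_ne_top μ _),
    ← ENNReal.ofReal_toReal (measure_ne_top (F x) B),
    ← ENNReal.ofReal_toReal (measure_ne_top μ {ω | ∀ i ≤ n, X i ω = z1 i ∧ D i ω ∈ A2 i}),
    ← ENNReal.ofReal_mul (hF.1 x y),
    ← ENNReal.ofReal_mul (mul_nonneg (hF.1 x y) ENNReal.toReal_nonneg)]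
  exact congrArg _ key

/-- As functions of an event of `past X D n`, both sides are finite measures. They agree on
cylinders, a generating π-system, hence on all past events and all past-measurable integrands. -/
lemma IsSemiMarkov.setLIntegral_past (h : IsSemiMarkov μ P F X D) (hF : ProperLaws P F) (n : ℕ)
    (x y : State) {B : Set ℝ} (hB : MeasurableSet B) {Φ : Ω → ℝ≥0∞}
    (hΦ : Measurable[past X D n] Φ) :
    ∫⁻ ω in {ω | X n ω = x ∧ D n ω ∈ B ∧ X (n + 1) ω = y}, Φ ω ∂μ =
      ENNReal.ofReal (P x y) * F x B * ∫⁻ ω in {ω | X n ω = x}, Φ ω ∂μ := by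
  have := hF.isFiniteMeasure
  have hle := past_le h.measurable_state h.measurable_sojourn n
  have key : (μ.restrict {ω | X n ω = x ∧ D n ω ∈ B ∧ X (n + 1) ω = y}).trim hle =
      (ENNReal.ofReal (P x y) * F x B) • (μ.restrict {ω | X n ω = x}).trim hle := by
    refine Measure.ext_of_generateFrom_of_cover_subset (S := cylinders X D n)
      (T := Set.range fun z : Fin n → State => cylinder X D n (extendPath z) fun _ => Set.univ)
      rfl (isPiSystem_cylinders n) ?_ (Set.countable_range _) ?_ ?_ ?_
    · rintro _ ⟨z, rfl⟩
      exact ⟨_, _, fun _ => MeasurableSet.univ, rfl⟩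
    · rw [Set.sUnion_range]; exact iUnion_cylinder n
    · intro s _
      have : IsFiniteMeasure ((μ.restrict {ω | X n ω = x ∧ D n ω ∈ B ∧ X (n + 1) ω = y}).trim hle) :=
        isFiniteMeasure_trim hle
      exact measure_ne_top _ _
    · intro s hs
      have hs' : MeasurableSet[past X D n] s := MeasurableSpace.measurableSet_generateFrom hs
      rw [Measure.smul_apply, trim_measurableSet_eq hle hs', trim_measurableSet_eq hle hs',
        Measure.restrict_apply (hle _ hs'), Measure.restrict_apply (hle _ hs'), smul_eq_mul]
      obtain ⟨z, A, hA, rfl⟩ := hs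
      exact h.measure_cylinder_inter hF n z hA x y hB
  rw [← lintegral_trim hle hΦ, key, lintegral_smul_measure, lintegral_trim hle hΦ, smul_eq_mul]

/-- The Markov property. -/
lemma IsSemiMarkov.setLIntegral_mul (h : IsSemiMarkov μ P F X D) (hF : ProperLaws P F) (n : ℕ)
    (x y : State) {Φ : Ω → ℝ≥0∞} (hΦ : Measurable[past X D n] Φ) {g : ℝ → ℝ≥0∞}
    (hg : Measurable g) :
    ∫⁻ ω in {ω | X n ω = x ∧ X (n + 1) ω = y}, Φ ω * g (D n ω) ∂μ =
      ENNReal.ofReal (P x y) * (∫⁻ d, g d ∂F x) * ∫⁻ ω in {ω | X n ω = x}, Φ ω ∂μ := by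
  have hle := past_le h.measurable_state h.measurable_sojourn n
  have hΦ' : Measurable Φ := hΦ.mono hle le_rfl
  have hD := h.measurable_sojourn n
  have hE : MeasurableSet {ω | X n ω = x ∧ X (n + 1) ω = y} :=
    (h.measurable_state n (measurableSet_singleton x)).inter
      (h.measurable_state (n + 1) (measurableSet_singleton y))
  -- With `Φ` absorbed as a density, the law of `D n` on this event is a multiple of `F x`;
  -- integrating `g` against it gives the claim.
  have key : ((μ.withDensity Φ).restrict {ω | X n ω = x ∧ X (n + 1) ω = y}).map (D n) =
      (ENNReal.ofReal (P x y) * ∫⁻ ω in {ω | X n ω = x}, Φ ω ∂μ) • F x := by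
    ext B hB
    rw [Measure.map_apply hD hB, Measure.restrict_apply (hD hB),
      withDensity_apply _ ((hD hB).inter hE), Measure.smul_apply, smul_eq_mul]
    have : D n ⁻¹' B ∩ {ω | X n ω = x ∧ X (n + 1) ω = y} =
        {ω | X n ω = x ∧ D n ω ∈ B ∧ X (n + 1) ω = y} := by
      ext ω; simp only [Set.mem_inter_iff, Set.mem_preimage, Set.mem_ofPred_eq]; tauto
    rw [this, h.setLIntegral_past hF n x y hB hΦ]
    ring
  have := congrArg (fun ν => ∫⁻ d, g d ∂ν) key
  simp only [lintegral_smul_measure, smul_eq_mul] at this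
  rw [lintegral_map hg hD] at this
  have h2 := setLIntegral_withDensity_eq_setLIntegral_mul μ hΦ' (hg.comp hD) hE
  simp only [Pi.mul_apply, Function.comp_def] at h2
  rw [← h2, this]
  ring

end Markov

/-! ### Service during a busy period -/

section Service

variable {Ω : Type*} {X : ℕ → Ω → State} {D : ℕ → Ω → ℝ}

/-- Time spent in `on` during the first `n` states. -/
noncomputable def onTime (X : ℕ → Ω → State) (D : ℕ → Ω → ℝ) (n : ℕ) (ω : Ω) : ℝ :=
  ∑ i ∈ Finset.range n, if X i ω = .on then D i ω else 0

lemma jumpTime_succ (n : ℕ) (ω : Ω) : jumpTime D (n + 1) ω = jumpTime D n ω + D n ω :=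
  Finset.sum_range_succ _ _

lemma onTime_succ (n : ℕ) (ω : Ω) :
    onTime X D (n + 1) ω = onTime X D n ω + if X n ω = .on then D n ω else 0 :=
  Finset.sum_range_succ _ _

lemma jumpTime_mono {ω : Ω} (hD : ∀ n, 0 ≤ D n ω) : Monotone fun n => jumpTime D n ω :=
  monotone_nat_of_le_succ fun n => by rw [jumpTime_succ]; linarith [hD n]

lemma stateAt_eq {ω : Ω} (hD : ∀ n, 0 ≤ D n ω) {n : ℕ} {s : ℝ} (h1 : jumpTime D n ω ≤ s)
    (h2 : s < jumpTime D (n + 1) ω) : stateAt X D s ω = X n ω := by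
  have : IsLeast {n : ℕ | s < jumpTime D (n + 1) ω} n := by
    refine ⟨h2, fun m hm => ?_⟩
    by_contra! hmn
    exact (lt_of_lt_of_le hm ((jumpTime_mono hD (show m + 1 ≤ n from hmn)).trans h1)).false
  rw [stateAt, this.csInf_eq]

/-- The intervals between successive jumps are half-open and the state is constant on each, so each
adds its full length or nothing. -/
lemma volume_on_Ico {ω : Ω} (hD : ∀ n, 0 ≤ D n ω) (n : ℕ) :
    volume {s | s ∈ Set.Ico 0 (jumpTime D n ω) ∧ stateAt X D s ω = .on} =
      ENNReal.ofReal (onTime X D n ω) := by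
  induction n with
  | zero => simp [jumpTime, onTime]
  | succ n ih =>
    have h0 : 0 ≤ jumpTime D n ω := Finset.sum_nonneg fun i _ => hD i
    have hon : 0 ≤ onTime X D n ω := Finset.sum_nonneg fun i _ => by split_ifs <;> simp [hD]
    have hE : {s | s ∈ Set.Ico 0 (jumpTime D (n + 1) ω) ∧ stateAt X D s ω = .on} =
        {s | s ∈ Set.Ico 0 (jumpTime D n ω) ∧ stateAt X D s ω = .on} ∪
          (if X n ω = .on then Set.Ico (jumpTime D n ω) (jumpTime D (n + 1) ω) else ∅) := by
      ext s
      have hmono := jumpTime_mono hD n.le_succ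
      simp only [Set.mem_union, Set.mem_ofPred_eq, Set.mem_Ico]
      rcases lt_or_ge s (jumpTime D n ω) with hs | hs
      · have : s < jumpTime D (n + 1) ω := hs.trans_le hmono
        split_ifs <;> simp [hs, this]
      · constructor
        · rintro ⟨⟨_, h2⟩, h3⟩
          rw [stateAt_eq hD hs h2] at h3
          right; simp [h3, hs, h2]
        · rintro (⟨⟨_, h⟩, _⟩ | h)
          · exact absurd h (not_lt.2 hs)
          · split_ifs at h with hX
            · exact ⟨⟨h0.trans hs, h.2⟩, by rw [stateAt_eq hD hs h.2, hX]⟩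
            · exact absurd h (Set.notMem_empty s)
    rw [hE, measure_union, ih, onTime_succ]
    · split_ifs with hX
      · rw [Real.volume_Ico, ENNReal.ofReal_add hon (hD n), jumpTime_succ, add_sub_cancel_left]
      · simp
    · rw [Set.disjoint_left]
      rintro s ⟨⟨_, h⟩, _⟩ h2
      split_ifs at h2
      · exact absurd h (not_lt.2 h2.1)
      · exact h2
    · split_ifs <;> simp

/-- The time spent in `on` during `(0, t]`. -/
noncomputable def onDuration (X : ℕ → Ω → State) (D : ℕ → Ω → ℝ) (t : ℝ) (ω : Ω) : ℝ :=
  volume.real {s | s ∈ Set.Ioc 0 t ∧ stateAt X D s ω = State.on}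

/-- With `onDuration_le_onTime`, this encloses the time in `on` up to `t` between its values at the
jumps just before and just after `t`. -/
lemma onTime_le_onDuration {ω : Ω} (hD : ∀ n, 0 ≤ D n ω) {n : ℕ} {t : ℝ}
    (ht : jumpTime D n ω ≤ t) : onTime X D n ω ≤ onDuration X D t ω := by
  have hon : 0 ≤ onTime X D n ω := Finset.sum_nonneg fun i _ => by split_ifs <;> simp [hD]
  have hfin : volume {s | s ∈ Set.Ioc 0 t ∧ stateAt X D s ω = State.on} ≠ ∞ :=
    measure_ne_top_of_subset (fun s hs => hs.1) (by simp : volume (Set.Ioc 0 t) ≠ ∞)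
  rw [onDuration, measureReal_def, ← ENNReal.toReal_ofReal hon]
  refine ENNReal.toReal_mono hfin ?_
  rw [← volume_on_Ico hD n]
  have h0 : volume ({0} : Set ℝ) = 0 := by simp
  -- `volume_on_Ico` includes the instant `0`, which `onDuration` excludes; it is a null set.
  refine measure_mono_ae ?_
  filter_upwards [measure_eq_zero_iff_ae_notMem.1 h0] with s hs h
  exact ⟨⟨lt_of_le_of_ne h.1.1 (fun h => hs (by simp [h.symm])), h.1.2.le.trans ht⟩, h.2⟩

lemma onDuration_le_onTime {ω : Ω} (hD : ∀ n, 0 ≤ D n ω) {n : ℕ} {t : ℝ}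
    (ht : t < jumpTime D n ω) : onDuration X D t ω ≤ onTime X D n ω := by
  have hon : 0 ≤ onTime X D n ω := Finset.sum_nonneg fun i _ => by split_ifs <;> simp [hD]
  refine ENNReal.toReal_le_of_le_ofReal hon ?_
  rw [← volume_on_Ico hD n]
  exact measure_mono fun s hs => ⟨⟨hs.1.1.le, hs.1.2.trans_lt ht⟩, hs.2⟩

variable [MeasurableSpace Ω]

lemma measurable_jumpTime (hD : ∀ n, Measurable (D n)) (n : ℕ) : Measurable (jumpTime D n) :=
  Finset.measurable_fun_sum _ fun i _ => hD i

/-- Measurability jointly in path and time makes the length of a time section a measurable function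
of the path. -/
lemma measurable_stateAt (hX : ∀ n, Measurable (X n)) (hD : ∀ n, Measurable (D n)) :
    Measurable fun p : Ω × ℝ => stateAt X D p.2 p.1 := by
  have hA : ∀ n, MeasurableSet {p : Ω × ℝ | p.2 < jumpTime D (n + 1) p.1} := fun n =>
    measurableSet_lt measurable_snd ((measurable_jumpTime hD _).comp measurable_fst)
  have hN : Measurable fun p : Ω × ℝ => sInf {n : ℕ | p.2 < jumpTime D (n + 1) p.1} := by
    refine measurable_to_countable' fun n => ?_
    have : (fun p : Ω × ℝ => sInf {n : ℕ | p.2 < jumpTime D (n + 1) p.1}) ⁻¹' {n} =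
        ({p : Ω × ℝ | p.2 < jumpTime D (n + 1) p.1} ∩
          ⋂ m, ⋂ _ : m < n, {p : Ω × ℝ | p.2 < jumpTime D (m + 1) p.1}ᶜ) ∪
        -- If no jump time exceeds `p.2`, the infimum is that of the empty set, which is `0`.
        (if n = 0 then ⋂ m, {p : Ω × ℝ | p.2 < jumpTime D (m + 1) p.1}ᶜ else ∅) := by
      ext p
      simp only [Set.mem_preimage, Set.mem_singleton_iff, Set.mem_union, Set.mem_inter_iff,
        Set.mem_iInter, Set.mem_compl_iff]
      constructor
      · rintro rfl
        rcases Set.eq_empty_or_nonempty {n : ℕ | p.2 < jumpTime D (n + 1) p.1} with h | h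
        · right
          rw [h, Nat.sInf_empty, if_pos rfl]
          simp only [Set.mem_iInter]
          exact fun m hm => Set.notMem_empty m (h ▸ hm)
        · exact Or.inl ⟨Nat.sInf_mem h, fun m hm => Nat.notMem_of_lt_sInf hm⟩
      · rintro (⟨h1, h2⟩ | h)
        · refine IsLeast.csInf_eq ⟨h1, fun m hm => ?_⟩
          by_contra! hmn
          exact h2 m hmn hm
        · split_ifs at h with hn
          · rw [hn, Nat.sInf_eq_zero]
            right
            exact Set.eq_empty_of_forall_notMem fun m => Set.mem_iInter.1 h m
          · exact absurd h (Set.notMem_empty p)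
    rw [this]
    refine ((hA n).inter (MeasurableSet.iInter fun m => MeasurableSet.iInter fun _ =>
      (hA m).compl)).union ?_
    split_ifs
    · exact MeasurableSet.iInter fun m => (hA m).compl
    · exact MeasurableSet.empty
  have hX' : Measurable fun q : ℕ × Ω => X q.1 q.2 := measurable_from_prod_countable_right hX
  exact hX'.comp (hN.prodMk measurable_fst)

lemma measurable_onDuration (hX : ∀ n, Measurable (X n)) (hD : ∀ n, Measurable (D n)) (t : ℝ) :
    Measurable (onDuration X D t) := by
  have hE : MeasurableSet {p : Ω × ℝ | p.2 ∈ Set.Ioc 0 t ∧ stateAt X D p.2 p.1 = .on} :=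
    (measurable_snd measurableSet_Ioc).inter
      (measurable_stateAt hX hD (measurableSet_singleton _))
  exact (measurable_measure_prodMk_left (ν := volume) hE).ennreal_toReal

end Service

/-! ### Exponential growth and optional stopping -/

section Growth

variable {Ω : Type*} {X : ℕ → Ω → State} {D : ℕ → Ω → ℝ}

/-- Growth factor of `exp (l * time - q * time in on)` during a visit of length `d` to `x`. -/
noncomputable def weight (l q : ℝ) (x : State) (d : ℝ) : ℝ :=
  Real.exp (l * d - q * if x = .on then d else 0)

/-- The value of `exp (l * time - q * time in on)` when the `n`-th state is entered. -/
noncomputable def growth (X : ℕ → Ω → State) (D : ℕ → Ω → ℝ) (l q : ℝ) (n : ℕ) (ω : Ω) : ℝ :=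
  Real.exp (l * jumpTime D n ω - q * onTime X D n ω)

lemma growth_succ (l q : ℝ) (n : ℕ) (ω : Ω) :
    growth X D l q (n + 1) ω = growth X D l q n ω * weight l q (X n ω) (D n ω) := by
  rw [growth, growth, weight, ← Real.exp_add, jumpTime_succ, onTime_succ]
  ring_nf

lemma measurable_weight (l q : ℝ) (x : State) : Measurable (weight l q x) := by
  unfold weight
  split_ifs <;> fun_prop

lemma measurable_past_jumpTime (n : ℕ) : Measurable[past X D n] (jumpTime D n) :=
  @Finset.measurable_fun_sum _ _ _ _ _ _ (past X D n) _ _ fun _ hi =>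
    measurable_past_sojourn (Finset.mem_range.1 hi)

lemma measurable_past_growth (l q : ℝ) (n : ℕ) : Measurable[past X D n] (growth X D l q n) := by
  have h1 := measurable_past_jumpTime (X := X) (D := D) n
  have h2 : Measurable[past X D n] (onTime X D n) := by
    refine @Finset.measurable_fun_sum _ _ _ _ _ _ (past X D n) _ _ fun i hi => ?_
    have hs : MeasurableSet[past X D n] {ω | X i ω = .on} :=
      measurable_past_state (Finset.mem_range.1 hi) (measurableSet_singleton State.on)
    have hd : Measurable[past X D n] (D i) := measurable_past_sojourn (Finset.mem_range.1 hi)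
    have h0 : Measurable[past X D n] fun _ : Ω => (0 : ℝ) := @measurable_const _ _ _ (past X D n) _
    exact @Measurable.ite _ _ _ _ (past X D n) _ _ _ hs hd h0
  exact Real.measurable_exp.comp ((h1.const_mul l).sub (h2.const_mul q))

/-- `h` is harmonic for the semi-Markov process weighted by `weight l q`. -/
def IsHarmonic (P : Matrix State State ℝ) (F : State → Measure ℝ) (l q : ℝ) (h : State → ℝ) :
    Prop :=
  ∀ x, ENNReal.ofReal (h x) = ∑ y, ENNReal.ofReal (P x y) *
    (∫⁻ d, ENNReal.ofReal (weight l q x d) ∂F x) * ENNReal.ofReal (h y)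

lemma lintegral_eq_sum_fiber [MeasurableSpace Ω] {μ : Measure Ω} {S : Type*} [Fintype S]
    [MeasurableSpace S] [MeasurableSingletonClass S] {Z : Ω → S} (hZ : Measurable Z)
    (f : Ω → ℝ≥0∞) : ∫⁻ ω, f ω ∂μ = ∑ s, ∫⁻ ω in {ω | Z ω = s}, f ω ∂μ := by
  have h : ⋃ s, {ω | Z ω = s} = Set.univ := by ext; simp
  have hd : Pairwise (Function.onFun Disjoint fun s => {ω | Z ω = s}) := fun s s' hss =>
    Set.disjoint_left.2 fun ω h1 h2 => hss (h1.symm.trans h2)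
  have hm : ∀ s, MeasurableSet {ω | Z ω = s} := fun s => hZ (measurableSet_singleton s)
  rw [← tsum_fintype (L := .unconditional S), ← lintegral_iUnion hm hd, h, Measure.restrict_univ]

variable [mΩ : MeasurableSpace Ω] {μ : Measure Ω} [IsProbabilityMeasure μ]
  {P : Matrix State State ℝ} {F : State → Measure ℝ}

/-- The martingale property. -/
lemma IsSemiMarkov.setLIntegral_growth (hS : IsSemiMarkov μ P F X D) (hF : ProperLaws P F)
    {l q : ℝ} {h : State → ℝ} (hh : IsHarmonic P F l q h) (n : ℕ) {B : Set Ω}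
    (hB : MeasurableSet[past X D n] B) :
    ∫⁻ ω in B, ENNReal.ofReal (growth X D l q n ω) * ENNReal.ofReal (h (X n ω)) ∂μ =
      ∫⁻ ω in B, ENNReal.ofReal (growth X D l q (n + 1) ω) *
        ENNReal.ofReal (h (X (n + 1) ω)) ∂μ := by
  have hle := past_le hS.measurable_state hS.measurable_sojourn n
  set Φ : Ω → ℝ≥0∞ := B.indicator fun ω => ENNReal.ofReal (growth X D l q n ω) with hΦdef
  have hΦ : Measurable[past X D n] Φ :=
    Measurable.indicator (ENNReal.measurable_ofReal.comp (measurable_past_growth l q n)) hB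
  have hΦ' : Measurable Φ := hΦ.mono hle le_rfl
  have hB' := hle _ hB
  have e1 : ∫⁻ ω in B, ENNReal.ofReal (growth X D l q n ω) * ENNReal.ofReal (h (X n ω)) ∂μ =
      ∑ x, (∫⁻ ω in {ω | X n ω = x}, Φ ω ∂μ) * ENNReal.ofReal (h x) := by
    rw [← lintegral_indicator hB', lintegral_eq_sum_fiber (hS.measurable_state n)]
    refine Finset.sum_congr rfl fun x _ => ?_
    rw [← lintegral_mul_const _ hΦ']
    refine setLIntegral_congr_fun (hS.measurable_state n (measurableSet_singleton x)) ?_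
    rintro ω rfl
    simp only [hΦdef, Set.indicator]
    split_ifs <;> simp
  -- Splitting over the pair of consecutive states makes the last factor of `growth` a function of
  -- `D n` alone, as the Markov property requires.
  have e2 : ∫⁻ ω in B, ENNReal.ofReal (growth X D l q (n + 1) ω) *
        ENNReal.ofReal (h (X (n + 1) ω)) ∂μ =
      ∑ z : State × State, (∫⁻ ω in {ω | X n ω = z.1 ∧ X (n + 1) ω = z.2},
        Φ ω * ENNReal.ofReal (weight l q z.1 (D n ω)) ∂μ) * ENNReal.ofReal (h z.2) := by
    have hpair := (hS.measurable_state n).prodMk (hS.measurable_state (n + 1))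
    rw [← lintegral_indicator hB', lintegral_eq_sum_fiber hpair]
    refine Finset.sum_congr rfl fun z _ => ?_
    have hz : {ω | (X n ω, X (n + 1) ω) = z} = {ω | X n ω = z.1 ∧ X (n + 1) ω = z.2} := by
      ext; simp [Prod.ext_iff]
    have hm : Measurable fun ω => Φ ω * ENNReal.ofReal (weight l q z.1 (D n ω)) :=
      hΦ'.mul (((measurable_weight l q z.1).comp (hS.measurable_sojourn n)).ennreal_ofReal)
    rw [← lintegral_mul_const _ hm, hz]
    refine setLIntegral_congr_fun (hz ▸ hpair (measurableSet_singleton z)) ?_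
    rintro ω ⟨h1, h2⟩
    simp only [hΦdef, Set.indicator, ← h1, ← h2]
    split_ifs
    · rw [growth_succ, growth, ENNReal.ofReal_mul (Real.exp_nonneg _)]
    · simp
  rw [e1, e2, Fintype.sum_prod_type]
  refine Finset.sum_congr rfl fun x _ => ?_
  rw [hh x, Finset.mul_sum]
  refine Finset.sum_congr rfl fun y _ => ?_
  rw [hS.setLIntegral_mul hF n x y hΦ (measurable_weight l q x).ennreal_ofReal]
  ring

/-- Almost sure bounds on sojourn times and on a function of the states visited. -/
structure Bounded (μ : Measure Ω) (X : ℕ → Ω → State) (D : ℕ → Ω → ℝ) (h : State → ℝ)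
    (b m c c' : ℝ) : Prop where
  nonneg : ∀ᵐ ω ∂μ, ∀ n, 0 ≤ D n ω
  le : ∀ᵐ ω ∂μ, ∀ n, D n ω ≤ b
  le_add : ∀ᵐ ω ∂μ, ∀ n, m ≤ D n ω + D (n + 1) ω
  le_fun : ∀ᵐ ω ∂μ, ∀ n, c ≤ h (X n ω)
  fun_le : ∀ᵐ ω ∂μ, ∀ n, h (X n ω) ≤ c'

-- Sojourns are taken in pairs because a single one may have length zero.
omit mΩ in
lemma le_jumpTime {ω : Ω} {m : ℝ} (h : ∀ n, m ≤ D n ω + D (n + 1) ω) (k : ℕ) :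
    k * m ≤ jumpTime D (2 * k) ω := by
  induction k with
  | zero => simp [jumpTime]
  | succ k ih =>
    rw [show 2 * (k + 1) = 2 * k + 1 + 1 by ring, jumpTime_succ, jumpTime_succ]
    push_cast
    linarith [h (2 * k)]

omit [IsProbabilityMeasure μ] in
lemma setLIntegral_jumpTime_le (hDm : ∀ n, Measurable (D n)) (hD : ∀ᵐ ω ∂μ, ∀ n, 0 ≤ D n ω)
    (t : ℝ) (n : ℕ) (f : Ω → ℝ≥0∞) :
    ∫⁻ ω in {ω | jumpTime D n ω ≤ t}, f ω ∂μ = ∫⁻ ω in {ω | jumpTime D (n + 1) ω ≤ t}, f ω ∂μ +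
      ∫⁻ ω in {ω | jumpTime D n ω ≤ t ∧ t < jumpTime D (n + 1) ω}, f ω ∂μ := by
  have hm : MeasurableSet {ω | jumpTime D (n + 1) ω ≤ t} :=
    measurable_jumpTime hDm _ measurableSet_Iic
  rw [← lintegral_inter_add_sdiff f {ω | jumpTime D n ω ≤ t} hm]
  congr 1
  · refine setLIntegral_congr ?_
    filter_upwards [hD] with ω hω
    refine propext ⟨fun h => h.2, fun h => ⟨(jumpTime_mono hω n.le_succ).trans h, h⟩⟩
  · congr 2
    ext ω
    simp

-- Optional stopping without stopping times: while the jump time is at most `t`, `f n` may be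
-- replaced by `f (n + 1)`, and the part of the space where the next jump passes `t` is split off.
-- It serves both for the martingale and for a sequence that does not depend on `n`.
omit [IsProbabilityMeasure μ] in
lemma lintegral_eq_sum_jumpTime (hDm : ∀ n, Measurable (D n)) (hD : ∀ᵐ ω ∂μ, ∀ n, 0 ≤ D n ω)
    {t : ℝ} (ht : 0 ≤ t) (f : ℕ → Ω → ℝ≥0∞)
    (hf : ∀ n, ∫⁻ ω in {ω | jumpTime D n ω ≤ t}, f n ω ∂μ =
      ∫⁻ ω in {ω | jumpTime D n ω ≤ t}, f (n + 1) ω ∂μ) (n : ℕ) :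
    ∫⁻ ω, f 0 ω ∂μ = ∫⁻ ω in {ω | jumpTime D n ω ≤ t}, f n ω ∂μ +
      ∑ k ∈ Finset.range n,
        ∫⁻ ω in {ω | jumpTime D k ω ≤ t ∧ t < jumpTime D (k + 1) ω}, f (k + 1) ω ∂μ := by
  induction n with
  | zero => simp [jumpTime, ht]
  | succ n ih =>
    rw [ih, hf, setLIntegral_jumpTime_le hDm hD, Finset.sum_range_succ]
    ring

/-- Both expectations are decomposed according to the index `k` of the sojourn in progress at time
`t`. On each piece the integrands differ by bounded factors, because the next jump overshoots `t` by
at most `b`. -/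
lemma IsSemiMarkov.growth_bounds (hS : IsSemiMarkov μ P F X D) (hF : ProperLaws P F)
    {l q : ℝ} (hl : 0 ≤ l) (hq : 0 ≤ q) {h : State → ℝ} (hh : IsHarmonic P F l q h)
    {b m c c' : ℝ} (hm : 0 < m) (hc : 0 < c) (hb : Bounded μ X D h b m c c') {t : ℝ}
    (ht : 0 ≤ t) :
    ∫⁻ ω, ENNReal.ofReal (h (X 0 ω)) ∂μ ≤ ENNReal.ofReal (Real.exp (l * (t + b)) * c') *
        ∫⁻ ω, ENNReal.ofReal (Real.exp (-q * onDuration X D t ω)) ∂μ ∧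
      ENNReal.ofReal (Real.exp (l * t - q * b) * c) *
        ∫⁻ ω, ENNReal.ofReal (Real.exp (-q * onDuration X D t ω)) ∂μ ≤
      ∫⁻ ω, ENNReal.ofReal (h (X 0 ω)) ∂μ := by
  have hDm := hS.measurable_sojourn
  have hSm : Measurable fun ω => ENNReal.ofReal (Real.exp (-q * onDuration X D t ω)) :=
    (Real.measurable_exp.comp
      ((measurable_onDuration hS.measurable_state hDm t).const_mul _)).ennreal_ofReal
  -- After `2 * N` jumps the time exceeds `t` almost surely, so the decomposition is a finite sum
  -- with no remainder.
  obtain ⟨N, hN⟩ : ∃ N : ℕ, t < N * m := by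
    obtain ⟨N, hN⟩ := exists_nat_gt (t / m)
    exact ⟨N, (div_lt_iff₀ hm).1 hN⟩
  have hnull : μ {ω | jumpTime D (2 * N) ω ≤ t} = 0 := by
    rw [measure_eq_zero_iff_ae_notMem]
    filter_upwards [hb.le_add] with ω hω h
    exact (hN.trans_le ((le_jumpTime hω N).trans h)).false
  have e1 : ∫⁻ ω, ENNReal.ofReal (h (X 0 ω)) ∂μ = ∑ k ∈ Finset.range (2 * N),
      ∫⁻ ω in {ω | jumpTime D k ω ≤ t ∧ t < jumpTime D (k + 1) ω},
        ENNReal.ofReal (growth X D l q (k + 1) ω) * ENNReal.ofReal (h (X (k + 1) ω)) ∂μ := by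
    have := lintegral_eq_sum_jumpTime hDm hb.nonneg ht
      (fun n ω => ENNReal.ofReal (growth X D l q n ω) * ENNReal.ofReal (h (X n ω)))
      (fun n => hS.setLIntegral_growth hF hh n (measurable_past_jumpTime n measurableSet_Iic))
      (2 * N)
    rw [setLIntegral_measure_zero _ _ hnull, zero_add] at this
    simpa [growth, jumpTime, onTime] using this
  have e2 : ∫⁻ ω, ENNReal.ofReal (Real.exp (-q * onDuration X D t ω)) ∂μ =
      ∑ k ∈ Finset.range (2 * N),
        ∫⁻ ω in {ω | jumpTime D k ω ≤ t ∧ t < jumpTime D (k + 1) ω},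
          ENNReal.ofReal (Real.exp (-q * onDuration X D t ω)) ∂μ := by
    have := lintegral_eq_sum_jumpTime hDm hb.nonneg ht
      (fun _ ω => ENNReal.ofReal (Real.exp (-q * onDuration X D t ω))) (fun _ => rfl) (2 * N)
    rwa [setLIntegral_measure_zero _ _ hnull, zero_add] at this
  have hmeas : ∀ k, MeasurableSet {ω | jumpTime D k ω ≤ t ∧ t < jumpTime D (k + 1) ω} := fun k =>
    (measurable_jumpTime hDm k measurableSet_Iic).inter
      (measurable_jumpTime hDm (k + 1) measurableSet_Ioi)
  rw [e1, e2, Finset.mul_sum, Finset.mul_sum]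
  constructor
  · refine Finset.sum_le_sum fun k _ => ?_
    rw [← lintegral_const_mul _ hSm]
    refine setLIntegral_mono_ae' (hmeas k) ?_
    filter_upwards [hb.nonneg, hb.le, hb.le_fun, hb.fun_le] with ω h0 h1 h2 h3 ⟨h4, h5⟩
    rw [growth, ← ENNReal.ofReal_mul (Real.exp_nonneg _),
      ← ENNReal.ofReal_mul (mul_nonneg (Real.exp_nonneg _) ((hc.le.trans (h2 0)).trans (h3 0)))]
    refine ENNReal.ofReal_le_ofReal ?_
    rw [mul_right_comm, ← Real.exp_add]
    -- The jump ending the sojourn comes at most `b` after `t`, and the time in `on` at that jump is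
    -- at least that at `t`.
    refine mul_le_mul (Real.exp_le_exp.2 ?_) (h3 _) (hc.le.trans (h2 _)) (Real.exp_nonneg _)
    have h6 := onDuration_le_onTime (X := X) h0 h5
    have h7 := h1 k
    rw [jumpTime_succ]
    nlinarith
  · refine Finset.sum_le_sum fun k _ => ?_
    rw [← lintegral_const_mul _ hSm]
    refine setLIntegral_mono_ae' (hmeas k) ?_
    filter_upwards [hb.nonneg, hb.le, hb.le_fun] with ω h0 h1 h2 ⟨h4, h5⟩
    rw [growth, ← ENNReal.ofReal_mul (Real.exp_nonneg _),
      ← ENNReal.ofReal_mul (mul_nonneg (Real.exp_nonneg _) hc.le)]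
    refine ENNReal.ofReal_le_ofReal ?_
    rw [mul_right_comm, ← Real.exp_add]
    -- The jump comes after `t`, and the last sojourn adds at most `b` to the time in `on`.
    refine mul_le_mul (Real.exp_le_exp.2 ?_) (h2 _) hc.le (Real.exp_nonneg _)
    have h6 := onTime_le_onDuration (X := X) h0 h4
    have h7 := h1 k
    have h8 : onTime X D (k + 1) ω ≤ onTime X D k ω + b := by
      rw [onTime_succ]
      have := (h0 k).trans h7
      split_ifs <;> linarith
    nlinarith

omit [IsProbabilityMeasure μ] in
/-- If the expectation of `exp (- θ S(t))` is of the order of `exp (- l t)`, then the effective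
capacity is `l / θ`. -/
lemma hasEffectiveCapacity_of_bounds {S : ℝ → Ω → ℝ} {θ l a₁ a₂ : ℝ} (hθ : 0 < θ) (h1 : 0 < a₁)
    (h2 : 0 < a₂)
    (hS : ∀ t, 0 < t → a₁ * Real.exp (-l * t) ≤ ∫ ω, Real.exp (-θ * S t ω) ∂μ ∧
      ∫ ω, Real.exp (-θ * S t ω) ∂μ ≤ a₂ * Real.exp (-l * t)) :
    HasEffectiveCapacity μ S θ (l / θ) := by
  have lim : ∀ a : ℝ, Tendsto (fun t : ℝ => l / θ - Real.log a / θ / t) atTop (𝓝 (l / θ)) := by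
    intro a
    have := (tendsto_const_nhds (x := Real.log a / θ)).div_atTop tendsto_id
    simpa using (tendsto_const_nhds (x := l / θ)).sub this
  have key : ∀ t a : ℝ, 0 < t → 0 < a →
      -(1 / (θ * t) * Real.log (a * Real.exp (-l * t))) = l / θ - Real.log a / θ / t := by
    intro t a ht ha
    rw [Real.log_mul ha.ne' (Real.exp_pos _).ne', Real.log_exp]
    field_simp
    ring
  refine tendsto_of_tendsto_of_tendsto_of_le_of_le' (lim a₂) (lim a₁) ?_ ?_
  · filter_upwards [eventually_gt_atTop 0] with t ht
    rw [← key t a₂ ht h2]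
    have := Real.log_le_log ((mul_pos h1 (Real.exp_pos _)).trans_le (hS t ht).1) (hS t ht).2
    gcongr
  · filter_upwards [eventually_gt_atTop 0] with t ht
    rw [← key t a₁ ht h1]
    have := Real.log_le_log (mul_pos h1 (Real.exp_pos _)) (hS t ht).1
    gcongr

/-- A positive harmonic function determines the effective capacity. -/
theorem IsSemiMarkov.hasEffectiveCapacity (hS : IsSemiMarkov μ P F X D) (hF : ProperLaws P F)
    {l θ R : ℝ} (hl : 0 ≤ l) (hθ : 0 < θ) (hR : 0 ≤ R) {h : State → ℝ}
    (hh : IsHarmonic P F l (R * θ) h)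
    {b m c c' : ℝ} (hm : 0 < m) (hc : 0 < c) (hb : Bounded μ X D h b m c c') :
    HasEffectiveCapacity μ (service X D R) θ (l / θ) := by
  have hq : 0 ≤ R * θ := mul_nonneg hR hθ.le
  obtain ⟨ω₀, hω⟩ := (hb.le_fun.and hb.fun_le).exists
  have hcc : c ≤ c' := (hω.1 0).trans (hω.2 0)
  have hc' : 0 < c' := hc.trans_le hcc
  have hX0 : Measurable fun ω => ENNReal.ofReal (h (X 0 ω)) :=
    (measurable_from_top (f := fun x => ENNReal.ofReal (h x))).comp (hS.measurable_state 0)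
  have hlow : ENNReal.ofReal c ≤ ∫⁻ ω, ENNReal.ofReal (h (X 0 ω)) ∂μ := by
    calc ENNReal.ofReal c = ∫⁻ _, ENNReal.ofReal c ∂μ := by simp
      _ ≤ _ := lintegral_mono_ae (by
        filter_upwards [hb.le_fun] with ω h using ENNReal.ofReal_le_ofReal (h 0))
  have hup : ∫⁻ ω, ENNReal.ofReal (h (X 0 ω)) ∂μ ≤ ENNReal.ofReal c' := by
    calc _ ≤ ∫⁻ _, ENNReal.ofReal c' ∂μ := lintegral_mono_ae (by
            filter_upwards [hb.fun_le] with ω h using ENNReal.ofReal_le_ofReal (h 0))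
      _ = _ := by simp
  -- The constants result from solving the two bounds of `growth_bounds` for the expectation, the
  -- mean of `h (X 0)` being between `c` and `c'`.
  refine hasEffectiveCapacity_of_bounds hθ (a₁ := c / (Real.exp (l * b) * c'))
    (a₂ := c' / (Real.exp (-(R * θ) * b) * c)) (by positivity) (by positivity) fun t ht => ?_
  have hmeas : Measurable fun ω => Real.exp (-(R * θ) * onDuration X D t ω) :=
    Real.measurable_exp.comp
      ((measurable_onDuration hS.measurable_state hS.measurable_sojourn t).const_mul _)
  have hserv : ∀ ω, Real.exp (-θ * service X D R t ω) =
      Real.exp (-(R * θ) * onDuration X D t ω) := by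
    intro ω; rw [service, onDuration]; ring_nf
  simp only [hserv]
  have hint : Integrable (fun ω => Real.exp (-(R * θ) * onDuration X D t ω)) μ := by
    refine Integrable.of_bound hmeas.aestronglyMeasurable 1 (ae_of_all _ fun ω => ?_)
    rw [Real.norm_eq_abs, Real.abs_exp, Real.exp_le_one_iff]
    have : 0 ≤ onDuration X D t ω := ENNReal.toReal_nonneg
    nlinarith
  have hI : ∫⁻ ω, ENNReal.ofReal (Real.exp (-(R * θ) * onDuration X D t ω)) ∂μ =
      ENNReal.ofReal (∫ ω, Real.exp (-(R * θ) * onDuration X D t ω) ∂μ) :=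
    (ofReal_integral_eq_lintegral_ofReal hint (ae_of_all _ fun ω => Real.exp_nonneg _)).symm
  set I := ∫ ω, Real.exp (-(R * θ) * onDuration X D t ω) ∂μ
  have hI0 : 0 ≤ I := integral_nonneg fun ω => Real.exp_nonneg _
  obtain ⟨g1, g2⟩ := hS.growth_bounds hF hl hq hh hm hc hb ht.le
  rw [hI] at g1 g2
  have k1 := hlow.trans g1
  have k2 := g2.trans hup
  rw [← ENNReal.ofReal_mul (by positivity), ENNReal.ofReal_le_ofReal_iff (by positivity)] at k1 k2
  constructor
  · rw [div_mul_eq_mul_div, div_le_iff₀ (by positivity), neg_mul, Real.exp_neg,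
      ← div_eq_mul_inv, div_le_iff₀ (Real.exp_pos _)]
    rw [mul_add, Real.exp_add] at k1
    linarith
  · rw [div_mul_eq_mul_div, le_div_iff₀ (by positivity), neg_mul l, Real.exp_neg,
      ← div_eq_mul_inv, le_div_iff₀ (Real.exp_pos _)]
    rw [sub_eq_add_neg, Real.exp_add] at k2
    rw [neg_mul]
    linarith

end Growth

/-! ### Packets -/

section Packets

variable {Ω : Type*} (Y : Noise Ω) (Q : Params)

lemma Noise.collisions_le (n : ℕ) (ω : Ω) : Y.collisions Q n ω ≤ Q.K :=
  Nat.sInf_le (Or.inl le_rfl)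

lemma Noise.collision_of_lt_collisions {n j : ℕ} {ω : Ω} (h : j < Y.collisions Q n ω) :
    Y.collision n j ω = true := by
  have := Nat.notMem_of_lt_sInf h
  simp only [Set.mem_ofPred_eq, not_or, Bool.not_eq_false] at this
  exact this.2

lemma Noise.collisions_eq_iff {n i : ℕ} (hi : i < Q.K) (ω : Ω) : Y.collisions Q n ω = i ↔
    (∀ j < i, Y.collision n j ω = true) ∧ Y.collision n i ω = false := by
  constructor
  · rintro rfl
    refine ⟨fun j hj => Y.collision_of_lt_collisions Q hj, ?_⟩
    have : Y.collisions Q n ω ∈ {j | Q.K ≤ j ∨ Y.collision n j ω = false} :=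
      Nat.sInf_mem ⟨Q.K, Or.inl le_rfl⟩
    exact this.resolve_left (not_le.2 hi)
  · rintro ⟨h1, h2⟩
    refine IsLeast.csInf_eq ⟨Or.inr h2, fun m hm => ?_⟩
    by_contra! hmi
    rcases hm with hm | hm
    · omega
    · simp [h1 m hmi] at hm

lemma Noise.collisions_eq_K_iff {n : ℕ} (ω : Ω) : Y.collisions Q n ω = Q.K ↔
    ∀ j < Q.K, Y.collision n j ω = true := by
  constructor
  · intro h j hj
    exact Y.collision_of_lt_collisions Q (h ▸ hj)
  · intro h
    refine IsLeast.csInf_eq ⟨Or.inl le_rfl, fun m hm => ?_⟩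
    by_contra! hmi
    rcases hm with hm | hm
    · omega
    · simp [h m hmi] at hm

lemma Noise.dropped_eq_compl (n : ℕ) : Y.dropped Q n = (Y.delivered Q n)ᶜ := by
  ext ω
  have := Y.collisions_le Q n ω
  simp only [Noise.dropped, Noise.delivered, Set.mem_ofPred_eq, Set.mem_compl_iff]
  omega

/-- The random inputs from packet `1` on. -/
def Noise.shift : Noise Ω where
  collision n := Y.collision (n + 1)
  backoff n := Y.backoff (n + 1)
  slot n := Y.slot (n + 1)
  error n := Y.error (n + 1)

/-- Regeneration: the recursion for `phase` consults only the current packet, so from the start of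
packet `1` on it is the recursion for the shifted noise, with packet numbers raised by one. -/
lemma Noise.phase_shift {a : ℕ} {ω : Ω} (h : Y.phase Q ω a = (1, false)) (m : ℕ) :
    Y.phase Q ω (a + m) = ((Y.shift.phase Q ω m).1 + 1, (Y.shift.phase Q ω m).2) := by
  induction m with
  | zero => simpa [Noise.phase] using h
  | succ m ih =>
    rw [← add_assoc, Noise.phase, ih, Noise.phase]
    have : ω ∈ Y.delivered Q ((Y.shift.phase Q ω m).1 + 1) ↔
      ω ∈ Y.shift.delivered Q (Y.shift.phase Q ω m).1 := Iff.rfl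
    by_cases h1 : (Y.shift.phase Q ω m).2 = false ∧ ω ∈ Y.shift.delivered Q (Y.shift.phase Q ω m).1
    · rw [if_pos h1, if_pos ⟨h1.1, this.2 h1.2⟩]
    · rw [if_neg h1, if_neg (fun h2 => h1 ⟨h2.1, this.1 h2.2⟩)]

lemma Noise.state_shift {a : ℕ} {ω : Ω} (h : Y.phase Q ω a = (1, false)) (m : ℕ) :
    Y.state Q (a + m) ω = Y.shift.state Q m ω := by
  unfold Noise.state
  rw [Y.phase_shift Q h m]
  rfl

lemma Noise.sojourn_shift {a : ℕ} {ω : Ω} (h : Y.phase Q ω a = (1, false)) (m : ℕ) :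
    Y.sojourn Q (a + m) ω = Y.shift.sojourn Q m ω := by
  unfold Noise.sojourn
  rw [Y.phase_shift Q h m]
  rfl

variable {Y Q}

lemma Noise.phase_one_of_dropped {ω : Ω} (h : ω ∉ Y.delivered Q 0) :
    Y.phase Q ω 1 = (1, false) := by
  simp [Noise.phase, h]

lemma Noise.phase_one_of_delivered {ω : Ω} (h : ω ∈ Y.delivered Q 0) :
    Y.phase Q ω 1 = (0, true) := by
  simp [Noise.phase, h]

lemma Noise.phase_two_of_delivered {ω : Ω} (h : ω ∈ Y.delivered Q 0) :
    Y.phase Q ω 2 = (1, false) := by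
  rw [Noise.phase, Y.phase_one_of_delivered h]
  simp

end Packets

/-! ### Measurability -/

section Measurability

variable {Ω : Type*} [MeasurableSpace Ω] {Y : Noise Ω} {Q : Params}

/-- Handles packet numbers and numbers of summands that are themselves random: it suffices to treat
each fixed value. -/
lemma measurable_of_countable_param {S β : Type*} [Countable S] [MeasurableSpace S]
    [DiscreteMeasurableSpace S] [MeasurableSpace β] {Z : Ω → S} (hZ : Measurable Z)
    {f : S → Ω → β} (hf : ∀ s, Measurable (f s)) : Measurable fun ω => f (Z ω) ω := by
  have : Measurable fun z : S × Ω => f z.1 z.2 := measurable_from_prod_countable_right hf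
  exact this.comp (hZ.prodMk measurable_id)

/-- Assuming only that the inputs involved are measurable lets these lemmas be applied to the
sub-σ-algebras `Noise.info` too, which is how independence is exploited. -/
lemma Noise.measurable_collisions {n : ℕ} (h : ∀ j, Measurable (Y.collision n j)) :
    Measurable (Y.collisions Q n) := by
  have hb : ∀ j b, MeasurableSet {ω | Y.collision n j ω = b} := fun j b =>
    h j (measurableSet_singleton b)
  refine measurable_to_countable' fun i => ?_
  rcases lt_trichotomy i Q.K with hi | rfl | hi
  · have : Y.collisions Q n ⁻¹' {i} =
        (⋂ j, ⋂ _ : j < i, {ω | Y.collision n j ω = true}) ∩ {ω | Y.collision n i ω = false} := by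
      ext ω
      simpa using Y.collisions_eq_iff Q hi ω
    rw [this]
    exact (MeasurableSet.iInter fun j => MeasurableSet.iInter fun _ => hb _ _).inter (hb _ _)
  · have : Y.collisions Q n ⁻¹' {Q.K} = ⋂ j, ⋂ _ : j < Q.K, {ω | Y.collision n j ω = true} := by
      ext ω
      simpa using Y.collisions_eq_K_iff Q ω
    rw [this]
    exact MeasurableSet.iInter fun j => MeasurableSet.iInter fun _ => hb _ _
  · have : Y.collisions Q n ⁻¹' {i} = ∅ := by
      ext ω
      have := Y.collisions_le Q n ω
      simp only [Set.mem_preimage, Set.mem_singleton_iff, Set.mem_empty_iff_false, iff_false]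
      omega
    rw [this]
    exact MeasurableSet.empty

lemma Noise.measurable_backoffTime {n j : ℕ} (h1 : Measurable (Y.backoff n j))
    (h2 : ∀ d, Measurable (Y.slot n j d)) : Measurable (Y.backoffTime Q n j) := by
  refine measurable_of_countable_param h1
    (f := fun m ω => ∑ d ∈ Finset.range m, Q.slotDuration (Y.slot n j d ω)) fun m => ?_
  exact Finset.measurable_fun_sum _ fun d _ =>
    (measurable_from_top (f := Q.slotDuration)).comp (h2 d)

lemma Noise.measurable_offTime {n : ℕ} (h : ∀ j, Measurable (Y.collision n j))
    (h1 : ∀ j, Measurable (Y.backoff n j)) (h2 : ∀ j d, Measurable (Y.slot n j d)) :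
    Measurable (Y.offTime Q n) := by
  refine measurable_of_countable_param (Noise.measurable_collisions (Q := Q) h)
    (f := fun m ω => (m : ℝ) * Q.Tc +
      ∑ j ∈ Finset.range (min (m + 1) Q.K), Y.backoffTime Q n j ω) fun m => ?_
  exact (Finset.measurable_fun_sum _ fun j _ =>
    Noise.measurable_backoffTime (h1 j) (h2 j)).const_add _

lemma Noise.measurableSet_delivered {n : ℕ} (h : ∀ j, Measurable (Y.collision n j)) :
    MeasurableSet (Y.delivered Q n) :=
  Noise.measurable_collisions h measurableSet_Iio

lemma Noise.measurableSet_dropped {n : ℕ} (h : ∀ j, Measurable (Y.collision n j)) :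
    MeasurableSet (Y.dropped Q n) :=
  Noise.measurable_collisions h (measurableSet_singleton _)

lemma Noise.measurable_phase (h : ∀ s, Measurable (Y.draw s)) (m : ℕ) :
    Measurable fun ω => Y.phase Q ω m := by
  induction m with
  | zero => exact measurable_const
  | succ m ih =>
    classical
    have : Measurable fun ω => if (Y.phase Q ω m).2 = false ∧
        ω ∈ Y.delivered Q (Y.phase Q ω m).1 then ((Y.phase Q ω m).1, true)
        else ((Y.phase Q ω m).1 + 1, false) := by
      refine measurable_of_countable_param ih (f := fun z ω =>
        if z.2 = false ∧ ω ∈ Y.delivered Q z.1 then (z.1, true) else (z.1 + 1, false)) fun z => ?_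
      have hs : MeasurableSet {ω | z.2 = false ∧ ω ∈ Y.delivered Q z.1} :=
        (MeasurableSet.const (z.2 = false)).inter
          (Noise.measurableSet_delivered fun j => h (.collision z.1 j))
      exact Measurable.ite hs measurable_const measurable_const
    convert this using 2
    rw [Noise.phase]

lemma Noise.measurable_state (h : ∀ s, Measurable (Y.draw s)) (m : ℕ) :
    Measurable (Y.state Q m) := by
  classical
  have : Measurable fun ω => if (Y.phase Q ω m).2 = true then
      if Y.error (Y.phase Q ω m).1 ω = true then State.off1 else State.on
      else if ω ∈ Y.delivered Q (Y.phase Q ω m).1 then State.off2 else State.off3 := by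
    refine measurable_of_countable_param (Noise.measurable_phase (Q := Q) h m) (f := fun z ω =>
      if z.2 = true then if Y.error z.1 ω = true then State.off1 else State.on
      else if ω ∈ Y.delivered Q z.1 then State.off2 else State.off3) fun z => ?_
    have he : MeasurableSet {ω | Y.error z.1 ω = true} :=
      h (.error z.1) (MeasurableSpace.measurableSet_top (s := ({true} : Set Bool)))
    have hd : MeasurableSet {ω | ω ∈ Y.delivered Q z.1} :=
      Noise.measurableSet_delivered fun j => h (.collision z.1 j)
    exact Measurable.ite (MeasurableSet.const (z.2 = true))
      (Measurable.ite he measurable_const measurable_const)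
      (Measurable.ite hd measurable_const measurable_const)
  convert this using 2
  rw [Noise.state]

lemma Noise.measurable_sojourn (h : ∀ s, Measurable (Y.draw s)) (m : ℕ) :
    Measurable (Y.sojourn Q m) := by
  refine measurable_of_countable_param (Noise.measurable_phase (Q := Q) h m)
    (f := fun z ω => if z.2 = true then Q.Tf else Y.offTime Q z.1 ω) fun z => ?_
  exact Measurable.ite (MeasurableSet.const (z.2 = true)) measurable_const
    (Noise.measurable_offTime (fun j => h (.collision z.1 j))
      (fun j => h (.backoff z.1 j)) (fun j d => h (.slot z.1 j d)))

end Measurability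

/-! ### Independence and laws of the random inputs -/

section Independence

/-- The σ-algebra generated by some of the random inputs. -/
@[reducible] def Noise.info {Ω : Type*} (Y : Noise Ω) (S : Set Source) : MeasurableSpace Ω :=
  ⨆ s ∈ S, MeasurableSpace.comap (Y.draw s) inferInstance

lemma Noise.measurable_info {Ω : Type*} (Y : Noise Ω) {S : Set Source} {s : Source} (hs : s ∈ S) :
    Measurable[Y.info S] (Y.draw s) :=
  measurable_iff_comap_le.2 (le_iSup₂_of_le s hs le_rfl)

variable {Ω : Type*} [mΩ : MeasurableSpace Ω] {μ : Measure Ω} {Y : Noise Ω} {Q : Params}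

lemma Noise.IsLAA.info_le (hY : Y.IsLAA Q μ) (S : Set Source) : Y.info S ≤ mΩ :=
  iSup₂_le fun s _ => (hY.measurable s).comap_le

lemma Noise.IsLAA.indep_info (hY : Y.IsLAA Q μ) {S T : Set Source} (hST : Disjoint S T) :
    Indep (Y.info S) (Y.info T) μ :=
  indep_iSup_of_disjoint (fun s => (hY.measurable s).comap_le) hY.indep hST

lemma Noise.IsLAA.lintegral_mul (hY : Y.IsLAA Q μ) {S T : Set Source} (hST : Disjoint S T)
    {f g : Ω → ℝ≥0∞} (hf : Measurable[Y.info S] f) (hg : Measurable[Y.info T] g) :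
    ∫⁻ ω, f ω * g ω ∂μ = (∫⁻ ω, f ω ∂μ) * ∫⁻ ω, g ω ∂μ :=
  lintegral_mul_eq_lintegral_mul_lintegral_of_independent_measurableSpace
    (hY.info_le S) (hY.info_le T) (hY.indep_info hST) hf hg

lemma Noise.IsLAA.measureReal_inter (hY : Y.IsLAA Q μ) {S T : Set Source} (hST : Disjoint S T)
    {A B : Set Ω} (hA : MeasurableSet[Y.info S] A) (hB : MeasurableSet[Y.info T] B) :
    μ.real (A ∩ B) = μ.real A * μ.real B := by
  rw [measureReal_def, (Indep_iff _ _ μ).1 (hY.indep_info hST) A B hA hB, ENNReal.toReal_mul]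
  rfl

/-- The label of an input of the shifted noise, as a label of the original noise. -/
def Source.next : Source → Source
  | .collision n j => .collision (n + 1) j
  | .backoff n j => .backoff (n + 1) j
  | .slot n j d => .slot (n + 1) j d
  | .error n => .error (n + 1)

lemma Source.next_injective : Function.Injective Source.next := by
  intro s t h
  cases s <;> cases t <;> simp_all [Source.next]

omit mΩ in
lemma Noise.measurable_shift_draw {m : MeasurableSpace Ω} (s : Source)
    (h : Measurable[m] (Y.draw s.next)) : Measurable[m] (Y.shift.draw s) := by
  cases s <;> exact h

lemma Noise.IsLAA.shift (hY : Y.IsLAA Q μ) : Y.shift.IsLAA Q μ where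
  measurable s := Noise.measurable_shift_draw s (hY.measurable _)
  indep := by
    have h := iIndep.precomp Source.next_injective ((iIndepFun_iff_iIndep _ _ _).1 hY.indep)
    refine (iIndepFun_iff_iIndep _ _ _).2 ?_
    convert h using 1
    funext s
    cases s <;> rfl
  collision_law n j := hY.collision_law (n + 1) j
  backoff_law n j := hY.backoff_law (n + 1) j
  slot_law n j := hY.slot_law (n + 1) j
  error_law n := hY.error_law (n + 1)

variable [IsProbabilityMeasure μ]

lemma window_pos (hQ : Q.Valid) (j : ℕ) : 0 < Q.window j := by
  have := hQ.W_pos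
  unfold Params.window
  cases Q.scheme
  · exact this
  · positivity

/-- The prescribed probabilities of the values below the window already add up to 1, so every other
value is null. -/
lemma Noise.IsLAA.measure_backoff (hQ : Q.Valid) (hY : Y.IsLAA Q μ) (n j m : ℕ) :
    μ {ω | Y.backoff n j ω = m} =
      if m < Q.window j then ENNReal.ofReal (1 / (Q.window j : ℝ)) else 0 := by
  have hlt : ∀ m < Q.window j, μ {ω | Y.backoff n j ω = m} =
      ENNReal.ofReal (1 / (Q.window j : ℝ)) := fun m hm => by
    rw [← hY.backoff_law n j m hm, ofReal_measureReal]
  split_ifs with hm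
  · exact hlt m hm
  · have hmeas : Measurable (Y.backoff n j) := hY.measurable (.backoff n j)
    have h1 : μ {ω | Y.backoff n j ω < Q.window j} = 1 := by
      have : {ω | Y.backoff n j ω < Q.window j} =
          ⋃ m ∈ Finset.range (Q.window j), {ω | Y.backoff n j ω = m} := by
        ext; simp
      rw [this, measure_biUnion_finset]
      · rw [Finset.sum_congr rfl fun m hm => hlt m (Finset.mem_range.1 hm), Finset.sum_const,
          Finset.card_range, nsmul_eq_mul, ← ENNReal.ofReal_natCast,
          ← ENNReal.ofReal_mul (Nat.cast_nonneg _)]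
        have : (Q.window j : ℝ) ≠ 0 := by exact_mod_cast (window_pos hQ j).ne'
        rw [mul_one_div_cancel this, ENNReal.ofReal_one]
      · intro a _ b _ hab
        exact Set.disjoint_left.2 fun ω h1 h2 => hab (h1.symm.trans h2)
      · exact fun m _ => hmeas (measurableSet_singleton m)
    refine measure_mono_null ?_ ((prob_compl_eq_zero_iff (hmeas measurableSet_Iio)).2 h1)
    intro ω (hω : Y.backoff n j ω = m)
    simpa [hω] using hm

lemma Noise.IsLAA.ae_backoff_lt (hQ : Q.Valid) (hY : Y.IsLAA Q μ) :
    ∀ᵐ ω ∂μ, ∀ n j, Y.backoff n j ω < Q.window j := by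
  rw [ae_all_iff]; intro n
  rw [ae_all_iff]; intro j
  have : ∀ᵐ ω ∂μ, ∀ m, Q.window j ≤ m → Y.backoff n j ω ≠ m := by
    rw [ae_all_iff]; intro m
    by_cases hm : Q.window j ≤ m
    · have := hY.measure_backoff hQ n j m
      rw [if_neg (not_lt.2 hm), measure_eq_zero_iff_ae_notMem] at this
      filter_upwards [this] with ω h _ using h
    · exact ae_of_all _ fun ω h => absurd h hm
  filter_upwards [this] with ω h
  by_contra! h'
  exact h _ h' rfl

lemma measure_bool_eq {Z : Ω → Bool} (hZ : Measurable Z) {a : ℝ}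
    (h : μ.real {ω | Z ω = true} = a) (b : Bool) :
    μ {ω | Z ω = b} = ENNReal.ofReal (if b then a else 1 - a) := by
  cases b
  · have hc : {ω | Z ω = false} = {ω | Z ω = true}ᶜ := by ext; simp
    have hm : MeasurableSet {ω | Z ω = true} := hZ (measurableSet_singleton true)
    rw [hc, ← ofReal_measureReal, probReal_compl_eq_one_sub hm, h]
    simp
  · rw [← ofReal_measureReal, h]; simp

/-- The parameters determine the joint law of the random inputs. -/
lemma Noise.IsLAA.map_draw_eq (hQ : Q.Valid) (hY : Y.IsLAA Q μ) {Y' : Noise Ω}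
    (hY' : Y'.IsLAA Q μ) :
    μ.map (fun ω s => Y.draw s ω) = μ.map (fun ω s => Y'.draw s ω) := by
  -- By independence both joint laws are products of marginals; each input has countably many
  -- values, so point masses decide.
  rw [(iIndepFun_iff_map_fun_eq_infinitePi_map hY.measurable).1 hY.indep,
    (iIndepFun_iff_map_fun_eq_infinitePi_map hY'.measurable).1 hY'.indep]
  congr 1
  funext s
  have hc : Countable s.Val := by cases s <;> unfold Source.Val <;> infer_instance
  refine Measure.ext_of_singleton fun v => ?_
  rw [Measure.map_apply (hY.measurable s) (MeasurableSpace.measurableSet_top),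
    Measure.map_apply (hY'.measurable s) (MeasurableSpace.measurableSet_top)]
  cases s with
  | collision n j =>
    exact (measure_bool_eq (hY.measurable (.collision n j)) (hY.collision_law n j) v).trans
      (measure_bool_eq (hY'.measurable (.collision n j)) (hY'.collision_law n j) v).symm
  | backoff n j => exact (hY.measure_backoff hQ n j v).trans (hY'.measure_backoff hQ n j v).symm
  | slot n j d =>
    have := (hY.slot_law n j d v).trans (hY'.slot_law n j d v).symm
    exact (measureReal_eq_measureReal_iff (measure_ne_top _ _) (measure_ne_top _ _)).1 this
  | error n =>
    exact (measure_bool_eq (hY.measurable (.error n)) (hY.error_law n) v).trans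
      (measure_bool_eq (hY'.measurable (.error n)) (hY'.error_law n) v).symm

/-- The random inputs as coordinates. -/
def Noise.canonical : Noise ((s : Source) → s.Val) where
  collision n j ω := ω (.collision n j)
  backoff n j ω := ω (.backoff n j)
  slot n j d ω := ω (.slot n j d)
  error n ω := ω (.error n)

/-- The event is the preimage, under the map collecting all inputs, of the same event for
`Noise.canonical`; hence its probability depends only on the joint law. -/
lemma Noise.IsLAA.measure_packet_eq (hQ : Q.Valid) (hY : Y.IsLAA Q μ) {Y' : Noise Ω}
    (hY' : Y'.IsLAA Q μ) (I : Set ℕ) {A : Set ℝ} (hA : MeasurableSet A) :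
    μ {ω | Y.collisions Q 0 ω ∈ I ∧ Y.offTime Q 0 ω ∈ A} =
      μ {ω | Y'.collisions Q 0 ω ∈ I ∧ Y'.offTime Q 0 ω ∈ A} := by
  have hm : MeasurableSet {ω | Noise.canonical.collisions Q 0 ω ∈ I ∧
      Noise.canonical.offTime Q 0 ω ∈ A} :=
    (Noise.measurable_collisions (fun j => measurable_pi_apply (Source.collision 0 j))
      (MeasurableSet.of_discrete)).inter
    (Noise.measurable_offTime (fun j => measurable_pi_apply (Source.collision 0 j))
      (fun j => measurable_pi_apply (Source.backoff 0 j))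
      (fun j d => measurable_pi_apply (Source.slot 0 j d)) hA)
  have := congrArg (fun ν => ν {ω | Noise.canonical.collisions Q 0 ω ∈ I ∧
    Noise.canonical.offTime Q 0 ω ∈ A}) (hY.map_draw_eq hQ hY')
  beta_reduce at this
  rw [Measure.map_apply (measurable_pi_lambda _ hY.measurable) hm,
    Measure.map_apply (measurable_pi_lambda _ hY'.measurable) hm] at this
  exact this

/-- `sojournLaw` is defined through packet `0`; applied to `Y.shift`, this shows that later packets
have the same laws. -/
lemma Noise.IsLAA.sojournLaw_eq (hQ : Q.Valid) (hY : Y.IsLAA Q μ) {Y' : Noise Ω}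
    (hY' : Y'.IsLAA Q μ) : Y.sojournLaw Q μ = Y'.sojournLaw Q μ := by
  have hcol : ∀ Z : Noise Ω, Z.IsLAA Q μ → ∀ j, Measurable (Z.collision 0 j) :=
    fun Z hZ j => hZ.measurable (.collision 0 j)
  have hoff : ∀ Z : Noise Ω, Z.IsLAA Q μ → Measurable (Z.offTime Q 0) := fun Z hZ =>
    Noise.measurable_offTime (hcol Z hZ) (fun j => hZ.measurable (.backoff 0 j))
      (fun j d => hZ.measurable (.slot 0 j d))
  have key : ∀ (Z : Noise Ω) (I : Set ℕ), Z.IsLAA Q μ → ∀ A, MeasurableSet A →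
      (cond μ {ω | Z.collisions Q 0 ω ∈ I}).map (Z.offTime Q 0) A =
      (μ {ω | Z.collisions Q 0 ω ∈ I ∧ Z.offTime Q 0 ω ∈ Set.univ})⁻¹ *
        μ {ω | Z.collisions Q 0 ω ∈ I ∧ Z.offTime Q 0 ω ∈ A} := by
    intro Z I hZ A hA
    have hI : MeasurableSet {ω | Z.collisions Q 0 ω ∈ I} :=
      Noise.measurable_collisions (hcol Z hZ) MeasurableSet.of_discrete
    rw [Measure.map_apply (hoff Z hZ) hA, cond_apply hI]
    simp only [Set.mem_univ, and_true]
    rfl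
  have main : ∀ I : Set ℕ, (cond μ {ω | Y.collisions Q 0 ω ∈ I}).map (Y.offTime Q 0) =
      (cond μ {ω | Y'.collisions Q 0 ω ∈ I}).map (Y'.offTime Q 0) := by
    intro I
    ext A hA
    rw [key Y I hY A hA, key Y' I hY' A hA, hY.measure_packet_eq hQ hY' I hA,
      hY.measure_packet_eq hQ hY' I MeasurableSet.univ]
  funext x
  cases x
  · rfl
  · rfl
  · exact main (Set.Iio Q.K)
  · exact main {Q.K}

end Independence

/-! ### The protocol is a semi-Markov process -/

/-- Probability of a cylinder event, when the first state is drawn from `g`. -/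
def pathProb (P : Matrix State State ℝ) (F : State → Measure ℝ) :
    (State → ℝ) → ℕ → (ℕ → State) → (ℕ → Set ℝ) → ℝ
  | _, 0, _, _ => 1
  | g, n + 1, x, A => g (x 0) * (F (x 0)).real (A 0) *
      pathProb P F (P (x 0)) n (fun i => x (i + 1)) (fun i => A (i + 1))

/-- `pathProb` peels off the first state, as regeneration does; here it takes the product form of
`IsSemiMarkov.law`. -/
lemma pathProb_succ (P : Matrix State State ℝ) (F : State → Measure ℝ) (g : State → ℝ) (n : ℕ)
    (x : ℕ → State) (A : ℕ → Set ℝ) : pathProb P F g (n + 1) x A =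
      g (x 0) * (∏ i ∈ Finset.range n, P (x i) (x (i + 1))) *
        ∏ i ∈ Finset.range (n + 1), (F (x i)).real (A i) := by
  induction n generalizing g x A with
  | zero => simp [pathProb]
  | succ n ih =>
    rw [pathProb, ih, Finset.prod_range_succ' (fun i => P (x i) (x (i + 1))),
      Finset.prod_range_succ' (fun i => (F (x i)).real (A i)) (n + 1)]
    ring

/-- Law of the first state of the protocol. -/
def Params.initial (Q : Params) : State → ℝ
  | .off2 => 1 - Q.p ^ Q.K
  | .off3 => Q.p ^ Q.K
  | _ => 0

/-- Leaving any state but `off2` means that a fresh packet begins. -/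
lemma transition_of_ne_off2 (Q : Params) {x : State} (hx : x ≠ .off2) :
    Q.transition x = Q.initial := by
  funext y
  cases x <;> cases y <;> simp_all [Params.transition, Params.initial]

/-- The packet that an input belongs to. -/
def Source.packet : Source → ℕ
  | .collision n _ => n
  | .backoff n _ => n
  | .slot n _ _ => n
  | .error n => n

section Protocol

variable {Ω : Type*} [mΩ : MeasurableSpace Ω] {μ : Measure Ω} {Y : Noise Ω} {Q : Params}

omit mΩ in
lemma Noise.info_mono (Y : Noise Ω) {S T : Set Source} (h : S ⊆ T) : Y.info S ≤ Y.info T :=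
  biSup_mono h

omit mΩ in
lemma Noise.measurableSet_shift_cylinder (Y : Noise Ω) (n : ℕ) (x : ℕ → State)
    {A : ℕ → Set ℝ} (hA : ∀ i, MeasurableSet (A i)) :
    MeasurableSet[Y.info {s | s.packet ≠ 0}]
      (cylinder (Y.shift.state Q) (Y.shift.sojourn Q) n x A) := by
  have h : ∀ s, Measurable[Y.info {s | s.packet ≠ 0}] (Y.shift.draw s) := fun s =>
    Noise.measurable_shift_draw s
      (Y.measurable_info (by cases s <;> simp [Source.next, Source.packet]))
  exact @measurableSet_cylinder Ω _ _ (Y.info {s | s.packet ≠ 0})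
    (fun n => @Noise.measurable_state Ω (Y.info {s | s.packet ≠ 0}) _ _ h n)
    (fun n => @Noise.measurable_sojourn Ω (Y.info {s | s.packet ≠ 0}) _ _ h n) n x A hA

omit mΩ in
/-- Delivery and off time of packet `0` do not depend on its reception error. -/
lemma Noise.measurableSet_info_packet (Y : Noise Ω) (Q : Params) (I : Set ℕ) {A : Set ℝ}
    (hA : MeasurableSet A) :
    MeasurableSet[Y.info {s | s.packet = 0 ∧ s ≠ .error 0}]
      {ω | Y.collisions Q 0 ω ∈ I ∧ Y.offTime Q 0 ω ∈ A} := by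
  let m := Y.info {s | s.packet = 0 ∧ s ≠ .error 0}
  have h1 : ∀ j, Measurable[m] (Y.collision 0 j) := fun j =>
    Y.measurable_info (s := .collision 0 j) ⟨rfl, by simp⟩
  have h2 : ∀ j, Measurable[m] (Y.backoff 0 j) := fun j =>
    Y.measurable_info (s := .backoff 0 j) ⟨rfl, by simp⟩
  have h3 : ∀ j d, Measurable[m] (Y.slot 0 j d) := fun j d =>
    Y.measurable_info (s := .slot 0 j d) ⟨rfl, by simp⟩
  exact MeasurableSet.inter
    (@Noise.measurable_collisions Ω m Y Q 0 h1 I MeasurableSet.of_discrete)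
    (@Noise.measurable_offTime Ω m Y Q 0 h1 h2 h3 A hA)

omit mΩ in
lemma Noise.measurableSet_info_error (Y : Noise Ω) (b : Bool) :
    MeasurableSet[Y.info {Source.error 0}] {ω | Y.error 0 ω = b} :=
  Y.measurable_info (s := .error 0) (Set.mem_singleton _)
    (MeasurableSpace.measurableSet_top (s := ({b} : Set Bool)))

variable [IsProbabilityMeasure μ]

omit [IsProbabilityMeasure μ] in
lemma Noise.IsLAA.measureReal_forall_collision (hY : Y.IsLAA Q μ) (n i : ℕ) :
    μ.real {ω | ∀ j < i, Y.collision n j ω = true} = Q.p ^ i := by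
  have hind : iIndepFun (fun j => Y.collision n j) μ :=
    hY.indep.precomp (g := fun j => Source.collision n j) fun a b h => by simpa using h
  have := hind.measure_inter_preimage_eq_mul (Finset.range i) (sets := fun _ => {true})
    (fun _ _ => measurableSet_singleton _)
  have hset : ⋂ j ∈ Finset.range i, Y.collision n j ⁻¹' {true} =
      {ω | ∀ j < i, Y.collision n j ω = true} := by ext; simp
  rw [hset] at this
  rw [measureReal_def, this, ENNReal.toReal_prod]
  refine (Finset.prod_congr rfl fun j _ => hY.collision_law n j).trans ?_
  simp

omit [IsProbabilityMeasure μ] in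
lemma Noise.IsLAA.measureReal_dropped (hY : Y.IsLAA Q μ) (n : ℕ) :
    μ.real (Y.dropped Q n) = Q.p ^ Q.K := by
  rw [← hY.measureReal_forall_collision n]
  congr 1
  ext ω
  exact Y.collisions_eq_K_iff Q ω

omit [IsProbabilityMeasure μ] in
lemma Noise.IsLAA.measurableSet_delivered' (hY : Y.IsLAA Q μ) (n : ℕ) :
    MeasurableSet (Y.delivered Q n) :=
  Noise.measurableSet_delivered fun j => hY.measurable (.collision n j)

lemma Noise.IsLAA.measureReal_delivered (hY : Y.IsLAA Q μ) (n : ℕ) :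
    μ.real (Y.delivered Q n) = 1 - Q.p ^ Q.K := by
  rw [← hY.measureReal_dropped n, Y.dropped_eq_compl,
    probReal_compl_eq_one_sub (hY.measurableSet_delivered' n)]
  ring

omit [IsProbabilityMeasure μ] in
lemma Noise.IsLAA.measurable_offTime' (hY : Y.IsLAA Q μ) (n : ℕ) : Measurable (Y.offTime Q n) :=
  Noise.measurable_offTime (fun j => hY.measurable (.collision n j))
    (fun j => hY.measurable (.backoff n j)) (fun j d => hY.measurable (.slot n j d))

/-- Null `S` is allowed, both sides then being zero; this covers dropped packets when `p = 0`. -/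
lemma measureReal_inter_preimage_eq_cond {S : Set Ω} (hS : MeasurableSet S) {f : Ω → ℝ}
    (hf : Measurable f) {A : Set ℝ} (hA : MeasurableSet A) :
    μ.real (S ∩ f ⁻¹' A) = μ.real S * ((cond μ S).map f).real A := by
  rw [map_measureReal_apply hf hA, measureReal_def (cond μ S), cond_apply hS, ENNReal.toReal_mul,
    ENNReal.toReal_inv, ← measureReal_def, ← measureReal_def]
  rcases eq_or_ne (μ.real S) 0 with h | h
  · rw [h, zero_mul]
    refine le_antisymm (h ▸ measureReal_mono Set.inter_subset_left) measureReal_nonneg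
  · field_simp

/-- Packet `0` is split off, and the remaining path is a cylinder event for `Y.shift`, independent
of packet `0`. The induction is strong because a delivered packet uses up two states, and `Y` is
quantified inside because the noise changes. -/
lemma Noise.IsLAA.measureReal_cylinder (hQ : Q.Valid) (N : ℕ) :
    ∀ (Y : Noise Ω), Y.IsLAA Q μ → ∀ (x : ℕ → State) (A : ℕ → Set ℝ),
      (∀ i, MeasurableSet (A i)) →
      μ.real (cylinder (Y.state Q) (Y.sojourn Q) N x A) =
        pathProb Q.transition (Y.sojournLaw Q μ) Q.initial N x A := by
  induction N using Nat.strong_induction_on with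
  | _ N ih =>
  intro Y hY x A hA
  classical
  rcases N with _ | N
  · simp [cylinder, pathProb]
  have hstate0 : ∀ ω, Y.state Q 0 ω = if ω ∈ Y.delivered Q 0 then .off2 else .off3 := fun ω => by
    by_cases hd : ω ∈ Y.delivered Q 0 <;> simp [Noise.state, Noise.phase, hd]
  have hsoj0 : ∀ ω, Y.sojourn Q 0 ω = Y.offTime Q 0 ω := fun ω => by
    simp [Noise.sojourn, Noise.phase]
  have hlaw := hY.shift.sojournLaw_eq hQ hY
  have hdisj : Disjoint {s : Source | s.packet = 0} {s : Source | s.packet ≠ 0} :=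
    Set.disjoint_left.2 fun s h1 h2 => h2 h1
  have hle0 : Y.info {s | s.packet = 0 ∧ s ≠ .error 0} ≤ Y.info {s | s.packet = 0} :=
    Y.info_mono fun s hs => hs.1
  have hle1 : Y.info {.error 0} ≤ Y.info {s | s.packet = 0} :=
    Y.info_mono fun s hs => by rw [Set.mem_singleton_iff.1 hs]; rfl
  have hdel : μ.real {ω | Y.collisions Q 0 ω ∈ Set.Iio Q.K ∧ Y.offTime Q 0 ω ∈ A 0} =
      (1 - Q.p ^ Q.K) * (Y.sojournLaw Q μ .off2).real (A 0) := by
    rw [← hY.measureReal_delivered 0]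
    exact measureReal_inter_preimage_eq_cond (hY.measurableSet_delivered' 0)
      (hY.measurable_offTime' 0) (hA 0)
  have hdrop : μ.real {ω | Y.collisions Q 0 ω ∈ ({Q.K} : Set ℕ) ∧ Y.offTime Q 0 ω ∈ A 0} =
      Q.p ^ Q.K * (Y.sojournLaw Q μ .off3).real (A 0) := by
    rw [← hY.measureReal_dropped 0]
    exact measureReal_inter_preimage_eq_cond
      (Noise.measurableSet_dropped fun j => hY.measurable (.collision 0 j))
      (hY.measurable_offTime' 0) (hA 0)
  have hmem : ∀ ω, ω ∈ Y.delivered Q 0 ↔ Y.collisions Q 0 ω ∈ Set.Iio Q.K := fun ω => Iff.rfl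
  have hmem' : ∀ ω, ω ∉ Y.delivered Q 0 ↔ Y.collisions Q 0 ω ∈ ({Q.K} : Set ℕ) := fun ω => by
    have := Y.collisions_le Q 0 ω
    rw [hmem, Set.mem_Iio, Set.mem_singleton_iff]
    omega
  have hempty : ∀ y, x 0 = y → y = .on ∨ y = .off1 →
      μ.real (cylinder (Y.state Q) (Y.sojourn Q) (N + 1) x A) =
        pathProb Q.transition (Y.sojournLaw Q μ) Q.initial (N + 1) x A := by
    intro y hy hy'
    have : cylinder (Y.state Q) (Y.sojourn Q) (N + 1) x A = ∅ := by
      refine Set.eq_empty_of_forall_notMem fun ω hω => ?_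
      have := (hω 0 (by omega)).1
      rw [hstate0, hy] at this
      rcases hy' with rfl | rfl <;> split_ifs at this
    rw [this, pathProb, hy]
    rcases hy' with rfl | rfl <;> simp [Params.initial]
  rcases hx0 : x 0 with _ | _ | _ | _
  · exact hempty _ hx0 (Or.inl rfl)
  · exact hempty _ hx0 (Or.inr rfl)
  -- A cylinder of length one ends before the transmission of packet `0`, so the reception error
  -- plays no role.
  · rcases N with _ | N
    · have : cylinder (Y.state Q) (Y.sojourn Q) 1 x A =
          {ω | Y.collisions Q 0 ω ∈ Set.Iio Q.K ∧ Y.offTime Q 0 ω ∈ A 0} := by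
        ext ω
        simp only [cylinder, Set.mem_ofPred_eq, Nat.lt_one_iff, forall_eq, hstate0, hsoj0, hx0,
          ← hmem]
        simp
      rw [this, hdel]
      simp [pathProb, hx0, Params.initial]
    have hstate1 : ∀ ω ∈ Y.delivered Q 0, Y.state Q 1 ω =
        if Y.error 0 ω = true then .off1 else .on := fun ω hω => by
      simp [Noise.state, Noise.phase_one_of_delivered hω]
    have hsoj1 : ∀ ω ∈ Y.delivered Q 0, Y.sojourn Q 1 ω = Q.Tf := fun ω hω => by
      simp [Noise.sojourn, Noise.phase_one_of_delivered hω]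
    have hempty1 : x 1 = .off2 ∨ x 1 = .off3 →
        μ.real (cylinder (Y.state Q) (Y.sojourn Q) (N + 1 + 1) x A) =
          pathProb Q.transition (Y.sojournLaw Q μ) Q.initial (N + 1 + 1) x A := by
      intro hy
      have : cylinder (Y.state Q) (Y.sojourn Q) (N + 1 + 1) x A = ∅ := by
        refine Set.eq_empty_of_forall_notMem fun ω hω => ?_
        have h0 := (hω 0 (by omega)).1
        rw [hstate0, hx0] at h0
        have hd : ω ∈ Y.delivered Q 0 := by
          by_contra h
          rw [if_neg h] at h0
          exact State.noConfusion h0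
        have h1 := (hω 1 (by omega)).1
        rw [hstate1 ω hd] at h1
        rcases hy with hy | hy <;> rw [hy] at h1 <;> split_ifs at h1
      rw [this, pathProb, pathProb, hx0]
      rcases hy with hy | hy <;> simp [hy, Params.transition]
    have hmain : ∀ b : Bool, x 1 = (if b = true then .off1 else .on) →
        μ.real (cylinder (Y.state Q) (Y.sojourn Q) (N + 1 + 1) x A) =
          pathProb Q.transition (Y.sojournLaw Q μ) Q.initial (N + 1 + 1) x A := by
      intro b hb
      -- The transmission lasts exactly `Tf`, so the constraint `A 1` is either impossible or void.
      by_cases hTf : Q.Tf ∈ A 1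
      swap
      · have : cylinder (Y.state Q) (Y.sojourn Q) (N + 1 + 1) x A = ∅ := by
          refine Set.eq_empty_of_forall_notMem fun ω hω => ?_
          have h0 := (hω 0 (by omega)).1
          rw [hstate0, hx0] at h0
          have hd : ω ∈ Y.delivered Q 0 := by
            by_contra h
            rw [if_neg h] at h0
            exact State.noConfusion h0
          have h1 := (hω 1 (by omega)).2
          rw [hsoj1 ω hd] at h1
          exact hTf h1
        rw [this, pathProb, pathProb]
        have : (Y.sojournLaw Q μ (x 1)).real (A 1) = 0 := by
          rw [hb]
          cases b <;> simp [Noise.sojournLaw, measureReal_def, Measure.dirac_apply' _ (hA 1), hTf]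
        simp [this]
      have hset : cylinder (Y.state Q) (Y.sojourn Q) (N + 1 + 1) x A =
          ({ω | Y.collisions Q 0 ω ∈ Set.Iio Q.K ∧ Y.offTime Q 0 ω ∈ A 0} ∩
            {ω | Y.error 0 ω = b}) ∩ cylinder (Y.shift.state Q) (Y.shift.sojourn Q) N
              (fun i => x (i + 2)) (fun i => A (i + 2)) := by
        ext ω
        by_cases hd : ω ∈ Y.delivered Q 0
        · have hsh := Noise.phase_two_of_delivered hd
          have he : (if Y.error 0 ω = true then State.off1 else State.on) = x 1 ↔
              Y.error 0 ω = b := by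
            rw [hb]
            cases b <;> cases Y.error 0 ω <;> simp
          constructor
          · intro h
            have h0 := h 0 (by omega)
            have h1 := h 1 (by omega)
            rw [hsoj0] at h0
            rw [hstate1 ω hd, he] at h1
            refine ⟨⟨⟨hd, h0.2⟩, h1.1⟩, fun i hi => ?_⟩
            rw [← Y.state_shift Q hsh i, ← Y.sojourn_shift Q hsh i, add_comm 2 i]
            exact h (i + 2) (by omega)
          · rintro ⟨⟨⟨-, h0⟩, h1⟩, h2⟩ i hi
            rcases i with _ | _ | i
            · rw [hstate0, if_pos hd, hsoj0, hx0]
              exact ⟨rfl, h0⟩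
            · rw [zero_add, hstate1 ω hd, he, hsoj1 ω hd]
              exact ⟨h1, hTf⟩
            · have := h2 i (by omega)
              rw [← Y.state_shift Q hsh i, ← Y.sojourn_shift Q hsh i, add_comm 2 i] at this
              exact this
        · constructor
          · intro h
            have h0 := (h 0 (by omega)).1
            rw [hstate0, if_neg hd, hx0] at h0
            exact State.noConfusion h0
          · rintro ⟨⟨⟨h, -⟩, -⟩, -⟩
            exact absurd h hd
      have hE := Y.measurableSet_info_packet Q (Set.Iio Q.K) (hA 0)
      have hEr := Y.measurableSet_info_error b
      have herr : μ.real {ω | Y.error 0 ω = b} = if b then Q.ε else 1 - Q.ε := by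
        have := measure_bool_eq (hY.measurable (.error 0)) (hY.error_law 0) b
        rw [measureReal_def]
        refine (congrArg ENNReal.toReal this).trans (ENNReal.toReal_ofReal ?_)
        have := hQ.ε_nonneg
        have := hQ.ε_le_one
        split_ifs <;> linarith
      -- Three independent pieces: delivery and off time of packet `0`, its reception error, and all
      -- later packets.
      rw [hset, hY.measureReal_inter hdisj ((hle0 _ hE).inter (hle1 _ hEr))
        (Y.measurableSet_shift_cylinder N _ fun i => hA (i + 2)),
        hY.measureReal_inter (Set.disjoint_left.2 fun s h1 h2 => h1.2 h2) hE hEr, hdel, herr,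
        ih N (by omega) Y.shift hY.shift _ _ fun i => hA (i + 2), hlaw, pathProb, pathProb]
      have hF : (Y.sojournLaw Q μ (x 1)).real (A 1) = 1 := by
        rw [hb]
        cases b <;> simp [Noise.sojournLaw, measureReal_def, Measure.dirac_apply' _ (hA 1), hTf]
      have hP : Q.transition .off2 (x 1) = if b then Q.ε else 1 - Q.ε := by
        rw [hb]
        cases b <;> simp [Params.transition]
      have hP1 : Q.transition (x 1) = Q.initial := by
        refine transition_of_ne_off2 Q ?_
        rw [hb]
        cases b <;> simp
      simp only [zero_add, hF, hP, hP1, hx0, Params.initial]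
      ring
    rcases hx1 : x 1 with _ | _ | _ | _
    · exact hmain false (by simp [hx1])
    · exact hmain true (by simp [hx1])
    · exact hempty1 (Or.inl hx1)
    · exact hempty1 (Or.inr hx1)
  · have hset : cylinder (Y.state Q) (Y.sojourn Q) (N + 1) x A =
        {ω | Y.collisions Q 0 ω ∈ ({Q.K} : Set ℕ) ∧ Y.offTime Q 0 ω ∈ A 0} ∩
          cylinder (Y.shift.state Q) (Y.shift.sojourn Q) N
            (fun i => x (i + 1)) (fun i => A (i + 1)) := by
      ext ω
      by_cases hd : ω ∈ Y.delivered Q 0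
      · constructor
        · intro h
          have h0 := (h 0 (by omega)).1
          rw [hstate0, if_pos hd, hx0] at h0
          exact State.noConfusion h0
        · rintro ⟨⟨h, -⟩, -⟩
          exact absurd hd ((hmem' ω).2 h)
      · have hsh := Noise.phase_one_of_dropped hd
        constructor
        · intro h
          have h0 := h 0 (by omega)
          rw [hsoj0] at h0
          refine ⟨⟨(hmem' ω).1 hd, h0.2⟩, fun i hi => ?_⟩
          rw [← Y.state_shift Q hsh i, ← Y.sojourn_shift Q hsh i, add_comm 1 i]
          exact h (i + 1) (by omega)
        · rintro ⟨⟨-, h0⟩, h2⟩ i hi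
          rcases i with _ | i
          · rw [hstate0, if_neg hd, hsoj0, hx0]
            exact ⟨rfl, h0⟩
          · have := h2 i (by omega)
            rw [← Y.state_shift Q hsh i, ← Y.sojourn_shift Q hsh i, add_comm 1 i] at this
            exact this
    have hE := Y.measurableSet_info_packet Q {Q.K} (hA 0)
    rw [hset, hY.measureReal_inter hdisj (hle0 _ hE)
      (Y.measurableSet_shift_cylinder N _ fun i => hA (i + 1)), hdrop,
      ih N (by omega) Y.shift hY.shift _ _ fun i => hA (i + 1), hlaw, pathProb, hx0,
      transition_of_ne_off2 Q (by simp)]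
    rfl

lemma isProbabilityMeasure_or_eq_zero {S : Set Ω} {f : Ω → ℝ} (hf : Measurable f) :
    IsProbabilityMeasure ((cond μ S).map f) ∨ (cond μ S).map f = 0 ∧ μ.real S = 0 := by
  rcases eq_or_ne (μ S) 0 with h | h
  · right
    simp [cond_eq_zero_of_meas_eq_zero h, measureReal_def, h]
  · left
    have := cond_isProbabilityMeasure h
    exact Measure.isProbabilityMeasure_map hf.aemeasurable

/-- Degeneracy can occur only for `off3` with `p = 0`, since delivery has positive probability. -/
lemma Noise.IsLAA.sojournLaw_proper (hQ : Q.Valid) (hY : Y.IsLAA Q μ) (y : State) :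
    IsProbabilityMeasure (Y.sojournLaw Q μ y) ∨
      Y.sojournLaw Q μ y = 0 ∧ (∀ x, Q.transition x y = 0) ∧ Q.initial y = 0 := by
  cases y
  · left; unfold Noise.sojournLaw; infer_instance
  · left; unfold Noise.sojournLaw; infer_instance
  · refine (isProbabilityMeasure_or_eq_zero (S := Y.delivered Q 0)
      (hY.measurable_offTime' 0)).imp_right fun h => ?_
    have h2 := h.2
    rw [hY.measureReal_delivered] at h2
    have := pow_lt_one₀ hQ.p_nonneg hQ.p_lt_one (Nat.one_le_iff_ne_zero.1 hQ.K_pos)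
    linarith
  · refine (isProbabilityMeasure_or_eq_zero (S := Y.dropped Q 0)
      (hY.measurable_offTime' 0)).imp_right fun h => ⟨h.1, ?_⟩
    have h2 := h.2
    rw [hY.measureReal_dropped] at h2
    exact ⟨fun x => by cases x <;> simp [Params.transition, h2], h2⟩

lemma Noise.IsLAA.properLaws (hQ : Q.Valid) (hY : Y.IsLAA Q μ) :
    ProperLaws Q.transition (Y.sojournLaw Q μ) := by
  refine ⟨fun x y => ?_, fun y => (hY.sojournLaw_proper hQ y).imp_right fun h => ⟨h.1, h.2.1⟩⟩
  have h1 := hQ.ε_nonneg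
  have h2 := hQ.ε_le_one
  have h3 := pow_nonneg hQ.p_nonneg Q.K
  have h4 := pow_le_one₀ (n := Q.K) hQ.p_nonneg hQ.p_lt_one.le
  cases x <;> cases y <;> simp [Params.transition, *]

/-- The protocol is a semi-Markov process. -/
theorem Noise.IsLAA.isSemiMarkov (hQ : Q.Valid) (hY : Y.IsLAA Q μ) :
    IsSemiMarkov μ Q.transition (Y.sojournLaw Q μ) (Y.state Q) (Y.sojourn Q) where
  measurable_state n := Noise.measurable_state hY.measurable n
  measurable_sojourn n := Noise.measurable_sojourn hY.measurable n
  law n x A hA := by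
    have h1 := Noise.IsLAA.measureReal_cylinder hQ (n + 1) Y hY x A hA
    have h2 := Noise.IsLAA.measureReal_cylinder hQ 1 Y hY x (fun _ => Set.univ)
      (fun _ => MeasurableSet.univ)
    have e1 : {ω | ∀ i ≤ n, Y.state Q i ω = x i ∧ Y.sojourn Q i ω ∈ A i} =
        cylinder (Y.state Q) (Y.sojourn Q) (n + 1) x A := by
      ext; simp [cylinder]
    have e2 : {ω | Y.state Q 0 ω = x 0} =
        cylinder (Y.state Q) (Y.sojourn Q) 1 x (fun _ => Set.univ) := by
      ext; simp [cylinder]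
    -- The law of the first state is read off from a cylinder of length one, which produces an extra
    -- total mass; it is 1 unless `initial` vanishes.
    have e3 : Q.initial (x 0) * (Y.sojournLaw Q μ (x 0)).real (A 0) =
        Q.initial (x 0) * (Y.sojournLaw Q μ (x 0)).real Set.univ *
          (Y.sojournLaw Q μ (x 0)).real (A 0) := by
      rcases hY.sojournLaw_proper hQ (x 0) with h | h
      · simp
      · simp [h.2.2]
    rw [e1, e2, h1, h2, pathProb_succ, pathProb_succ, Finset.prod_range_succ' _ n]
    simp only [Finset.range_zero, Finset.prod_empty, zero_add, Finset.range_one,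
      Finset.prod_singleton]
    linear_combination (∏ i ∈ Finset.range n, Q.transition (x i) (x (i + 1))) *
      (∏ i ∈ Finset.range n, (Y.sojournLaw Q μ (x (i + 1))).real (A (i + 1))) * e3

end Protocol

/-! ### Generating functions in closed form -/

/-- Generating function of the duration of a timeslot. -/
noncomputable def Params.slotPgf (Q : Params) (z : ℝ) : ℝ := ∑ k, Q.slotProb k * z ^ Q.slotDuration k

/-- Generating function of the `j`-th backoff timer. -/
noncomputable def Params.timerPgf (Q : Params) (j : ℕ) (x : ℝ) : ℝ :=
  ∑ m ∈ Finset.range (Q.window j), x ^ m * (1 / (Q.window j : ℝ))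

/-- Generating function of the total duration of the first `i` backoffs. -/
noncomputable def Params.backoffPgf (Q : Params) (i : ℕ) (z : ℝ) : ℝ :=
  ∏ j ∈ Finset.range i, Q.timerPgf j (Q.slotPgf z)

/-- Generating function of the off time of a delivered packet. -/
noncomputable def Params.deliveredPgf (Q : Params) (z : ℝ) : ℝ :=
  (∑ i ∈ Finset.range Q.K, (1 - Q.p) * Q.p ^ i * z ^ ((i : ℝ) * Q.Tc) * Q.backoffPgf (i + 1) z) /
    (1 - Q.p ^ Q.K)

/-- Generating function of the off time of a dropped packet. -/
noncomputable def Params.droppedPgf (Q : Params) (z : ℝ) : ℝ := z ^ ((Q.K : ℝ) * Q.Tc) * Q.backoffPgf Q.K z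

section Pgf

variable {Q : Params}

lemma slotPgf_pos (hQ : Q.Valid) {z : ℝ} (hz : 0 < z) : 0 < Q.slotPgf z := by
  obtain ⟨k, -, hk⟩ : ∃ k ∈ Finset.univ, 0 < Q.slotProb k := by
    by_contra! h
    have := Finset.sum_nonpos h
    rw [hQ.slotProb_sum] at this
    linarith
  exact Finset.sum_pos' (fun k _ => mul_nonneg (hQ.slotProb_nonneg k) (Real.rpow_nonneg hz.le _))
    ⟨k, Finset.mem_univ k, mul_pos hk (Real.rpow_pos_of_pos hz _)⟩

lemma timerPgf_pos (hQ : Q.Valid) (j : ℕ) {x : ℝ} (hx : 0 < x) : 0 < Q.timerPgf j x := by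
  have := window_pos hQ j
  exact Finset.sum_pos (fun m _ => by positivity) ⟨0, Finset.mem_range.2 this⟩

lemma backoffPgf_pos (hQ : Q.Valid) (i : ℕ) {z : ℝ} (hz : 0 < z) : 0 < Q.backoffPgf i z :=
  Finset.prod_pos fun j _ => timerPgf_pos hQ j (slotPgf_pos hQ hz)

lemma one_sub_pow_pos (hQ : Q.Valid) : 0 < 1 - Q.p ^ Q.K := by
  have := pow_lt_one₀ hQ.p_nonneg hQ.p_lt_one (Nat.one_le_iff_ne_zero.1 hQ.K_pos)
  linarith

lemma droppedPgf_pos (hQ : Q.Valid) {z : ℝ} (hz : 0 < z) : 0 < Q.droppedPgf z :=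
  mul_pos (Real.rpow_pos_of_pos hz _) (backoffPgf_pos hQ _ hz)

lemma deliveredPgf_pos (hQ : Q.Valid) {z : ℝ} (hz : 0 < z) : 0 < Q.deliveredPgf z := by
  have h1 : 0 < 1 - Q.p := by linarith [hQ.p_lt_one]
  have h2 := hQ.p_nonneg
  refine div_pos (Finset.sum_pos' (fun i _ => ?_) ⟨0, Finset.mem_range.2 hQ.K_pos, ?_⟩)
    (one_sub_pow_pos hQ)
  · have := backoffPgf_pos hQ (i + 1) hz
    positivity
  · have := backoffPgf_pos hQ 1 hz
    simp only [pow_zero, zero_add]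
    positivity

variable {Ω : Type*} [mΩ : MeasurableSpace Ω] {μ : Measure Ω} {Y : Noise Ω}

omit mΩ in
lemma measurable_indicator_const {m : MeasurableSpace Ω} {s : Set Ω} (hs : MeasurableSet[m] s)
    (c : ℝ≥0∞) : Measurable[m] (s.indicator fun _ => c) :=
  measurable_const.indicator hs

lemma lintegral_eq_sum_of_ae_lt {Z : Ω → ℕ} (hZ : Measurable Z) {N : ℕ}
    (h : ∀ᵐ ω ∂μ, Z ω < N) (f : Ω → ℝ≥0∞) :
    ∫⁻ ω, f ω ∂μ = ∑ m ∈ Finset.range N, ∫⁻ ω in {ω | Z ω = m}, f ω ∂μ := by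
  have hm : ∀ m, MeasurableSet {ω | Z ω = m} := fun m => hZ (measurableSet_singleton m)
  rw [← lintegral_biUnion_finset _ fun m _ => hm m]
  · have : (⋃ m ∈ Finset.range N, {ω | Z ω = m} : Set Ω) =ᵐ[μ] Set.univ := by
      filter_upwards [h] with ω hω
      refine propext ⟨fun _ => trivial, fun _ => ?_⟩
      exact Set.mem_biUnion (Finset.mem_coe.2 (Finset.mem_range.2 hω)) rfl
    rw [setLIntegral_congr this, Measure.restrict_univ]
  · intro a _ b _ hab
    exact Set.disjoint_left.2 fun ω h1 h2 => hab (h1.symm.trans h2)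

lemma Noise.IsLAA.lintegral_slot (hQ : Q.Valid) (hY : Y.IsLAA Q μ) [IsProbabilityMeasure μ]
    {z : ℝ} (hz : 0 < z) (n j d : ℕ) :
    ∫⁻ ω, ENNReal.ofReal (z ^ Q.slotDuration (Y.slot n j d ω)) ∂μ =
      ENNReal.ofReal (Q.slotPgf z) := by
  have hm : Measurable (Y.slot n j d) := hY.measurable (.slot n j d)
  rw [lintegral_eq_sum_fiber hm, Params.slotPgf, ENNReal.ofReal_sum_of_nonneg
    fun k _ => mul_nonneg (hQ.slotProb_nonneg k) (Real.rpow_nonneg hz.le _)]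
  refine Finset.sum_congr rfl fun k _ => ?_
  have hk : MeasurableSet {ω | Y.slot n j d ω = k} := hm (measurableSet_singleton k)
  rw [setLIntegral_congr_fun (g := fun _ => ENNReal.ofReal (z ^ Q.slotDuration k)) hk
    (by rintro ω rfl; rfl), setLIntegral_const, ENNReal.ofReal_mul (hQ.slotProb_nonneg k),
    ← hY.slot_law n j d k, ofReal_measureReal, mul_comm]

lemma Noise.IsLAA.lintegral_backoff (hQ : Q.Valid) (hY : Y.IsLAA Q μ) [IsProbabilityMeasure μ]
    (n j : ℕ) {x : ℝ} (hx : 0 < x) :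
    ∫⁻ ω, ENNReal.ofReal (x ^ Y.backoff n j ω) ∂μ = ENNReal.ofReal (Q.timerPgf j x) := by
  have hm : Measurable (Y.backoff n j) := hY.measurable (.backoff n j)
  rw [lintegral_eq_sum_of_ae_lt hm ((hY.ae_backoff_lt hQ).mono fun ω h => h n j), Params.timerPgf,
    ENNReal.ofReal_sum_of_nonneg fun m _ => by positivity]
  refine Finset.sum_congr rfl fun m hmW => ?_
  have hk : MeasurableSet {ω | Y.backoff n j ω = m} := hm (measurableSet_singleton m)
  rw [setLIntegral_congr_fun (g := fun _ => ENNReal.ofReal (x ^ m)) hk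
    (by rintro ω rfl; rfl), setLIntegral_const, hY.measure_backoff hQ,
    if_pos (Finset.mem_range.1 hmW), ENNReal.ofReal_mul (by positivity)]

/-- The inputs of the first `i` backoffs of packet `n`. -/
def Source.backoffs (n i : ℕ) : Set Source :=
  {s | ∃ j < i, s = .backoff n j ∨ ∃ d, s = .slot n j d}

omit mΩ in
lemma Noise.measurable_slotFactor (Y : Noise Ω) (Q : Params) (z : ℝ) {S : Set Source} {n j d : ℕ}
    (h : .slot n j d ∈ S) :
    Measurable[Y.info S] fun ω => ENNReal.ofReal (z ^ Q.slotDuration (Y.slot n j d ω)) := by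
  have h1 : Measurable[Y.info S] (Y.slot n j d) := Y.measurable_info h
  exact (measurable_from_top (f := fun k => ENNReal.ofReal (z ^ Q.slotDuration k))).comp h1

omit mΩ in
lemma Noise.measurable_slotFactors (Y : Noise Ω) (Q : Params) (z : ℝ) (n j m : ℕ) :
    Measurable[Y.info {s | ∃ d < m, s = .slot n j d}] fun ω =>
      ∏ d ∈ Finset.range m, ENNReal.ofReal (z ^ Q.slotDuration (Y.slot n j d ω)) :=
  @Finset.measurable_fun_prod _ _ _ _ _ _ (Y.info {s | ∃ d < m, s = .slot n j d}) _ _ fun d hd =>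
    Y.measurable_slotFactor Q z ⟨d, Finset.mem_range.1 hd, rfl⟩

lemma Noise.IsLAA.lintegral_slots (hQ : Q.Valid) (hY : Y.IsLAA Q μ) [IsProbabilityMeasure μ]
    {z : ℝ} (hz : 0 < z) (n j m : ℕ) :
    ∫⁻ ω, ∏ d ∈ Finset.range m, ENNReal.ofReal (z ^ Q.slotDuration (Y.slot n j d ω)) ∂μ =
      ENNReal.ofReal (Q.slotPgf z) ^ m := by
  induction m with
  | zero => simp
  | succ m ih =>
    have hd : Disjoint {s : Source | ∃ d < m, s = .slot n j d} {.slot n j m} := by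
      rw [Set.disjoint_singleton_right]
      rintro ⟨d, hd, h⟩
      simp only [Source.slot.injEq, true_and] at h
      omega
    simp only [Finset.prod_range_succ]
    rw [hY.lintegral_mul hd (Y.measurable_slotFactors Q z n j m)
      (Y.measurable_slotFactor Q z (Set.mem_singleton _)), ih, hY.lintegral_slot hQ hz, pow_succ]

lemma ofReal_rpow_sum {ι : Type*} (s : Finset ι) (f : ι → ℝ) {z : ℝ} (hz : 0 < z) :
    ENNReal.ofReal (z ^ ∑ i ∈ s, f i) = ∏ i ∈ s, ENNReal.ofReal (z ^ f i) := by
  rw [Real.rpow_sum_of_pos hz, ENNReal.ofReal_prod_of_nonneg fun i _ => Real.rpow_nonneg hz.le _]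

/-- A random sum: on the event that the timer equals `m`, the backoff consists of `m` independent
slots, independent of the timer, so the generating functions are composed. -/
lemma Noise.IsLAA.lintegral_backoffTime (hQ : Q.Valid) (hY : Y.IsLAA Q μ)
    [IsProbabilityMeasure μ] {z : ℝ} (hz : 0 < z) (n j : ℕ) :
    ∫⁻ ω, ENNReal.ofReal (z ^ Y.backoffTime Q n j ω) ∂μ =
      ENNReal.ofReal (Q.timerPgf j (Q.slotPgf z)) := by
  have hm : Measurable (Y.backoff n j) := hY.measurable (.backoff n j)
  rw [lintegral_eq_sum_of_ae_lt hm ((hY.ae_backoff_lt hQ).mono fun ω h => h n j), Params.timerPgf,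
    ENNReal.ofReal_sum_of_nonneg fun m _ =>
      mul_nonneg (pow_nonneg (slotPgf_pos hQ hz).le _) (by positivity)]
  refine Finset.sum_congr rfl fun m hmW => ?_
  have hk' : MeasurableSet[Y.info {.backoff n j}] {ω | Y.backoff n j ω = m} :=
    Y.measurable_info (s := .backoff n j) (Set.mem_singleton _)
      (MeasurableSpace.measurableSet_top (s := ({m} : Set ℕ)))
  have hk : MeasurableSet {ω | Y.backoff n j ω = m} := hY.info_le _ _ hk'
  have hd : Disjoint {Source.backoff n j} {s : Source | ∃ d < m, s = .slot n j d} := by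
    rw [Set.disjoint_singleton_left]
    rintro ⟨d, -, h⟩
    exact Source.noConfusion h
  have hg : Measurable[Y.info {.backoff n j}]
      ({ω | Y.backoff n j ω = m}.indicator fun _ => (1 : ℝ≥0∞)) :=
    measurable_indicator_const hk' 1
  have key : ∫⁻ ω in {ω | Y.backoff n j ω = m}, ENNReal.ofReal (z ^ Y.backoffTime Q n j ω) ∂μ =
      ∫⁻ ω, {ω | Y.backoff n j ω = m}.indicator (fun _ => (1 : ℝ≥0∞)) ω *
        ∏ d ∈ Finset.range m, ENNReal.ofReal (z ^ Q.slotDuration (Y.slot n j d ω)) ∂μ := by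
    rw [← lintegral_indicator hk]
    refine lintegral_congr fun ω => ?_
    by_cases h : Y.backoff n j ω = m
    · rw [Set.indicator_of_mem (show ω ∈ {ω | Y.backoff n j ω = m} from h),
        Set.indicator_of_mem (show ω ∈ {ω | Y.backoff n j ω = m} from h), one_mul,
        Noise.backoffTime, h, ofReal_rpow_sum _ _ hz]
    · rw [Set.indicator_of_notMem (show ω ∉ {ω | Y.backoff n j ω = m} from h),
        Set.indicator_of_notMem (show ω ∉ {ω | Y.backoff n j ω = m} from h), zero_mul]
  rw [key, hY.lintegral_mul hd hg (Y.measurable_slotFactors Q z n j m), hY.lintegral_slots hQ hz,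
    lintegral_indicator hk, setLIntegral_one, hY.measure_backoff hQ,
    if_pos (Finset.mem_range.1 hmW), ENNReal.ofReal_mul (pow_nonneg (slotPgf_pos hQ hz).le _),
    ENNReal.ofReal_pow (slotPgf_pos hQ hz).le, mul_comm]

omit mΩ in
lemma Noise.measurable_backoffFactor (Y : Noise Ω) (Q : Params) (z : ℝ) {n j : ℕ} {S : Set Source}
    (h1 : .backoff n j ∈ S) (h2 : ∀ d, .slot n j d ∈ S) :
    Measurable[Y.info S] fun ω => ENNReal.ofReal (z ^ Y.backoffTime Q n j ω) := by
  have h : Measurable[Y.info S] (Y.backoffTime Q n j) :=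
    @Noise.measurable_backoffTime Ω (Y.info S) Y Q n j (Y.measurable_info h1)
      fun d => Y.measurable_info (h2 d)
  have hz : Measurable fun x : ℝ => ENNReal.ofReal (z ^ x) := by fun_prop
  exact hz.comp h

omit mΩ in
lemma Noise.measurable_backoffFactors (Y : Noise Ω) (Q : Params) (z : ℝ) (n i : ℕ) :
    Measurable[Y.info (Source.backoffs n i)] fun ω =>
      ∏ j ∈ Finset.range i, ENNReal.ofReal (z ^ Y.backoffTime Q n j ω) :=
  @Finset.measurable_fun_prod _ _ _ _ _ _ (Y.info (Source.backoffs n i)) _ _ fun j hj =>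
    Y.measurable_backoffFactor Q z ⟨j, Finset.mem_range.1 hj, Or.inl rfl⟩
      fun d => ⟨j, Finset.mem_range.1 hj, Or.inr ⟨d, rfl⟩⟩

lemma Noise.IsLAA.lintegral_backoffTimes (hQ : Q.Valid) (hY : Y.IsLAA Q μ)
    [IsProbabilityMeasure μ] {z : ℝ} (hz : 0 < z) (n i : ℕ) :
    ∫⁻ ω, ∏ j ∈ Finset.range i, ENNReal.ofReal (z ^ Y.backoffTime Q n j ω) ∂μ =
      ENNReal.ofReal (Q.backoffPgf i z) := by
  induction i with
  | zero => simp [Params.backoffPgf]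
  | succ i ih =>
    have hd : Disjoint (Source.backoffs n i)
        {s : Source | s = .backoff n i ∨ ∃ d, s = .slot n i d} := by
      rw [Set.disjoint_left]
      rintro _ ⟨j, hj, rfl | ⟨d, rfl⟩⟩ (h | ⟨d, h⟩)
      · simp only [Source.backoff.injEq, true_and] at h
        omega
      · exact Source.noConfusion h
      · exact Source.noConfusion h
      · simp only [Source.slot.injEq, true_and] at h
        omega
    simp only [Finset.prod_range_succ]
    rw [hY.lintegral_mul hd (Y.measurable_backoffFactors Q z n i)
      (Y.measurable_backoffFactor Q z (Or.inl rfl) fun d => Or.inr ⟨d, rfl⟩), ih,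
      hY.lintegral_backoffTime hQ hz, ← ENNReal.ofReal_mul (backoffPgf_pos hQ i hz).le,
      Params.backoffPgf, Params.backoffPgf, Finset.prod_range_succ]

/-- On this event the number of backoffs is the constant `min (i + 1) K`, and the event depends only
on collision inputs, which are independent of the backoffs. -/
lemma Noise.IsLAA.setLIntegral_offTime (hQ : Q.Valid) (hY : Y.IsLAA Q μ)
    [IsProbabilityMeasure μ] {z : ℝ} (hz : 0 < z) (n i : ℕ) :
    ∫⁻ ω in {ω | Y.collisions Q n ω = i}, ENNReal.ofReal (z ^ Y.offTime Q n ω) ∂μ =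
      ENNReal.ofReal (μ.real {ω | Y.collisions Q n ω = i} *
        (z ^ ((i : ℝ) * Q.Tc) * Q.backoffPgf (min (i + 1) Q.K) z)) := by
  set k := min (i + 1) Q.K
  let S : Set Source := Set.range fun j => Source.collision n j
  have hk' : MeasurableSet[Y.info S] {ω | Y.collisions Q n ω = i} := by
    have h1 : ∀ j, Measurable[Y.info S] (Y.collision n j) := fun j =>
      Y.measurable_info (s := .collision n j) ⟨j, rfl⟩
    exact @Noise.measurable_collisions Ω (Y.info S) Y Q n h1 {i} MeasurableSet.of_discrete
  have hk : MeasurableSet {ω | Y.collisions Q n ω = i} := hY.info_le _ _ hk'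
  have hd : Disjoint S (Source.backoffs n k) := by
    rw [Set.disjoint_left]
    rintro _ ⟨j, rfl⟩ ⟨j', -, h | ⟨d, h⟩⟩ <;> exact Source.noConfusion h
  have hg : Measurable[Y.info S] ({ω | Y.collisions Q n ω = i}.indicator fun _ =>
      ENNReal.ofReal (z ^ ((i : ℝ) * Q.Tc))) :=
    measurable_indicator_const hk' _
  have key : ∫⁻ ω in {ω | Y.collisions Q n ω = i}, ENNReal.ofReal (z ^ Y.offTime Q n ω) ∂μ =
      ∫⁻ ω, {ω | Y.collisions Q n ω = i}.indicator
        (fun _ => ENNReal.ofReal (z ^ ((i : ℝ) * Q.Tc))) ω *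
        ∏ j ∈ Finset.range k, ENNReal.ofReal (z ^ Y.backoffTime Q n j ω) ∂μ := by
    rw [← lintegral_indicator hk]
    refine lintegral_congr fun ω => ?_
    by_cases h : Y.collisions Q n ω = i
    · rw [Set.indicator_of_mem (show ω ∈ {ω | Y.collisions Q n ω = i} from h),
        Set.indicator_of_mem (show ω ∈ {ω | Y.collisions Q n ω = i} from h),
        Noise.offTime, h, Real.rpow_add hz, ENNReal.ofReal_mul (Real.rpow_nonneg hz.le _),
        ofReal_rpow_sum _ _ hz]
    · rw [Set.indicator_of_notMem (show ω ∉ {ω | Y.collisions Q n ω = i} from h),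
        Set.indicator_of_notMem (show ω ∉ {ω | Y.collisions Q n ω = i} from h), zero_mul]
  rw [key, hY.lintegral_mul hd hg (Y.measurable_backoffFactors Q z n k),
    hY.lintegral_backoffTimes hQ hz, lintegral_indicator hk, setLIntegral_const,
    ENNReal.ofReal_mul measureReal_nonneg, ENNReal.ofReal_mul (Real.rpow_nonneg hz.le _),
    ofReal_measureReal]
  ring

/-- Exactly `i` collisions means that the first `i` attempts collide but not the first `i + 1`,
giving `p ^ i - p ^ (i + 1)`. -/
lemma Noise.IsLAA.measureReal_collisions (hY : Y.IsLAA Q μ) [IsProbabilityMeasure μ]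
    {i : ℕ} (hi : i < Q.K) (n : ℕ) :
    μ.real {ω | Y.collisions Q n ω = i} = (1 - Q.p) * Q.p ^ i := by
  have hm : ∀ j, Measurable (Y.collision n j) := fun j => hY.measurable (.collision n j)
  have hset : {ω | Y.collisions Q n ω = i} = {ω | ∀ j < i, Y.collision n j ω = true} \
      {ω | ∀ j < i + 1, Y.collision n j ω = true} := by
    ext ω
    simp only [Set.mem_ofPred_eq, Y.collisions_eq_iff Q hi, Set.mem_sdiff, Nat.forall_lt_succ_right]
    constructor
    · rintro ⟨h1, h2⟩
      exact ⟨h1, by simp [h2]⟩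
    · rintro ⟨h1, h2⟩
      exact ⟨h1, Bool.eq_false_of_not_eq_true fun h => h2 ⟨h1, h⟩⟩
  have hmeas : MeasurableSet {ω | ∀ j < i + 1, Y.collision n j ω = true} := by
    have : {ω | ∀ j < i + 1, Y.collision n j ω = true} =
      ⋂ j, ⋂ _ : j < i + 1, Y.collision n j ⁻¹' {true} := by ext; simp
    rw [this]
    exact MeasurableSet.iInter fun j => MeasurableSet.iInter fun _ =>
      hm j (measurableSet_singleton _)
  have hsub : {ω | ∀ j < i + 1, Y.collision n j ω = true} ⊆
      {ω | ∀ j < i, Y.collision n j ω = true} := fun ω h j hj => h j (by omega)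
  rw [hset, measureReal_sdiff hsub hmeas,
    hY.measureReal_forall_collision, hY.measureReal_forall_collision]
  ring

lemma Noise.IsLAA.lintegral_delivered (hQ : Q.Valid) (hY : Y.IsLAA Q μ)
    [IsProbabilityMeasure μ] {z : ℝ} (hz : 0 < z) :
    ∫⁻ ω, ENNReal.ofReal (z ^ Y.offTime Q 0 ω) ∂(cond μ (Y.delivered Q 0)) =
      ENNReal.ofReal (Q.deliveredPgf z) := by
  have hm : Measurable (Y.collisions Q 0) :=
    Noise.measurable_collisions fun j => hY.measurable (.collision 0 j)
  have hdel := hY.measurableSet_delivered' 0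
  have hp := one_sub_pow_pos hQ
  have h1 : 0 ≤ 1 - Q.p := by linarith [hQ.p_lt_one]
  have h2 := hQ.p_nonneg
  have hinv : (μ (Y.delivered Q 0))⁻¹ = ENNReal.ofReal (1 - Q.p ^ Q.K)⁻¹ := by
    rw [ENNReal.ofReal_inv_of_pos hp, ← hY.measureReal_delivered 0, ofReal_measureReal]
  rw [ProbabilityTheory.cond, lintegral_smul_measure, hinv, lintegral_eq_sum_of_ae_lt hm
    (ae_restrict_of_forall_mem hdel fun ω h => h), smul_eq_mul, Params.deliveredPgf,
    div_eq_inv_mul, ENNReal.ofReal_mul (inv_nonneg.2 hp.le), ENNReal.ofReal_sum_of_nonneg]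
  · congr 1
    refine Finset.sum_congr rfl fun i hi => ?_
    rw [Finset.mem_range] at hi
    have hset : {ω | Y.collisions Q 0 ω = i} ∩ Y.delivered Q 0 = {ω | Y.collisions Q 0 ω = i} :=
      Set.inter_eq_left.2 fun ω (h : Y.collisions Q 0 ω = i) => by
        rw [← h] at hi; exact hi
    have hi' : MeasurableSet {ω | Y.collisions Q 0 ω = i} := hm (measurableSet_singleton i)
    rw [Measure.restrict_restrict hi', hset, hY.setLIntegral_offTime hQ hz,
      hY.measureReal_collisions hi, min_eq_left (show i + 1 ≤ Q.K from hi), mul_assoc _ (z ^ _)]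
  · intro i _
    have := (backoffPgf_pos hQ (i + 1) hz).le
    positivity

lemma Noise.IsLAA.lintegral_dropped (hQ : Q.Valid) (hY : Y.IsLAA Q μ)
    [IsProbabilityMeasure μ] {z : ℝ} (hz : 0 < z) (hp : 0 < Q.p) :
    ∫⁻ ω, ENNReal.ofReal (z ^ Y.offTime Q 0 ω) ∂(cond μ (Y.dropped Q 0)) =
      ENNReal.ofReal (Q.droppedPgf z) := by
  have hpK : 0 < Q.p ^ Q.K := by positivity
  have hinv : (μ (Y.dropped Q 0))⁻¹ = ENNReal.ofReal (Q.p ^ Q.K)⁻¹ := by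
    rw [ENNReal.ofReal_inv_of_pos hpK, ← hY.measureReal_dropped 0, ofReal_measureReal]
  have h := hY.setLIntegral_offTime hQ hz 0 Q.K
  have h' := hY.measureReal_dropped 0
  rw [Noise.dropped] at h'
  rw [h', min_eq_right (Nat.le_succ _)] at h
  rw [ProbabilityTheory.cond, lintegral_smul_measure, hinv, smul_eq_mul, Noise.dropped, h,
    ← ENNReal.ofReal_mul (by positivity), inv_mul_cancel_left₀ hpK.ne', Params.droppedPgf]

/-- Passing to the lower integral makes integrability questions disappear. -/
lemma pgf_eq_toReal {ν : Measure Ω} {V : Ω → ℝ} (hV : Measurable V) {z : ℝ} (hz : 0 < z) :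
    pgf ν V z = (∫⁻ ω, ENNReal.ofReal (z ^ V ω) ∂ν).toReal :=
  integral_eq_lintegral_of_nonneg_ae (ae_of_all _ fun _ => Real.rpow_nonneg hz.le _)
    (Measurable.pow measurable_const hV).aestronglyMeasurable

variable [IsProbabilityMeasure μ]

lemma Noise.IsLAA.t1Hat_eq_deliveredPgf (hQ : Q.Valid) (hY : Y.IsLAA Q μ) {z : ℝ} (hz : 0 < z) :
    Y.t1Hat Q μ z = Q.deliveredPgf z := by
  rw [Noise.t1Hat, pgf_eq_toReal (hY.measurable_offTime' 0) hz, hY.lintegral_delivered hQ hz,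
    ENNReal.toReal_ofReal (deliveredPgf_pos hQ hz).le]

lemma Noise.IsLAA.t2Hat_eq_droppedPgf (hQ : Q.Valid) (hY : Y.IsLAA Q μ) {z : ℝ} (hz : 0 < z)
    (hp : 0 < Q.p) : Y.t2Hat Q μ z = Q.droppedPgf z := by
  rw [Noise.t2Hat, pgf_eq_toReal (hY.measurable_offTime' 0) hz, hY.lintegral_dropped hQ hz hp,
    ENNReal.toReal_ofReal (droppedPgf_pos hQ hz).le]

lemma Noise.IsLAA.etaHat_eq_timerPgf (hQ : Q.Valid) (hY : Y.IsLAA Q μ) (j : ℕ) {z : ℝ}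
    (hz : 0 < z) : Y.etaHat μ j z = Q.timerPgf j z := by
  have hm : Measurable (Y.backoff 0 j) := hY.measurable (.backoff 0 j)
  have hm' : Measurable fun ω => (Y.backoff 0 j ω : ℝ) := measurable_from_top.comp hm
  rw [Noise.etaHat, pgf_eq_toReal hm' hz]
  simp only [Real.rpow_natCast]
  rw [hY.lintegral_backoff hQ 0 j hz, ENNReal.toReal_ofReal (timerPgf_pos hQ j hz).le]

lemma Noise.IsLAA.tauHat_eq_slotPgf (hQ : Q.Valid) (hY : Y.IsLAA Q μ) {z : ℝ} (hz : 0 < z) :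
    Y.tauHat Q μ z = Q.slotPgf z := by
  have hm : Measurable (Y.slot 0 0 0) := hY.measurable (.slot 0 0 0)
  have hm' : Measurable fun ω => Q.slotDuration (Y.slot 0 0 0 ω) :=
    (measurable_from_top (f := Q.slotDuration)).comp hm
  rw [Noise.tauHat, pgf_eq_toReal hm' hz, hY.lintegral_slot hQ hz, ENNReal.toReal_ofReal (slotPgf_pos hQ hz).le]

lemma slotPgf_eq (Q : Params) (z : ℝ) : Q.slotPgf z =
    Q.slotProb .idle * z ^ Q.sIdle + Q.slotProb .wifiCollision * z ^ Q.Tcw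
      + Q.slotProb .laaCollision * z ^ Q.Tc + Q.slotProb .wifiSuccess * z ^ Q.Tsw
      + Q.slotProb .laaSuccess * z ^ Q.Tf + Q.slotProb .mixedCollision * z ^ Q.Twl := by
  have : (Finset.univ : Finset SlotKind) =
    {.idle, .wifiCollision, .laaCollision, .wifiSuccess, .laaSuccess, .mixedCollision} := rfl
  rw [Params.slotPgf, this]
  simp [Params.slotDuration]
  ring

lemma timerPgf_of_ne_one (Q : Params) (j : ℕ) {x : ℝ} (hx : x ≠ 1) :
    Q.timerPgf j x = 1 / (Q.window j : ℝ) * ((1 - x ^ Q.window j) / (1 - x)) := by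
  rw [Params.timerPgf, ← Finset.sum_mul, geom_sum_eq hx, mul_comm,
    ← neg_div_neg_eq (x ^ _ - 1), neg_sub, neg_sub]

lemma timerPgf_one (hQ : Q.Valid) (j : ℕ) : Q.timerPgf j 1 = 1 := by
  have : (Q.window j : ℝ) ≠ 0 := by exact_mod_cast (window_pos hQ j).ne'
  simp [Params.timerPgf, this]

end Pgf

/-! ### The equation for the effective capacity -/

section Equation

variable {Q : Params}

/-- The left-hand side of the equation for the effective capacity, as a function of `θ * C`. -/
noncomputable def Params.cyclePgf (Q : Params) (θ l : ℝ) : ℝ :=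
  (1 - Q.p ^ Q.K) * Q.deliveredPgf (Real.exp l)
      * (Real.exp ((-Q.R * θ + l) * Q.Tf) * (1 - Q.ε) + Real.exp (l * Q.Tf) * Q.ε)
    + Q.p ^ Q.K * Q.droppedPgf (Real.exp l)

lemma slotDuration_pos (hQ : Q.Valid) (k : SlotKind) : 0 < Q.slotDuration k := by
  cases k
  exacts [hQ.sIdle_pos, hQ.Tcw_pos, hQ.Tc_pos, hQ.Tsw_pos, hQ.Tf_pos, hQ.Twl_pos]

lemma slotPgf_mono (hQ : Q.Valid) {z z' : ℝ} (hz : 0 < z) (h : z ≤ z') :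
    Q.slotPgf z ≤ Q.slotPgf z' :=
  Finset.sum_le_sum fun k _ => mul_le_mul_of_nonneg_left
    (Real.rpow_le_rpow hz.le h (slotDuration_pos hQ k).le) (hQ.slotProb_nonneg k)

lemma timerPgf_mono (Q : Params) (j : ℕ) {z z' : ℝ} (hz : 0 < z) (h : z ≤ z') :
    Q.timerPgf j z ≤ Q.timerPgf j z' :=
  Finset.sum_le_sum fun m _ => by gcongr

lemma backoffPgf_mono (hQ : Q.Valid) (i : ℕ) {z z' : ℝ} (hz : 0 < z) (h : z ≤ z') :
    Q.backoffPgf i z ≤ Q.backoffPgf i z' :=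
  Finset.prod_le_prod (fun j _ => (timerPgf_pos hQ j (slotPgf_pos hQ hz)).le)
    fun j _ => timerPgf_mono Q j (slotPgf_pos hQ hz) (slotPgf_mono hQ hz h)

lemma deliveredPgf_mono (hQ : Q.Valid) {z z' : ℝ} (hz : 0 < z) (h : z ≤ z') :
    Q.deliveredPgf z ≤ Q.deliveredPgf z' := by
  have h1 : 0 ≤ 1 - Q.p := by linarith [hQ.p_lt_one]
  have h2 := hQ.p_nonneg
  have h3 := hQ.Tc_pos
  refine div_le_div_of_nonneg_right (Finset.sum_le_sum fun i _ => ?_) (one_sub_pow_pos hQ).le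
  have := (backoffPgf_pos hQ (i + 1) hz).le
  exact mul_le_mul (mul_le_mul_of_nonneg_left (Real.rpow_le_rpow hz.le h (by positivity))
    (by positivity)) (backoffPgf_mono hQ _ hz h) this
    (mul_nonneg (by positivity) (Real.rpow_nonneg (hz.le.trans h) _))

lemma droppedPgf_mono (hQ : Q.Valid) {z z' : ℝ} (hz : 0 < z) (h : z ≤ z') :
    Q.droppedPgf z ≤ Q.droppedPgf z' := by
  have h3 := hQ.Tc_pos
  exact mul_le_mul (Real.rpow_le_rpow hz.le h (by positivity)) (backoffPgf_mono hQ _ hz h)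
    (backoffPgf_pos hQ _ hz).le (Real.rpow_nonneg (hz.le.trans h) _)

lemma slotPgf_one (hQ : Q.Valid) : Q.slotPgf 1 = 1 := by
  simp [Params.slotPgf, hQ.slotProb_sum]

lemma backoffPgf_one (hQ : Q.Valid) (i : ℕ) : Q.backoffPgf i 1 = 1 := by
  simp [Params.backoffPgf, slotPgf_one hQ, timerPgf_one hQ]

lemma deliveredPgf_one (hQ : Q.Valid) : Q.deliveredPgf 1 = 1 := by
  have h := mul_neg_geom_sum Q.p Q.K
  rw [Params.deliveredPgf, div_eq_one_iff_eq (one_sub_pow_pos hQ).ne', ← h, Finset.mul_sum]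
  simp [backoffPgf_one hQ]

lemma droppedPgf_one (hQ : Q.Valid) : Q.droppedPgf 1 = 1 := by
  simp [Params.droppedPgf, backoffPgf_one hQ]

lemma continuous_exp_rpow (a : ℝ) : Continuous fun l : ℝ => Real.exp l ^ a :=
  Real.continuous_exp.rpow_const fun l => Or.inl (Real.exp_pos l).ne'

lemma continuous_backoffPgf (Q : Params) (i : ℕ) :
    Continuous fun l : ℝ => Q.backoffPgf i (Real.exp l) := by
  have h : Continuous fun l : ℝ => Q.slotPgf (Real.exp l) :=
    continuous_finsetSum _ fun k _ => (continuous_exp_rpow _).const_mul _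
  exact continuous_finsetProd _ fun j _ => continuous_finsetSum _ fun m _ =>
    (h.pow m).mul_const _

lemma continuous_cyclePgf (Q : Params) (θ : ℝ) : Continuous (Q.cyclePgf θ) := by
  have h1 : Continuous fun l : ℝ => Q.deliveredPgf (Real.exp l) :=
    (continuous_finsetSum _ fun i _ => ((continuous_exp_rpow _).const_mul _).mul
      (continuous_backoffPgf Q _)).div_const _
  have h2 : Continuous fun l : ℝ => Q.droppedPgf (Real.exp l) :=
    (continuous_exp_rpow _).mul (continuous_backoffPgf Q _)
  unfold Params.cyclePgf
  fun_prop

/-- The off-time generating functions may be constant (no waiting when `W = K = 1`); strictness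
comes from the transmission factor, since `Tf > 0`, and its coefficient is positive. -/
lemma strictMono_cyclePgf (hQ : Q.Valid) (θ : ℝ) : StrictMono (Q.cyclePgf θ) := by
  intro l l' h
  have hexp : Real.exp l ≤ Real.exp l' := Real.exp_le_exp.2 h.le
  have h1 := deliveredPgf_mono hQ (Real.exp_pos l) hexp
  have h1' := deliveredPgf_pos hQ (Real.exp_pos l)
  have h2 := droppedPgf_mono hQ (Real.exp_pos l) hexp
  have h3 := one_sub_pow_pos hQ
  have h4 : 0 ≤ Q.p ^ Q.K := pow_nonneg hQ.p_nonneg _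
  have hT := mul_lt_mul_of_pos_right h hQ.Tf_pos
  have h5 : Real.exp ((-Q.R * θ + l) * Q.Tf) < Real.exp ((-Q.R * θ + l') * Q.Tf) :=
    Real.exp_lt_exp.2 (by linarith)
  have h6 : Real.exp (l * Q.Tf) < Real.exp (l' * Q.Tf) := Real.exp_lt_exp.2 hT
  have h7 := hQ.ε_nonneg
  have h8 : 0 ≤ 1 - Q.ε := by linarith [hQ.ε_le_one]
  have h9 : Real.exp ((-Q.R * θ + l) * Q.Tf) * (1 - Q.ε) + Real.exp (l * Q.Tf) * Q.ε <
      Real.exp ((-Q.R * θ + l') * Q.Tf) * (1 - Q.ε) + Real.exp (l' * Q.Tf) * Q.ε := by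
    rcases h7.eq_or_lt with h7 | h7
    · simpa [← h7] using h5
    · exact add_lt_add_of_le_of_lt (mul_le_mul_of_nonneg_right h5.le h8)
        (mul_lt_mul_of_pos_right h6 h7)
  have h10 : 0 ≤ Real.exp ((-Q.R * θ + l) * Q.Tf) * (1 - Q.ε) + Real.exp (l * Q.Tf) * Q.ε := by
    positivity
  refine add_lt_add_of_lt_of_le ?_ (mul_le_mul_of_nonneg_left h2 h4)
  exact mul_lt_mul' (mul_le_mul_of_nonneg_left h1 h3.le) h9 h10
    (mul_pos h3 (h1'.trans_le h1))

/-- At `l = 0` all generating functions are 1 and only the service factor is at most 1. At `l = R *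
θ` that factor is exactly 1 and everything else is at least 1. The intermediate value theorem
applies. -/
lemma exists_cyclePgf_eq_one (hQ : Q.Valid) {θ : ℝ} (hθ : 0 < θ) :
    ∃ l, 0 ≤ l ∧ Q.cyclePgf θ l = 1 := by
  have hR : 0 ≤ Q.R * θ := mul_nonneg hQ.R_nonneg hθ.le
  have h3 := one_sub_pow_pos hQ
  have h4 : 0 ≤ Q.p ^ Q.K := pow_nonneg hQ.p_nonneg _
  have h7 := hQ.ε_nonneg
  have h8 : 0 ≤ 1 - Q.ε := by linarith [hQ.ε_le_one]
  have hT := hQ.Tf_pos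
  have hlow : Q.cyclePgf θ 0 ≤ 1 := by
    rw [Params.cyclePgf, Real.exp_zero, deliveredPgf_one hQ, droppedPgf_one hQ]
    have : Real.exp ((-Q.R * θ + 0) * Q.Tf) ≤ 1 := Real.exp_le_one_iff.2 (by nlinarith)
    rw [zero_mul, Real.exp_zero]
    nlinarith [mul_le_mul_of_nonneg_right this h8]
  have hup : 1 ≤ Q.cyclePgf θ (Q.R * θ) := by
    have hexp : 1 ≤ Real.exp (Q.R * θ) := Real.one_le_exp hR
    have h1 := deliveredPgf_mono hQ one_pos hexp
    have h2 := droppedPgf_mono hQ one_pos hexp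
    rw [deliveredPgf_one hQ] at h1
    rw [droppedPgf_one hQ] at h2
    have h5 : 1 ≤ Real.exp (Q.R * θ * Q.Tf) := Real.one_le_exp (mul_nonneg hR hT.le)
    rw [Params.cyclePgf, show (-Q.R * θ + Q.R * θ) * Q.Tf = 0 by ring, Real.exp_zero]
    have h6 : 1 ≤ 1 * (1 - Q.ε) + Real.exp (Q.R * θ * Q.Tf) * Q.ε := by nlinarith
    have h9 := mul_le_mul h1 h6 zero_le_one (zero_le_one.trans h1)
    nlinarith
  obtain ⟨l, hl, h⟩ := intermediate_value_Icc hR (continuous_cyclePgf Q θ).continuousOn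
    ⟨hlow, hup⟩
  exact ⟨l, hl.1, h⟩

end Equation

/-! ### Effective capacity of the four-state model -/

section Capacity

lemma sum_state {M : Type*} [AddCommMonoid M] (f : State → M) :
    ∑ x, f x = f .on + (f .off1 + (f .off2 + f .off3)) := by
  have : (Finset.univ : Finset State) = {.on, .off1, .off2, .off3} := rfl
  rw [this]
  simp

/-! ### Almost sure properties of semi-Markov paths -/

section Generic

variable {Ω : Type*} [MeasurableSpace Ω] {μ : Measure Ω} [IsProbabilityMeasure μ]
  {P : Matrix State State ℝ} {F : State → Measure ℝ} {X : ℕ → Ω → State} {D : ℕ → Ω → ℝ}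

lemma IsSemiMarkov.measure_step (hS : IsSemiMarkov μ P F X D) (hF : ProperLaws P F) (n : ℕ)
    (x y : State) {B : Set ℝ} (hB : MeasurableSet B) :
    μ {ω | X n ω = x ∧ D n ω ∈ B ∧ X (n + 1) ω = y} =
      ENNReal.ofReal (P x y) * F x B * μ {ω | X n ω = x} := by
  have := hS.setLIntegral_past hF n x y hB (Φ := fun _ => 1)
    (@measurable_const _ _ _ (past X D n) _)
  simpa using this

lemma IsSemiMarkov.ae_sojourn_mem (hS : IsSemiMarkov μ P F X D) (hF : ProperLaws P F)
    {A : State → Set ℝ} (hA : ∀ x, MeasurableSet (A x)) (h : ∀ x, F x (A x)ᶜ = 0) :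
    ∀ᵐ ω ∂μ, ∀ n, D n ω ∈ A (X n ω) := by
  rw [ae_all_iff]
  intro n
  have h1 : ∀ᵐ ω ∂μ, ∀ x y, ¬ (X n ω = x ∧ D n ω ∈ (A x)ᶜ ∧ X (n + 1) ω = y) := by
    rw [ae_all_iff]; intro x
    rw [ae_all_iff]; intro y
    have := hS.measure_step hF n x y (hA x).compl
    rw [h x, mul_zero, zero_mul] at this
    exact measure_eq_zero_iff_ae_notMem.1 this
  filter_upwards [h1] with ω hω
  by_contra hc
  exact hω _ _ ⟨rfl, hc, rfl⟩

lemma IsSemiMarkov.ae_transition_ne_zero (hS : IsSemiMarkov μ P F X D) (hF : ProperLaws P F) :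
    ∀ᵐ ω ∂μ, ∀ n, P (X n ω) (X (n + 1) ω) ≠ 0 := by
  rw [ae_all_iff]
  intro n
  have h1 : ∀ᵐ ω ∂μ, ∀ x y, P x y = 0 →
      ¬ (X n ω = x ∧ D n ω ∈ Set.univ ∧ X (n + 1) ω = y) := by
    rw [ae_all_iff]; intro x
    rw [ae_all_iff]; intro y
    by_cases hxy : P x y = 0
    · have := hS.measure_step hF n x y MeasurableSet.univ
      rw [hxy, ENNReal.ofReal_zero, zero_mul, zero_mul] at this
      filter_upwards [measure_eq_zero_iff_ae_notMem.1 this] with ω hω _ using hω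
    · exact ae_of_all _ fun ω h => absurd h hxy
  filter_upwards [h1] with ω hω hc
  exact hω _ _ hc ⟨rfl, trivial, rfl⟩

end Generic

variable {Ω : Type*} [MeasurableSpace Ω] {μ : Measure Ω} {Q : Params} {Y : Noise Ω}

omit [MeasurableSpace Ω] in
lemma backoffTime_nonneg (hQ : Q.Valid) (Y : Noise Ω) (n j : ℕ) (ω : Ω) :
    0 ≤ Y.backoffTime Q n j ω :=
  Finset.sum_nonneg fun _ _ => (slotDuration_pos hQ _).le

omit [MeasurableSpace Ω] in
lemma collisions_mul_le_offTime (hQ : Q.Valid) (Y : Noise Ω) (n : ℕ) (ω : Ω) :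
    Y.collisions Q n ω * Q.Tc ≤ Y.offTime Q n ω :=
  le_add_of_nonneg_right (Finset.sum_nonneg fun j _ => backoffTime_nonneg hQ Y n j ω)

omit [MeasurableSpace Ω] in
lemma offTime_nonneg (hQ : Q.Valid) (Y : Noise Ω) (n : ℕ) (ω : Ω) : 0 ≤ Y.offTime Q n ω :=
  (mul_nonneg (Nat.cast_nonneg _) hQ.Tc_pos.le).trans (collisions_mul_le_offTime hQ Y n ω)

variable [IsProbabilityMeasure μ]

/-- There are at most `K` collisions and `K` backoffs, the `j`-th with fewer than `window j` slots,
each no longer than the sum of all slot durations. -/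
lemma Noise.IsLAA.exists_offTime_le (hQ : Q.Valid) (hY : Y.IsLAA Q μ) (n : ℕ) :
    ∃ B, ∀ᵐ ω ∂μ, Y.offTime Q n ω ≤ B := by
  set s := ∑ k, Q.slotDuration k
  have hs : ∀ k, Q.slotDuration k ≤ s := fun k =>
    Finset.single_le_sum (fun k _ => (slotDuration_pos hQ k).le) (Finset.mem_univ k)
  have hs0 : 0 ≤ s := Finset.sum_nonneg fun k _ => (slotDuration_pos hQ k).le
  refine ⟨Q.K * Q.Tc + ∑ j ∈ Finset.range Q.K, Q.window j * s, ?_⟩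
  filter_upwards [hY.ae_backoff_lt hQ] with ω hω
  have hb : ∀ j, Y.backoffTime Q n j ω ≤ Q.window j * s := fun j => by
    calc Y.backoffTime Q n j ω ≤ ∑ _d ∈ Finset.range (Y.backoff n j ω), s :=
          Finset.sum_le_sum fun d _ => hs _
      _ = Y.backoff n j ω * s := by simp
      _ ≤ _ := by
        have : (Y.backoff n j ω : ℝ) ≤ Q.window j := by exact_mod_cast (hω n j).le
        gcongr
  have hc : (Y.collisions Q n ω : ℝ) ≤ Q.K := by exact_mod_cast Y.collisions_le Q n ω
  refine add_le_add (mul_le_mul_of_nonneg_right hc hQ.Tc_pos.le) ?_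
  calc _ ≤ ∑ j ∈ Finset.range Q.K, Y.backoffTime Q n j ω :=
        Finset.sum_le_sum_of_subset_of_nonneg
          (Finset.range_subset_range.2 (min_le_right _ _))
          fun j _ _ => backoffTime_nonneg hQ Y n j ω
    _ ≤ _ := Finset.sum_le_sum fun j _ => hb j

/-- For `p = 0` the conditional measure is zero and so are both sides, which spares the later
arguments a case distinction. -/
lemma Noise.IsLAA.lintegral_dropped_eq_t2Hat (hQ : Q.Valid) (hY : Y.IsLAA Q μ) {z : ℝ}
    (hz : 0 < z) :
    ∫⁻ ω, ENNReal.ofReal (z ^ Y.offTime Q 0 ω) ∂(cond μ (Y.dropped Q 0)) =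
      ENNReal.ofReal (Y.t2Hat Q μ z) := by
  rcases hQ.p_nonneg.eq_or_lt with hp | hp
  · have h : μ (Y.dropped Q 0) = 0 := by
      have := hY.measureReal_dropped 0
      rw [← hp, zero_pow (Nat.one_le_iff_ne_zero.1 hQ.K_pos)] at this
      exact (measureReal_eq_zero_iff).1 this
    simp [Noise.t2Hat, pgf, cond_eq_zero_of_meas_eq_zero h]
  · rw [hY.lintegral_dropped hQ hz hp, hY.t2Hat_eq_droppedPgf hQ hz hp]

lemma Noise.IsLAA.capacityEquation_iff (hQ : Q.Valid) (hY : Y.IsLAA Q μ) (θ C : ℝ) :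
    Y.CapacityEquation Q μ θ C ↔ Q.cyclePgf θ (θ * C) = 1 := by
  rw [Noise.CapacityEquation, Params.cyclePgf, hY.t1Hat_eq_deliveredPgf hQ (Real.exp_pos _)]
  rcases hQ.p_nonneg.eq_or_lt with hp | hp
  · simp [← hp, zero_pow (Nat.one_le_iff_ne_zero.1 hQ.K_pos)]
  · rw [hY.t2Hat_eq_droppedPgf hQ (Real.exp_pos _) hp]

/-- A harmonic function of the four-state model. -/
noncomputable def Noise.potential (Y : Noise Ω) (Q : Params) (μ : Measure Ω) (θ l : ℝ) : State → ℝ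
  | .on => Real.exp (l * Q.Tf - Q.R * θ * Q.Tf)
  | .off1 => Real.exp (l * Q.Tf)
  | .off2 => Q.deliveredPgf (Real.exp l) *
      ((1 - Q.ε) * Real.exp (l * Q.Tf - Q.R * θ * Q.Tf) + Q.ε * Real.exp (l * Q.Tf))
  | .off3 => Y.t2Hat Q μ (Real.exp l)

omit [IsProbabilityMeasure μ] in
lemma t2Hat_nonneg (Y : Noise Ω) (Q : Params) {z : ℝ} (hz : 0 < z) : 0 ≤ Y.t2Hat Q μ z :=
  integral_nonneg fun _ => Real.rpow_nonneg hz.le _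

omit [IsProbabilityMeasure μ] in
lemma Noise.potential_off2_pos (hQ : Q.Valid) (Y : Noise Ω) (θ l : ℝ) :
    0 < Y.potential Q μ θ l .off2 := by
  refine mul_pos (deliveredPgf_pos hQ (Real.exp_pos l)) ?_
  have h7 := hQ.ε_nonneg
  have h8 : 0 ≤ 1 - Q.ε := by linarith [hQ.ε_le_one]
  rcases h7.eq_or_lt with h | h
  · simp [← h, Real.exp_pos]
  · positivity

omit [IsProbabilityMeasure μ] in
lemma Noise.potential_nonneg (hQ : Q.Valid) (Y : Noise Ω) (θ l : ℝ) (x : State) :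
    0 ≤ Y.potential Q μ θ l x := by
  cases x
  · exact (Real.exp_pos _).le
  · exact (Real.exp_pos _).le
  · exact (Y.potential_off2_pos hQ θ l).le
  · exact t2Hat_nonneg Y Q (Real.exp_pos l)

/-- Outside `off2` the mean of the potential at the next state is one and the same number, and the
equation says that it is 1. There the potential is just the mean weight of the visit; at `off2` that
mean is multiplied by the average over `on` and `off1`. -/
lemma Noise.IsLAA.isHarmonic (hQ : Q.Valid) (hY : Y.IsLAA Q μ) {θ l : ℝ}
    (hl : Q.cyclePgf θ l = 1) :
    IsHarmonic Q.transition (Y.sojournLaw Q μ) l (Q.R * θ) (Y.potential Q μ θ l) := by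
  have hF := hY.properLaws hQ
  set h := Y.potential Q μ θ l with hdef
  have hh : ∀ x, 0 ≤ h x := Y.potential_nonneg hQ θ l
  have hz := Real.exp_pos l
  -- All quantities are nonnegative, so harmonicity can be checked with real numbers once the mean
  -- weight `g` is known.
  have reduce : ∀ (x : State) (g : ℝ), 0 ≤ g →
      ∫⁻ d, ENNReal.ofReal (weight l (Q.R * θ) x d) ∂Y.sojournLaw Q μ x = ENNReal.ofReal g →
      h x = g * ∑ y, Q.transition x y * h y →
      ENNReal.ofReal (h x) = ∑ y, ENNReal.ofReal (Q.transition x y) *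
        (∫⁻ d, ENNReal.ofReal (weight l (Q.R * θ) x d) ∂Y.sojournLaw Q μ x) *
          ENNReal.ofReal (h y) := by
    intro x g hg hw hx
    rw [hw, hx, Finset.mul_sum, ENNReal.ofReal_sum_of_nonneg fun y _ =>
      mul_nonneg hg (mul_nonneg (hF.1 x y) (hh y))]
    refine Finset.sum_congr rfl fun y _ => ?_
    rw [ENNReal.ofReal_mul hg, ENNReal.ofReal_mul (hF.1 x y)]
    ring
  have hone : (1 - Q.p ^ Q.K) * h .off2 + Q.p ^ Q.K * h .off3 = 1 := by
    refine Eq.trans ?_ hl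
    rw [Params.cyclePgf, hdef]
    simp only [Noise.potential]
    have e : Real.exp ((-Q.R * θ + l) * Q.Tf) = Real.exp (l * Q.Tf - Q.R * θ * Q.Tf) := by
      ring_nf
    rw [e]
    rcases hQ.p_nonneg.eq_or_lt with hp | hp
    · rw [← hp, zero_pow (Nat.one_le_iff_ne_zero.1 hQ.K_pos)]
      ring
    · rw [hY.t2Hat_eq_droppedPgf hQ hz hp]
      ring
  have hsum : ∀ x, x ≠ .off2 → ∑ y, Q.transition x y * h y = 1 := by
    intro x hx
    rw [sum_state, transition_of_ne_off2 Q hx, ← hone]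
    simp [Params.initial]
  have hoff : ∀ (S : Set Ω) (x : State), x ≠ .on →
      Y.sojournLaw Q μ x = (cond μ S).map (Y.offTime Q 0) →
      ∫⁻ d, ENNReal.ofReal (weight l (Q.R * θ) x d) ∂Y.sojournLaw Q μ x =
        ∫⁻ ω, ENNReal.ofReal (Real.exp l ^ Y.offTime Q 0 ω) ∂(cond μ S) := by
    intro S x hx hS
    rw [hS, lintegral_map (measurable_weight _ _ _).ennreal_ofReal (hY.measurable_offTime' 0)]
    refine lintegral_congr fun ω => ?_
    rw [weight, if_neg hx, ← Real.exp_mul, mul_zero, sub_zero]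
  intro x
  cases x
  · refine reduce _ (h .on) (hh _) ?_ (by rw [hsum _ (by simp), mul_one])
    rw [Noise.sojournLaw, lintegral_dirac' _ (measurable_weight _ _ _).ennreal_ofReal]
    simp [weight, hdef, Noise.potential]
  · refine reduce _ (h .off1) (hh _) ?_ (by rw [hsum _ (by simp), mul_one])
    rw [Noise.sojournLaw, lintegral_dirac' _ (measurable_weight _ _ _).ennreal_ofReal]
    simp [weight, hdef, Noise.potential]
  · refine reduce _ (Q.deliveredPgf (Real.exp l)) (deliveredPgf_pos hQ hz).le ?_ ?_
    · rw [hoff (Y.delivered Q 0) _ (by simp) rfl, hY.lintegral_delivered hQ hz]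
    · rw [sum_state]
      simp [Params.transition, hdef, Noise.potential]
  · refine reduce _ (h .off3) (hh _) ?_ (by rw [hsum _ (by simp), mul_one])
    rw [hoff (Y.dropped Q 0) _ (by simp) rfl, hY.lintegral_dropped_eq_t2Hat hQ hz]
    rfl

/-- The sojourn times that can occur in each state, if off times are at most `B`. -/
def Params.sojournRange (Q : Params) (B : ℝ) : State → Set ℝ
  | .on => {Q.Tf}
  | .off1 => {Q.Tf}
  | .off2 => Set.Icc 0 B
  -- Empty for `p = 0`: membership of the sojourn time then rules out visits to `off3`, even as
  -- initial state.
  | .off3 => {d | d ∈ Set.Icc Q.Tc B ∧ 0 < Q.p}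

lemma Noise.IsLAA.exists_sojournRange (hQ : Q.Valid) (hY : Y.IsLAA Q μ) :
    ∃ B, ∀ x, MeasurableSet (Q.sojournRange B x) ∧
      Y.sojournLaw Q μ x (Q.sojournRange B x)ᶜ = 0 := by
  obtain ⟨B, hB⟩ := hY.exists_offTime_le hQ 0
  refine ⟨B, fun x => ?_⟩
  have hmeas : ∀ x, MeasurableSet (Q.sojournRange B x) := fun x => by
    cases x
    · exact measurableSet_singleton _
    · exact measurableSet_singleton _
    · exact measurableSet_Icc
    · exact measurableSet_Icc.inter (MeasurableSet.const (0 < Q.p))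
  have hdropm : MeasurableSet (Y.dropped Q 0) :=
    Noise.measurableSet_dropped fun j => hY.measurable (.collision 0 j)
  refine ⟨hmeas x, ?_⟩
  cases x
  · simp [Noise.sojournLaw, Params.sojournRange]
  · simp [Noise.sojournLaw, Params.sojournRange]
  · rw [Noise.sojournLaw, Measure.map_apply (hY.measurable_offTime' 0) (hmeas _).compl]
    refine measure_eq_zero_iff_ae_notMem.2 ?_
    filter_upwards [(cond_absolutelyContinuous (μ := μ)).ae_le hB] with ω hω h
    exact h ⟨offTime_nonneg hQ Y 0 ω, hω⟩
  · rw [Noise.sojournLaw, Measure.map_apply (hY.measurable_offTime' 0) (hmeas _).compl]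
    rcases hQ.p_nonneg.eq_or_lt with hp | hp
    · have h : μ (Y.dropped Q 0) = 0 := by
        have := hY.measureReal_dropped 0
        rw [← hp, zero_pow (Nat.one_le_iff_ne_zero.1 hQ.K_pos)] at this
        exact (measureReal_eq_zero_iff).1 this
      simp [cond_eq_zero_of_meas_eq_zero h]
    · refine measure_eq_zero_iff_ae_notMem.2 ?_
      filter_upwards [(cond_absolutelyContinuous (μ := μ)).ae_le hB, ae_cond_mem hdropm] with ω hω hd h
      refine h ⟨⟨?_, hω⟩, hp⟩
      refine le_trans ?_ (collisions_mul_le_offTime hQ Y 0 ω)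
      rw [show Y.collisions Q 0 ω = Q.K from hd]
      have : (1 : ℝ) ≤ Q.K := by exact_mod_cast hQ.K_pos
      nlinarith [hQ.Tc_pos]

/-- Only `off2` can have a sojourn of length zero, and the next state then lasts `Tf`. Only at
`off3` can the potential vanish, namely for `p = 0`, when that state is not visited. -/
lemma Noise.IsLAA.bounded (hQ : Q.Valid) (hY : Y.IsLAA Q μ) {Ω₁ : Type*} [MeasurableSpace Ω₁]
    {μ₁ : Measure Ω₁} [IsProbabilityMeasure μ₁] {X : ℕ → Ω₁ → State} {D : ℕ → Ω₁ → ℝ}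
    (hS : IsSemiMarkov μ₁ Q.transition (Y.sojournLaw Q μ) X D) (θ l : ℝ) :
    ∃ b m c c', 0 < m ∧ 0 < c ∧ Bounded μ₁ X D (Y.potential Q μ θ l) b m c c' := by
  have hF := hY.properLaws hQ
  obtain ⟨B, hB⟩ := hY.exists_sojournRange hQ
  have hD := hS.ae_sojourn_mem hF (fun x => (hB x).1) fun x => (hB x).2
  have hT := hS.ae_transition_ne_zero hF
  have hz := Real.exp_pos l
  set h := Y.potential Q μ θ l with hdef
  have hon : 0 < h .on := Real.exp_pos _
  have hoff1 : 0 < h .off1 := Real.exp_pos _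
  have hoff2 : 0 < h .off2 := Y.potential_off2_pos hQ θ l
  have hdrop := droppedPgf_pos hQ hz
  have hoff3 : 0 < Q.p → h .off3 = Q.droppedPgf (Real.exp l) := fun hp =>
    hY.t2Hat_eq_droppedPgf hQ hz hp
  set d := Q.droppedPgf (Real.exp l)
  have hTf := hQ.Tf_pos
  have hTc := hQ.Tc_pos
  have hnn : ∀ x, ∀ s ∈ Q.sojournRange B x, 0 ≤ s := by
    intro x s hs
    cases x
    · exact (Set.mem_singleton_iff.1 hs).symm ▸ hTf.le
    · exact (Set.mem_singleton_iff.1 hs).symm ▸ hTf.le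
    · exact hs.1
    · exact hTc.le.trans hs.1.1
  -- The closed form `d` replaces the potential at `off3`: it is positive even for `p = 0`, and
  -- equal to the potential whenever `off3` is visited.
  refine ⟨max Q.Tf B, min Q.Tf Q.Tc, min (min (h .on) (h .off1)) (min (h .off2) d),
    h .on + h .off1 + h .off2 + d, lt_min hTf hTc,
    lt_min (lt_min hon hoff1) (lt_min hoff2 hdrop), ?_, ?_, ?_, ?_, ?_⟩
  · filter_upwards [hD] with ω hω n using hnn _ _ (hω n)
  · filter_upwards [hD] with ω hω n
    have := hω n
    rcases hx : X n ω with _ | _ | _ | _ <;> rw [hx] at this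
    · exact (Set.mem_singleton_iff.1 this).trans_le (le_max_left _ _)
    · exact (Set.mem_singleton_iff.1 this).trans_le (le_max_left _ _)
    · exact this.2.trans (le_max_right _ _)
    · exact this.1.2.trans (le_max_right _ _)
  · filter_upwards [hD, hT] with ω hω hTω n
    have h0 := hω n
    have h1 := hω (n + 1)
    have h0' := hnn _ _ h0
    have h1' := hnn _ _ h1
    rcases hx : X n ω with _ | _ | _ | _ <;> rw [hx] at h0
    · rw [Set.mem_singleton_iff.1 h0]
      linarith [min_le_left Q.Tf Q.Tc]
    · rw [Set.mem_singleton_iff.1 h0]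
      linarith [min_le_left Q.Tf Q.Tc]
    · have h2 := hTω n
      rw [hx] at h2
      rcases hy : X (n + 1) ω with _ | _ | _ | _ <;> rw [hy] at h1 h2
      · rw [Set.mem_singleton_iff.1 h1]
        linarith [min_le_left Q.Tf Q.Tc]
      · rw [Set.mem_singleton_iff.1 h1]
        linarith [min_le_left Q.Tf Q.Tc]
      · exact absurd rfl h2
      · exact absurd rfl h2
    · linarith [min_le_right Q.Tf Q.Tc, h0.1.1]
  · filter_upwards [hD] with ω hω n
    have h0 := hω n
    rcases hx : X n ω with _ | _ | _ | _ <;> rw [hx] at h0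
    · exact (min_le_left _ _).trans (min_le_left _ _)
    · exact (min_le_left _ _).trans (min_le_right _ _)
    · exact (min_le_right _ _).trans (min_le_left _ _)
    · rw [hoff3 h0.2]
      exact (min_le_right _ _).trans (min_le_right _ _)
  · filter_upwards [hD] with ω hω n
    have h0 := hω n
    rcases hx : X n ω with _ | _ | _ | _ <;> rw [hx] at h0
    · linarith
    · linarith
    · linarith
    · rw [hoff3 h0.2]
      linarith

theorem Noise.IsLAA.hasEffectiveCapacity (hQ : Q.Valid) (hY : Y.IsLAA Q μ) {Ω₁ : Type*}
    [MeasurableSpace Ω₁] {μ₁ : Measure Ω₁} [IsProbabilityMeasure μ₁] {X : ℕ → Ω₁ → State}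
    {D : ℕ → Ω₁ → ℝ} (hS : IsSemiMarkov μ₁ Q.transition (Y.sojournLaw Q μ) X D) {θ l : ℝ}
    (hθ : 0 < θ) (hl0 : 0 ≤ l) (hl : Q.cyclePgf θ l = 1) :
    HasEffectiveCapacity μ₁ (service X D Q.R) θ (l / θ) := by
  obtain ⟨b, m, c, c', hm, hc, hb⟩ := hY.bounded hQ hS θ l
  exact hS.hasEffectiveCapacity (hY.properLaws hQ) hl0 hθ hQ.R_nonneg (hY.isHarmonic hQ hl) hm hc hb

end Capacity

/-! ### Timeslots in a network -/

section Contention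

lemma sum_card_eq_zero (n : ℕ) (v : ℝ) : (∑ A : Finset (Fin n), if A.card = 0 then
    v ^ A.card * (1 - v) ^ (n - A.card) else 0) = (1 - v) ^ n := by
  have : ∀ A : Finset (Fin n), A.card = 0 ↔ A = ∅ := fun A => Finset.card_eq_zero
  simp [this]

lemma sum_card_eq_one (n : ℕ) (v : ℝ) : (∑ A : Finset (Fin n), if A.card = 1 then
    v ^ A.card * (1 - v) ^ (n - A.card) else 0) = n * v * (1 - v) ^ (n - 1) := by
  have h1 : ∀ A : Finset (Fin n), (if A.card = 1 then v ^ A.card * (1 - v) ^ (n - A.card) else 0) =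
      if A.card = 1 then v * (1 - v) ^ (n - 1) else 0 := by
    intro A
    split_ifs with h
    · rw [h, pow_one]
    · rfl
  rw [Finset.sum_congr rfl fun A _ => h1 A, ← Finset.sum_filter, Finset.sum_const]
  have : (Finset.univ.filter fun A : Finset (Fin n) => A.card = 1) =
      Finset.powersetCard 1 Finset.univ := by
    ext A; simp [Finset.mem_powersetCard]
  rw [this, Finset.card_powersetCard]
  simp
  ring

lemma sum_card (n : ℕ) (v : ℝ) :
    ∑ A : Finset (Fin n), v ^ A.card * (1 - v) ^ (n - A.card) = 1 := by
  have := Fintype.sum_pow_mul_eq_add_pow (Fin n) v (1 - v)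
  simpa using this

/-- The total mass 1 minus the masses of no transmitter and of exactly one. -/
lemma sum_two_le_card (n : ℕ) (v : ℝ) : (∑ A : Finset (Fin n), if 2 ≤ A.card then
    v ^ A.card * (1 - v) ^ (n - A.card) else 0) =
      1 - (1 - v) ^ n - n * v * (1 - v) ^ (n - 1) := by
  refine Eq.trans ?_ (congrArg₂ (· - ·) (congrArg₂ (· - ·) (sum_card n v) (sum_card_eq_zero n v))
    (sum_card_eq_one n v))
  rw [← Finset.sum_sub_distrib, ← Finset.sum_sub_distrib]
  refine Finset.sum_congr rfl fun A _ => ?_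
  rcases lt_trichotomy A.card 1 with h | h | h
  · simp [Nat.lt_one_iff.1 h]
  · simp [h]
  · simp [show 2 ≤ A.card from h, show A ≠ ∅ by rintro rfl; simp at h, h.ne']

/-- A kind of slot that is described by separate conditions on the two numbers of transmitters has a
double sum that factors. -/
lemma contentionProb_eq_mul (N M : ℕ) (vL vW : ℝ) {k : SlotKind} {p q : ℕ → Prop}
    [DecidablePred p] [DecidablePred q] (h : ∀ a b, slotKind a b = k ↔ p a ∧ q b) :
    contentionProb N M vL vW k =
      (∑ A : Finset (Fin (N - 1)), if p A.card then
        vL ^ A.card * (1 - vL) ^ (N - 1 - A.card) else 0) *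
      ∑ B : Finset (Fin M), if q B.card then vW ^ B.card * (1 - vW) ^ (M - B.card) else 0 := by
  rw [contentionProb, Finset.sum_mul_sum]
  refine Finset.sum_congr rfl fun A _ => Finset.sum_congr rfl fun B _ => ?_
  simp only [h]
  by_cases h1 : p A.card <;> by_cases h2 : q B.card <;> simp [h1, h2]

lemma slotKind_eq_idle (a b : ℕ) : slotKind a b = .idle ↔ a = 0 ∧ b = 0 := by
  unfold slotKind; split_ifs <;> simp_all

lemma slotKind_eq_wifiCollision (a b : ℕ) : slotKind a b = .wifiCollision ↔ a = 0 ∧ 2 ≤ b := by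
  unfold slotKind; split_ifs <;> simp_all; omega

lemma slotKind_eq_laaCollision (a b : ℕ) : slotKind a b = .laaCollision ↔ 2 ≤ a ∧ b = 0 := by
  unfold slotKind; split_ifs <;> simp_all; omega

lemma slotKind_eq_wifiSuccess (a b : ℕ) : slotKind a b = .wifiSuccess ↔ a = 0 ∧ b = 1 := by
  unfold slotKind; split_ifs <;> simp_all

lemma slotKind_eq_laaSuccess (a b : ℕ) : slotKind a b = .laaSuccess ↔ a = 1 ∧ b = 0 := by
  unfold slotKind; split_ifs <;> simp_all

end Contention

end LAA

theorem theorem1 {Ω : Type*} [MeasurableSpace Ω] (μ : Measure Ω) [IsProbabilityMeasure μ]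
    (Q : LAA.Params) (hQ : Q.Valid) (Y : LAA.Noise Ω) (hY : Y.IsLAA Q μ) :
    -- the protocol is a four-state semi-Markov process
    LAA.IsSemiMarkov μ Q.transition (Y.sojournLaw Q μ) (Y.state Q) (Y.sojourn Q) ∧
    -- the effective capacity exists, and is the unique solution of the equation; it is the same
    -- for every semi-Markov process with these transition probabilities and sojourn laws,
    -- whatever its initial law
    (∀ θ : ℝ, 0 < θ → ∃ C : ℝ,
      Y.CapacityEquation Q μ θ C ∧
      (∀ C₁ : ℝ, Y.CapacityEquation Q μ θ C₁ → C₁ = C) ∧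
      LAA.HasEffectiveCapacity μ (LAA.service (Y.state Q) (Y.sojourn Q) Q.R) θ C ∧
      ∀ (Ω₁ : Type*) [MeasurableSpace Ω₁] (μ₁ : Measure Ω₁) [IsProbabilityMeasure μ₁]
        (X : ℕ → Ω₁ → LAA.State) (D : ℕ → Ω₁ → ℝ),
        LAA.IsSemiMarkov μ₁ Q.transition (Y.sojournLaw Q μ) X D →
        LAA.HasEffectiveCapacity μ₁ (LAA.service X D Q.R) θ C) ∧
    -- the generating functions
    (∀ z : ℝ, 0 < z →
      Y.t1Hat Q μ z =
        (∑ i ∈ Finset.range Q.K, (1 - Q.p) * Q.p ^ i * z ^ ((i : ℝ) * Q.Tc)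
          * ∏ j ∈ Finset.range (i + 1), Y.etaHat μ j (Y.tauHat Q μ z)) / (1 - Q.p ^ Q.K)) ∧
    (∀ z : ℝ, 0 < z → 0 < Q.p →
      Y.t2Hat Q μ z =
        z ^ ((Q.K : ℝ) * Q.Tc) * ∏ j ∈ Finset.range Q.K, Y.etaHat μ j (Y.tauHat Q μ z)) ∧
    (∀ (j : ℕ) (z : ℝ), 0 < z → z ≠ 1 →
      Y.etaHat μ j z = 1 / (Q.window j : ℝ) * ((1 - z ^ Q.window j) / (1 - z))) ∧
    (∀ j : ℕ, Y.etaHat μ j 1 = 1) ∧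
    (∀ z : ℝ, 0 < z → Y.tauHat Q μ z =
      Q.slotProb .idle * z ^ Q.sIdle + Q.slotProb .wifiCollision * z ^ Q.Tcw
        + Q.slotProb .laaCollision * z ^ Q.Tc + Q.slotProb .wifiSuccess * z ^ Q.Tsw
        + Q.slotProb .laaSuccess * z ^ Q.Tf + Q.slotProb .mixedCollision * z ^ Q.Twl) ∧
    -- the slot probabilities in a network of `N` LAA base stations and `M` WiFi nodes
    (∀ (N M : ℕ) (vL vW : ℝ), 1 ≤ N → 0 ≤ vL → vL ≤ 1 → 0 ≤ vW → vW ≤ 1 →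
      (∀ k, Q.slotProb k = LAA.contentionProb N M vL vW k) →
      Q.slotProb .idle = (1 - vL) ^ (N - 1) * (1 - vW) ^ M ∧
      Q.slotProb .wifiCollision =
        (1 - (1 - vW) ^ M - M * vW * (1 - vW) ^ (M - 1)) * (1 - vL) ^ (N - 1) ∧
      Q.slotProb .laaCollision =
        (1 - vW) ^ M * (1 - (1 - vL) ^ (N - 1) - ((N : ℝ) - 1) * vL * (1 - vL) ^ (N - 2)) ∧
      Q.slotProb .wifiSuccess = (1 - vL) ^ (N - 1) * (M * vW * (1 - vW) ^ (M - 1)) ∧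
      Q.slotProb .laaSuccess = (1 - vW) ^ M * (((N : ℝ) - 1) * vL * (1 - vL) ^ (N - 2)) ∧
      Q.slotProb .mixedCollision = 1 - Q.slotProb .idle - Q.slotProb .wifiCollision
        - Q.slotProb .laaCollision - Q.slotProb .wifiSuccess - Q.slotProb .laaSuccess) := by
  refine ⟨hY.isSemiMarkov hQ, fun θ hθ => ?_, fun z hz => ?_, fun z hz hp => ?_,
    fun j z hz hz1 => ?_, fun j => ?_, fun z hz => ?_, ?_⟩
  · obtain ⟨l, hl0, hl⟩ := LAA.exists_cyclePgf_eq_one hQ hθ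
    -- The equation is solved for `l = θ * C`.
    have hmul : θ * (l / θ) = l := mul_div_cancel₀ l hθ.ne'
    refine ⟨l / θ, ?_, fun C₁ hC₁ => ?_, hY.hasEffectiveCapacity hQ (hY.isSemiMarkov hQ) hθ hl0 hl,
      fun Ω₁ _ μ₁ _ X D hS => hY.hasEffectiveCapacity hQ hS hθ hl0 hl⟩
    · rwa [hY.capacityEquation_iff hQ, hmul]
    · rw [hY.capacityEquation_iff hQ] at hC₁
      rw [eq_div_iff hθ.ne', mul_comm]
      exact (LAA.strictMono_cyclePgf hQ θ).injective (hC₁.trans hl.symm)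
  · rw [hY.t1Hat_eq_deliveredPgf hQ hz, hY.tauHat_eq_slotPgf hQ hz]
    simp only [hY.etaHat_eq_timerPgf hQ _ (LAA.slotPgf_pos hQ hz)]
    rfl
  · rw [hY.t2Hat_eq_droppedPgf hQ hz hp, hY.tauHat_eq_slotPgf hQ hz]
    simp only [hY.etaHat_eq_timerPgf hQ _ (LAA.slotPgf_pos hQ hz)]
    rfl
  · rw [hY.etaHat_eq_timerPgf hQ j hz, LAA.timerPgf_of_ne_one Q j hz1]
  · rw [hY.etaHat_eq_timerPgf hQ j one_pos, LAA.timerPgf_one hQ]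
  · rw [hY.tauHat_eq_slotPgf hQ hz, LAA.slotPgf_eq]
  · intro N M vL vW hN _ _ _ _ hf
    -- Only here does `1 ≤ N` matter. For `N = 1` the truncated exponent `N - 2` is harmless, the
    -- factor `N - 1` being zero.
    have hcast : ((N - 1 : ℕ) : ℝ) = (N : ℝ) - 1 := by rw [Nat.cast_sub hN, Nat.cast_one]
    refine ⟨?_, ?_, ?_, ?_, ?_, ?_⟩
    · rw [hf, LAA.contentionProb_eq_mul N M vL vW LAA.slotKind_eq_idle, LAA.sum_card_eq_zero,
        LAA.sum_card_eq_zero]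
    · rw [hf, LAA.contentionProb_eq_mul N M vL vW LAA.slotKind_eq_wifiCollision,
        LAA.sum_card_eq_zero, LAA.sum_two_le_card, mul_comm]
    · rw [hf, LAA.contentionProb_eq_mul N M vL vW LAA.slotKind_eq_laaCollision,
        LAA.sum_card_eq_zero, LAA.sum_two_le_card, mul_comm, hcast, Nat.sub_sub]
    · rw [hf, LAA.contentionProb_eq_mul N M vL vW LAA.slotKind_eq_wifiSuccess,
        LAA.sum_card_eq_zero, LAA.sum_card_eq_one]
    · rw [hf, LAA.contentionProb_eq_mul N M vL vW LAA.slotKind_eq_laaSuccess,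
        LAA.sum_card_eq_zero, LAA.sum_card_eq_one, mul_comm, hcast, Nat.sub_sub]
    -- The last kind is obtained as the complement, since the probabilities sum to 1.
    · have huniv : (Finset.univ : Finset LAA.SlotKind) = {.idle, .wifiCollision, .laaCollision,
        .wifiSuccess, .laaSuccess, .mixedCollision} := rfl
      have hsum := hQ.slotProb_sum
      rw [huniv] at hsum
      simp at hsum
      linarith
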